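/- **Model.** Let $X\in\mathbb R^q$ be covariates, $U\in\mathbb R^r$ unmeasured confounders, $G\in\mathbb R$ an instrument, $P\in[p_1,p_2]$ ($0\le p_1\le p_2$) the price, $Y(p)$ the potential revenue at price $p$ and $Y=Y(P)$ the observed revenue, on a (standard Borel) probability space. Let $$\mathbb E[Y\mid P,G,X,U]=\beta_{p,1}(U,X)P+\beta_{p,2}(U,X)P^2+\beta_g(U,X,G)+\beta_{u,x}(U,X),\qquad \mathbb E[P\mid G,X,U]=\alpha_g(U,X,G)+\alpha_{u,x}(U,X),$$ with integrable coefficients. The revenue model is structural: for every policy $\pi$ (a measurable map from $\mathbb R^q$ to $[p_1,p_2]$), $Y(\pi(X))$ is integrable and $\mathbb E[Y(\pi(X))\mid G,X,U]$ is given by the same formula with $P$ replaced by $\pi(X)$. Put $\mathcal V(\pi)=\mathbb E[Y(\pi(X))]$ and let $\pi^*$ maximize $\mathcal V$ over all policies. **Identification assumptions.** $G\not\perp P\mid X$; $G\perp U\mid X$; and either (i) almost surely $\mathrm{Cov}(\beta_g(U,X,G),\mathbb E[P\mid G,U,X]\mid X,G)=0$ and $\mathrm{Cov}(\beta_{p,j}(U,X),\mathbb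 E[P^k\mid G,U,X]\mid X,G)=0$ for $j=1,2$, $k=1,2,3$, or (ii) there are random vectors $U_1,U_2$ such that $\beta_{p,1},\beta_{p,2},\beta_g$ depend on $U$ only through $U_1$ and $\alpha_g,\alpha_{u,x}$ only through $U_2$, with $U_1\perp U_2\mid (X,G)$ and $P\perp U_1\mid (X,U_2,G)$. **Residuals.** Let $Z=(Y,X,G,P)$. A parameter is $\alpha=(\beta_{p,1},\beta_{p,2},h_1,\dots,h_6)$, where $h_2$ is a function of $(x,g)$ and all others of $x$. With $e=P-h_2(X,G)$ and $v=h_3(X)-h_1(X)^2$, $W(Z;\alpha)\in\mathbb R^8$ has the entries $G-h_1$, $\ e$, $\ G^2-h_3$, $\ eY-h_4$, $\ Pe-h_5$, $\ P^2e-h_6$, $\ (G-h_1)e(Y-\beta_{p,1}P-\beta_{p,2}P^2)$, and $G(G-h_1)e(Y-\beta_{p,1}P-\beta_{p,2}P^2)-v(h_4-\beta_{p,1}h_5-\beta_{p,2}h_6)$ (functions evaluated at $X$). The true parameter $\alpha_0$ has $\beta_{p,j}(X)=\mathbb E[\beta_{p,j}(U,X)\mid X]$, $h_1=\mathbb E[G\mid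 X]$, $h_2=\mathbb E[P\mid X,G]$, $h_3=\mathbb E[G^2\mid X]$, $h_4=\mathbb E[eY\mid X]$, $h_5=\mathbb E[Pe\mid X]$, $h_6=\mathbb E[P^2e\mid X]$. Put $m(X;\alpha)=\mathbb E[W(Z;\alpha)\mid X]$, $\Sigma_\alpha(X)=\mathbb E[W(Z;\alpha)W(Z;\alpha)^\top\mid X]$, $\Phi(\alpha)=\mathbb E[m(X;\alpha)^\top\Sigma_{\alpha_0}(X)^{-1}m(X;\alpha)]$, $\|\alpha\|_{2,2}^2=\mathbb E\|\alpha(X,G)\|^2$, $\|f\|_{2,2}^2=\mathbb E\|f(X)\|^2$, and $$\|\alpha-\alpha_0\|_{ps,\alpha_0}^2=\mathbb E\big[\dot m^\top\Sigma_{\alpha_0}(X)^{-1}\dot m\big],\qquad \dot m=\tfrac{d}{dr}m(X;(1-r)\alpha_0+r\alpha)\big|_{r=0}.$$ **Spaces and estimator.** $\mathcal H\ni\alpha_0$ is a linear space of measurable parameters with norm $\|\cdot\|_{\mathcal H}$; $\mathcal F=\mathcal F_1\times\dots\times\mathcal F_8$ (which may depend on $n$) is a product of linear spaces of measurable functions $\mathbb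 R^q\to\mathbb R$ with norms $\|\cdot\|_{\mathcal F_i}$, and $\|f\|_{\mathcal F}^2=\sum_i\|f_i\|_{\mathcal F_i}^2$. For i.i.d. copies $Z_1,\dots,Z_n$ of $Z$, $\tilde\alpha\in\mathcal H$ and $\lambda_n,\mu_n>0$ let $$\hat\Phi_n(\alpha)=\sup_{f\in\mathcal F}\Big\{\tfrac1n\sum_i W(Z_i;\alpha)^\top f(X_i)-\tfrac1n\sum_i\{f(X_i)^\top W(Z_i;\tilde\alpha)\}^2-\lambda_n\|f\|_{\mathcal F}^2\Big\}+\mu_n\|\alpha\|_{\mathcal H}^2 .$$ The estimator $\hat\alpha_n\in\mathcal H$ is a function of the sample with $\hat\Phi_n(\hat\alpha_n)\le\inf_{\alpha\in\mathcal H}\hat\Phi_n(\alpha)+O_p(\eta_n)$, $0<\eta_n\to0$, and $\hat\pi=\min\{\max\{p_1,-\hat\beta_{p,1}/(2\hat\beta_{p,2})\},p_2\}$. **Complexity.** For a class $\mathcal G$ of real functions, $\mathcal R_n(\delta,\mathcal G)=\mathbb E\sup\{|\frac1n\sum_i\epsilon_ig(Z_i)|: g\in\mathcal G,\ \frac1n\sum_ig(Z_i)^2\le\delta^2\}$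 with i.i.d. Rademacher signs $\epsilon_i$; the critical radius of a vector-valued class with coordinate classes $\mathcal G|_k$ is the infimum of the $\delta>0$ with $\max_k\mathcal R_n(\delta,\mathrm{star}(\mathcal G|_k))\le\delta^2$, where $\mathrm{star}(\mathcal G)=\{rg:g\in\mathcal G,\ 0\le r\le1\}$. **Technical assumptions.** There are constants $A,B,L,\eta_\Sigma,c_\Sigma>0$ and sequences such that: 1. (Normalization) for all $\alpha$ with $\|\alpha\|_{\mathcal H}^2\le A$ and all $f$ with $\|f\|_{\mathcal F}^2\le B$, $\|\alpha(X,G)\|\le1$, $W(Z;\alpha)\in[-1,1]^8$ and $\|f(X)\|\le1$, outside a null set not depending on $\alpha,f$; the classes in 4 are pointwise measurable (each has a countable subclass that is sequentially dense for pointwise convergence). 2. $m(X;\alpha_0)=0$, and any $\alpha\in\mathcal H$ with $m(X;\alpha)=0$ a.s. has $\|\alpha-\alpha_0\|_{2,2}=0$. For all $\alpha$ with $\|\alpha\|_{\mathcal H}^2\le A$ there is $f\in\mathcal F$ with $\|f\|_{\mathcal F}\le L\|\alpha-\alpha_0\|_{\mathcal H}$ and $\|f-m(\cdot;\alpha)\|_{2,2}\le\eta_L$,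 where $0<\eta_L=\eta_{L,n}\to0$. 3. $\sigma_{\min}(\Sigma_\alpha(X))\ge c_\Sigma$ a.s. for each $\alpha\in\mathcal H$ with $\|\alpha-\alpha_0\|_{2,2}\le\eta_\Sigma$ and $\|\alpha-\alpha_0\|_{\mathcal H}\le\eta_\Sigma$, and $\tilde\alpha$ is such an $\alpha$. 4. $\delta_n=\bar\delta_n+C\sqrt{\log(1/\zeta)/n}$ with $C>0$, $\zeta\in(0,1)$, where $\bar\delta_n$ is at least the critical radii of $\{f:\|f\|_{\mathcal F}^2\le B\}$ and of $\{W(\cdot;\alpha)^\top f:\|\alpha\|_{\mathcal H}^2\le A,\ \|f\|_{\mathcal F}^2\le B,\ \|f\|_{\mathcal F}\le L\|\alpha-\alpha_0\|_{\mathcal H}\}$, and $\eta_{L}\lesssim\eta_n\asymp\lambda_n\asymp\mu_n\asymp\delta_n^2$. 5. (Curvature) With $\mathcal H_{\alpha_0,M_0,\epsilon}=\{\alpha\in\mathcal H:\|\alpha-\alpha_0\|_{2,2}\le\epsilon,\ \|\alpha\|_{2,2}\le M_0,\ \|\alpha\|_{\mathcal H}^2\le M_0\}$: for all $M_0,\epsilon>0$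 there is $c_{curv}>0$ with $\|\alpha-\alpha_0\|_{ps,\alpha_0}\le c_{curv}\sqrt{\Phi(\alpha)}$ on $\mathcal H_{\alpha_0,M_0,\epsilon}$. **Theorem (regret bound).** Under all of the above, if $-\beta_{p,2}(X)\ge c_{p,2}$ a.s. for a constant $c_{p,2}>0$, then for every $\epsilon>0$ and every $M_0>\max\{\|\alpha_0\|_{\mathcal H}^2,\|\alpha_0\|_{2,2}\}$, $$\mathcal V(\pi^*)-\mathcal V(\hat\pi)=O_p\big(\omega(\delta_n,\mathcal H_{\alpha_0,M_0,\epsilon})\big),\qquad \omega(\delta,\mathcal S)=\sup\{\|\alpha-\alpha_0\|_{2,2}:\alpha\in\mathcal S,\ \|\alpha-\alpha_0\|_{ps,\alpha_0}\le\delta\}.$$ -/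

import Mathlib

open MeasureTheory ProbabilityTheory Filter Topology Asymptotics

noncomputable section

namespace InvalidIVPricing

/-! ### Stochastic order and empirical process notions -/

/-- `T n = O_p(a n)` under the probability measures `P n`.  (On a non-measurable set a measure is the
outer measure, so no measurability of `T n` is needed.) -/
def IsBigOp {S : ℕ → Type*} [∀ n, MeasurableSpace (S n)] (P : ∀ n, Measure (S n))
    (T : ∀ n, S n → ℝ) (a : ℕ → ℝ) : Prop :=
  ∀ ζ : ℝ, 0 < ζ → ∃ C : ℝ, 0 < C ∧
    ∀ᶠ n in atTop, P n {D | C * a n < |T n D|} ≤ ENNReal.ofReal ζ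

/-- The law of an i.i.d. sample of size `n` from `Q`. -/
def sampleLaw {S : Type*} [MeasurableSpace S] (Q : Measure S) (n : ℕ) : Measure (Fin n → S) :=
  Measure.pi fun _ => Q

/-- The empirical norm `‖g‖_{n,2}`. -/
def empNorm {S : Type*} {n : ℕ} (s : Fin n → S) (g : S → ℝ) : ℝ :=
  √((1 / (n : ℝ)) * ∑ i, g (s i) ^ 2)

/-- The Rademacher sign attached to a coin toss. -/
def sign (b : Bool) : ℝ := if b then 1 else -1

/-- Local Rademacher complexity
`E_{ε, s} sup {|n⁻¹ ∑ ε_i g(s_i)| : g ∈ 𝒢, ‖g‖_{n,2} ≤ δ}`, with values in `[0, ∞]`. -/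
def localRademacher {S : Type*} [MeasurableSpace S] (Q : Measure S) (n : ℕ) (δ : ℝ)
    (𝒢 : Set (S → ℝ)) : ENNReal :=
  ∫⁻ s, (2 ^ n : ENNReal)⁻¹ * ∑ e : Fin n → Bool,
    ⨆ g ∈ {g | g ∈ 𝒢 ∧ empNorm s g ≤ δ},
      ENNReal.ofReal |(1 / (n : ℝ)) * ∑ i, sign (e i) * g (s i)| ∂(sampleLaw Q n)

/-- The star convex hull `{r g : g ∈ 𝒢, r ∈ [0, 1]}`. -/
def starHull {S : Type*} (𝒢 : Set (S → ℝ)) : Set (S → ℝ) :=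
  {h | ∃ g ∈ 𝒢, ∃ r : ℝ, 0 ≤ r ∧ r ≤ 1 ∧ h = r • g}

/-- The critical radius of a vector-valued class with coordinate projections `𝒢 k`: the smallest
`δ` with `max_k R_n(δ, star(𝒢 k)) ≤ δ²`. -/
def criticalRadius {S : Type*} [MeasurableSpace S] {d : ℕ} (Q : Measure S) (n : ℕ)
    (𝒢 : Fin d → Set (S → ℝ)) : ℝ :=
  sInf {δ : ℝ | 0 < δ ∧ ∀ k, localRademacher Q n δ (starHull (𝒢 k)) ≤ ENNReal.ofReal (δ ^ 2)}

/-- A pointwise measurable class: it has a countable subclass that is sequentially dense for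
pointwise convergence (so that suprema over the class are measurable). -/
def PointwiseMeasurable {S : Type*} (𝒢 : Set (S → ℝ)) : Prop :=
  ∃ 𝒟 ⊆ 𝒢, 𝒟.Countable ∧ ∀ g ∈ 𝒢, ∃ u : ℕ → S → ℝ, (∀ k, u k ∈ 𝒟) ∧
    ∀ s, Tendsto (fun k => u k s) atTop (𝓝 (g s))

/-- A (semi)normed linear space of functions: a linear subspace of `E` with its own norm. -/
structure NormedFunctionSpace (E : Type*) [AddCommGroup E] [Module ℝ E] where
  carrier : Submodule ℝ E
  norm : Seminorm ℝ carrier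

/-! ### The pricing model -/

/-- Covariates `X`, unmeasured confounders `U`, instrument `G`, price `P`, potential revenues
`Y(p)`, coefficient functions of the revenue and the price models, and the price range. -/
structure PricingModel (Ω : Type*) (q r : ℕ) where
  X : Ω → Fin q → ℝ
  U : Ω → Fin r → ℝ
  G : Ω → ℝ
  P : Ω → ℝ
  Ypot : ℝ → Ω → ℝ
  βp1 : (Fin r → ℝ) → (Fin q → ℝ) → ℝ
  βp2 : (Fin r → ℝ) → (Fin q → ℝ) → ℝ
  βg : (Fin r → ℝ) → (Fin q → ℝ) → ℝ → ℝ
  βux : (Fin r → ℝ) → (Fin q → ℝ) → ℝ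
  αg : (Fin r → ℝ) → (Fin q → ℝ) → ℝ → ℝ
  αux : (Fin r → ℝ) → (Fin q → ℝ) → ℝ
  p1 : ℝ
  p2 : ℝ

/-- Observations `z = (Y, X, G, P)`. -/
abbrev Obs (q : ℕ) := ℝ × (Fin q → ℝ) × ℝ × ℝ

def obsY {q : ℕ} (z : Obs q) : ℝ := z.1
def obsX {q : ℕ} (z : Obs q) : Fin q → ℝ := z.2.1
def obsG {q : ℕ} (z : Obs q) : ℝ := z.2.2.1
def obsP {q : ℕ} (z : Obs q) : ℝ := z.2.2.2

namespace PricingModel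

variable {Ω : Type*} {q r : ℕ} (M : PricingModel Ω q r)

/-- Observed revenue (consistency): `Y = Y(P)`. -/
def Y (ω : Ω) : ℝ := M.Ypot (M.P ω) ω

/-- The observed tuple. -/
def Z (ω : Ω) : Obs q := (M.Y ω, M.X ω, M.G ω, M.P ω)

/-- The conditional mean revenue at price `p` given `(G, X, U)`. -/
def meanRevenue (p : ℝ) (ω : Ω) : ℝ :=
  M.βp1 (M.U ω) (M.X ω) * p + M.βp2 (M.U ω) (M.X ω) * p ^ 2
    + M.βg (M.U ω) (M.X ω) (M.G ω) + M.βux (M.U ω) (M.X ω)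

/-- Pricing policies: measurable maps from covariates into `[p1, p2]`. -/
def IsPolicy (π : (Fin q → ℝ) → ℝ) : Prop :=
  Measurable π ∧ ∀ x, π x ∈ Set.Icc M.p1 M.p2

variable [MeasurableSpace Ω]

/-- The value `V(π) = E[Y(π(X))]`. -/
def value (μ : Measure Ω) (π : (Fin q → ℝ) → ℝ) : ℝ :=
  ∫ ω, M.Ypot (π (M.X ω)) ω ∂μ

/-- Optimal policies: maximizers of the value among all policies. -/
def IsOptimal (μ : Measure Ω) (π : (Fin q → ℝ) → ℝ) : Prop :=
  M.IsPolicy π ∧ ∀ π', M.IsPolicy π' → M.value μ π' ≤ M.value μ π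

/-- The observed and unobserved variables are measurable. -/
structure IsMeasurableModel : Prop where
  X : Measurable M.X
  U : Measurable M.U
  G : Measurable M.G
  P : Measurable M.P
  Ypot : Measurable (Function.uncurry M.Ypot)
  βp1 : Measurable (Function.uncurry M.βp1)
  βp2 : Measurable (Function.uncurry M.βp2)
  βg : Measurable fun t : (Fin r → ℝ) × (Fin q → ℝ) × ℝ => M.βg t.1 t.2.1 t.2.2
  βux : Measurable (Function.uncurry M.βux)
  αg : Measurable fun t : (Fin r → ℝ) × (Fin q → ℝ) × ℝ => M.αg t.1 t.2.1 t.2.2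
  αux : Measurable (Function.uncurry M.αux)

/-- The structural revenue and price models. -/
structure SatisfiesModels (μ : Measure Ω) : Prop where
  price_range : 0 ≤ M.p1 ∧ M.p1 ≤ M.p2 ∧ ∀ᵐ ω ∂μ, M.P ω ∈ Set.Icc M.p1 M.p2
  integrable_Y : Integrable M.Y μ
  integrable_βp1 : Integrable (fun ω => M.βp1 (M.U ω) (M.X ω)) μ
  integrable_βp2 : Integrable (fun ω => M.βp2 (M.U ω) (M.X ω)) μ
  integrable_βg : Integrable (fun ω => M.βg (M.U ω) (M.X ω) (M.G ω)) μ
  integrable_βux : Integrable (fun ω => M.βux (M.U ω) (M.X ω)) μ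
  /-- The revenue model for the observed revenue, `E[Y | P, G, X, U]`. -/
  revenue : μ[M.Y | MeasurableSpace.comap (fun ω => (M.P ω, M.G ω, M.X ω, M.U ω)) inferInstance]
    =ᵐ[μ] fun ω => M.meanRevenue (M.P ω) ω
  /-- The revenue model is structural: it governs the revenue when the price is set by a policy. -/
  intervention : ∀ π, M.IsPolicy π → Integrable (fun ω => M.Ypot (π (M.X ω)) ω) μ ∧
    μ[fun ω => M.Ypot (π (M.X ω)) ω |
        MeasurableSpace.comap (fun ω => (M.G ω, M.X ω, M.U ω)) inferInstance]
      =ᵐ[μ] fun ω => M.meanRevenue (π (M.X ω)) ω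
  /-- The price model. -/
  price : μ[M.P | MeasurableSpace.comap (fun ω => (M.G ω, M.X ω, M.U ω)) inferInstance]
    =ᵐ[μ] fun ω => M.αg (M.U ω) (M.X ω) (M.G ω) + M.αux (M.U ω) (M.X ω)

/-- The σ-algebra of `(X, G)`. -/
abbrev sigmaXG : MeasurableSpace Ω :=
  MeasurableSpace.comap (fun ω => (M.X ω, M.G ω)) inferInstance

/-- The σ-algebra of `(G, U, X)`. -/
abbrev sigmaGUX : MeasurableSpace Ω :=
  MeasurableSpace.comap (fun ω => (M.G ω, M.U ω, M.X ω)) inferInstance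

/-- Conditional covariance given the σ-algebra `m`. -/
def condCov (μ : Measure Ω) (m : MeasurableSpace Ω) (A B : Ω → ℝ) : Ω → ℝ :=
  μ[(A - μ[A | m]) * (B - μ[B | m]) | m]

/-- Orthogonality. -/
structure Orthogonality (μ : Measure Ω) : Prop where
  βg : condCov μ M.sigmaXG (fun ω => M.βg (M.U ω) (M.X ω) (M.G ω)) (μ[M.P | M.sigmaGUX]) =ᵐ[μ] 0
  βp1 : ∀ k ∈ Finset.Icc 1 3, condCov μ M.sigmaXG (fun ω => M.βp1 (M.U ω) (M.X ω))
    (μ[fun ω => M.P ω ^ k | M.sigmaGUX]) =ᵐ[μ] 0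
  βp2 : ∀ k ∈ Finset.Icc 1 3, condCov μ M.sigmaXG (fun ω => M.βp2 (M.U ω) (M.X ω))
    (μ[fun ω => M.P ω ^ k | M.sigmaGUX]) =ᵐ[μ] 0

variable {M}

/-- The sufficient condition for orthogonality: the unmeasured confounders split into `U₁`, which
drives the revenue coefficients, and `U₂`, which drives the price coefficients. -/
def SplitConfounders [StandardBorelSpace Ω] (μ : Measure Ω) [IsFiniteMeasure μ]
    (hM : M.IsMeasurableModel) : Prop :=
  ∃ (d₁ d₂ : ℕ) (U₁ : Ω → Fin d₁ → ℝ) (U₂ : Ω → Fin d₂ → ℝ) (_ : Measurable U₁)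
    (hU₂ : Measurable U₂),
    (∃ b : (Fin d₁ → ℝ) × (Fin q → ℝ) → ℝ, Measurable b ∧
      ∀ᵐ ω ∂μ, M.βp1 (M.U ω) (M.X ω) = b (U₁ ω, M.X ω)) ∧
    (∃ b : (Fin d₁ → ℝ) × (Fin q → ℝ) → ℝ, Measurable b ∧
      ∀ᵐ ω ∂μ, M.βp2 (M.U ω) (M.X ω) = b (U₁ ω, M.X ω)) ∧
    (∃ b : (Fin d₁ → ℝ) × (Fin q → ℝ) × ℝ → ℝ, Measurable b ∧
      ∀ᵐ ω ∂μ, M.βg (M.U ω) (M.X ω) (M.G ω) = b (U₁ ω, M.X ω, M.G ω)) ∧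
    (∃ a : (Fin d₂ → ℝ) × (Fin q → ℝ) × ℝ → ℝ, Measurable a ∧
      ∀ᵐ ω ∂μ, M.αg (M.U ω) (M.X ω) (M.G ω) = a (U₂ ω, M.X ω, M.G ω)) ∧
    (∃ a : (Fin d₂ → ℝ) × (Fin q → ℝ) → ℝ, Measurable a ∧
      ∀ᵐ ω ∂μ, M.αux (M.U ω) (M.X ω) = a (U₂ ω, M.X ω)) ∧
    CondIndepFun (MeasurableSpace.comap (fun ω => (M.X ω, M.G ω)) inferInstance)
      (hM.X.prodMk hM.G).comap_le U₁ U₂ μ ∧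
    CondIndepFun (MeasurableSpace.comap (fun ω => (M.X ω, U₂ ω, M.G ω)) inferInstance)
      (hM.X.prodMk (hU₂.prodMk hM.G)).comap_le M.P U₁ μ

/-- The identification assumptions: IV relevance, IV independence, and orthogonality or its
sufficient condition. -/
structure Identification [StandardBorelSpace Ω] (μ : Measure Ω) [IsFiniteMeasure μ]
    (hM : M.IsMeasurableModel) : Prop where
  relevance : ¬ CondIndepFun (MeasurableSpace.comap M.X inferInstance) hM.X.comap_le M.G M.P μ
  independence : CondIndepFun (MeasurableSpace.comap M.X inferInstance) hM.X.comap_le M.G M.U μ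
  orthogonality : M.Orthogonality μ ∨ SplitConfounders μ hM

end PricingModel

/-! ### Nuisance parameters and generalized residuals -/

/-- Parameters `α = (β_{p,1}, β_{p,2}, h₁, …, h₆)`.  The first component collects the seven
functions of `x`, namely `β_{p,1}, β_{p,2}, h₁, h₃, h₄, h₅, h₆`; the second one is `h₂(x, g)`. -/
abbrev Param (q : ℕ) := (Fin 7 → (Fin q → ℝ) → ℝ) × ((Fin q → ℝ) → ℝ → ℝ)

namespace Param

variable {q : ℕ} (α : Param q)

def β1 : (Fin q → ℝ) → ℝ := α.1 0
def β2 : (Fin q → ℝ) → ℝ := α.1 1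
def h1 : (Fin q → ℝ) → ℝ := α.1 2
def h3 : (Fin q → ℝ) → ℝ := α.1 3
def h4 : (Fin q → ℝ) → ℝ := α.1 4
def h5 : (Fin q → ℝ) → ℝ := α.1 5
def h6 : (Fin q → ℝ) → ℝ := α.1 6
def h2 : (Fin q → ℝ) → ℝ → ℝ := α.2

def IsMeas : Prop := (∀ k, Measurable (α.1 k)) ∧ Measurable (Function.uncurry α.2)

/-- `‖α(x, g)‖²`, the squared Euclidean norm of the value at `(x, g)`. -/
def sqAt (x : Fin q → ℝ) (g : ℝ) : ℝ := (∑ k, α.1 k x ^ 2) + α.2 x g ^ 2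

/-- The generalized residuals `W(z; α) = (w₁, …, w₈)`. -/
def W (z : Obs q) : Fin 8 → ℝ :=
  let y := obsY z
  let x := obsX z
  let g := obsG z
  let p := obsP z
  let e := p - α.h2 x g
  let v := α.h3 x - α.h1 x ^ 2
  ![g - α.h1 x,
    e,
    g ^ 2 - α.h3 x,
    e * y - α.h4 x,
    p * e - α.h5 x,
    p ^ 2 * e - α.h6 x,
    (g - α.h1 x) * e * y - ((g - α.h1 x) * e * p) * α.β1 x - ((g - α.h1 x) * e * p ^ 2) * α.β2 x,
    (g * (g - α.h1 x) * e * y - v * α.h4 x)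
      - (g * (g - α.h1 x) * e * p - v * α.h5 x) * α.β1 x
      - (g * (g - α.h1 x) * e * p ^ 2 - v * α.h6 x) * α.β2 x]

/-- The plug-in policy `min{max{p₁, -β₁ / (2 β₂)}, p₂}`. -/
def policy (p1 p2 : ℝ) (x : Fin q → ℝ) : ℝ :=
  min (max p1 (-α.β1 x / (2 * α.β2 x))) p2

/-- `α` is the true parameter of the model: `β_{p,j}(X) = E[β_{p,j}(U, X) | X]`, and `h₁, …, h₆`
are the nuisance conditional expectations. -/
structure IsTrue {Ω : Type*} [MeasurableSpace Ω] {r : ℕ} (M : PricingModel Ω q r)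
    (μ : Measure Ω) : Prop where
  β1 : (fun ω => α.β1 (M.X ω)) =ᵐ[μ]
    μ[fun ω => M.βp1 (M.U ω) (M.X ω) | MeasurableSpace.comap M.X inferInstance]
  β2 : (fun ω => α.β2 (M.X ω)) =ᵐ[μ]
    μ[fun ω => M.βp2 (M.U ω) (M.X ω) | MeasurableSpace.comap M.X inferInstance]
  h1 : (fun ω => α.h1 (M.X ω)) =ᵐ[μ] μ[M.G | MeasurableSpace.comap M.X inferInstance]
  h2 : (fun ω => α.h2 (M.X ω) (M.G ω)) =ᵐ[μ] μ[M.P | M.sigmaXG]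
  h3 : (fun ω => α.h3 (M.X ω)) =ᵐ[μ]
    μ[fun ω => M.G ω ^ 2 | MeasurableSpace.comap M.X inferInstance]
  h4 : (fun ω => α.h4 (M.X ω)) =ᵐ[μ]
    μ[fun ω => (M.P ω - α.h2 (M.X ω) (M.G ω)) * M.Y ω | MeasurableSpace.comap M.X inferInstance]
  h5 : (fun ω => α.h5 (M.X ω)) =ᵐ[μ]
    μ[fun ω => M.P ω * (M.P ω - α.h2 (M.X ω) (M.G ω)) | MeasurableSpace.comap M.X inferInstance]
  h6 : (fun ω => α.h6 (M.X ω)) =ᵐ[μ]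
    μ[fun ω => M.P ω ^ 2 * (M.P ω - α.h2 (M.X ω) (M.G ω)) |
      MeasurableSpace.comap M.X inferInstance]

end Param

/-! ### Population quantities; `Q` is the law of `Z = (Y, X, G, P)` -/

section Population

variable {q : ℕ} (Q : Measure (Obs q))

/-- The law of the covariates. -/
def lawX : Measure (Fin q → ℝ) := Q.map obsX

/-- `‖α‖_{2,2}`. -/
def normL2 (α : Param q) : ℝ := √(∫ z, α.sqAt (obsX z) (obsG z) ∂Q)

/-- `‖f‖_{2,2}` for functions of the covariates with values in `ℝ⁸`. -/
def normL2X (f : (Fin q → ℝ) → Fin 8 → ℝ) : ℝ := √(∫ x, ∑ k, f x k ^ 2 ∂(lawX Q))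

variable [IsFiniteMeasure Q]

/-- `m(x; α) = E[W(Z; α) | X = x]`, through the regular conditional law of `Z` given `X`. -/
def m (α : Param q) (x : Fin q → ℝ) : Fin 8 → ℝ :=
  fun k => ∫ z, α.W z k ∂(condDistrib id obsX Q x)

/-- `Σ_α(x) = E[W(Z; α) W(Z; α)ᵀ | X = x]`. -/
def Sig (α : Param q) (x : Fin q → ℝ) : Matrix (Fin 8) (Fin 8) ℝ :=
  Matrix.of fun j k => ∫ z, α.W z j * α.W z k ∂(condDistrib id obsX Q x)

/-- `Φ(α) = E[m(X; α)ᵀ Σ_{α₀}(X)⁻¹ m(X; α)]`. -/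
def Phi (α₀ α : Param q) : ℝ :=
  ∫ x, m Q α x ⬝ᵥ (Sig Q α₀ x)⁻¹.mulVec (m Q α x) ∂(lawX Q)

/-- The pathwise derivative `dm(x; α₀)/dα [α - α₀]`. -/
def pathDeriv (α₀ α : Param q) (x : Fin q → ℝ) : Fin 8 → ℝ :=
  fun k => deriv (fun t : ℝ => m Q ((1 - t) • α₀ + t • α) x k) 0

/-- The pseudometric `‖α₁ - α₂‖_{ps, α}` (with derivatives taken at `α₀`). -/
def psDist (α₀ α α₁ α₂ : Param q) : ℝ :=
  √(∫ x, (pathDeriv Q α₀ α₁ x - pathDeriv Q α₀ α₂ x) ⬝ᵥ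
    (Sig Q α x)⁻¹.mulVec (pathDeriv Q α₀ α₁ x - pathDeriv Q α₀ α₂ x) ∂(lawX Q))

variable (H : NormedFunctionSpace (Param q))

/-- The local space `H_{α₀, M₀, ε}`. -/
def localSpace (α₀ : H.carrier) (M₀ ε : ℝ) : Set H.carrier :=
  {α | normL2 Q (α - α₀ : H.carrier) ≤ ε ∧ normL2 Q α ≤ M₀ ∧ H.norm α ^ 2 ≤ M₀}

/-- The local modulus of continuity `ω(δ, S)` at `α₀`. -/
def modulus (α₀ : H.carrier) (δ : ℝ) (S : Set H.carrier) : ℝ :=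
  sSup ((fun α : H.carrier => normL2 Q (α - α₀ : H.carrier)) ''
    {α | α ∈ S ∧ psDist Q (α₀ : Param q) α₀ α α₀ ≤ δ})

end Population

/-! ### The adversary space and the min-max criterion -/

section Criterion

variable {q : ℕ}

/-- Elements of `F = F₁ × ⋯ × F₈`. -/
abbrev Adv (F : Fin 8 → NormedFunctionSpace ((Fin q → ℝ) → ℝ)) := ∀ k, (F k).carrier

variable {F : Fin 8 → NormedFunctionSpace ((Fin q → ℝ) → ℝ)}

/-- The value `f(x) ∈ ℝ⁸`. -/
def advAt (f : Adv F) (x : Fin q → ℝ) : Fin 8 → ℝ := fun k => (f k : (Fin q → ℝ) → ℝ) x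

/-- `‖f‖_F`, where `‖f‖_F² = ∑ ‖f_k‖²`. -/
def normF (f : Adv F) : ℝ := √(∑ k, (F k).norm (f k) ^ 2)

variable {n : ℕ} (D : Fin n → Obs q)

/-- `Ψ_n(α, f)`. -/
def PsiN (α : Param q) (f : Adv F) : ℝ :=
  (1 / (n : ℝ)) * ∑ i, α.W (D i) ⬝ᵥ advAt f (obsX (D i))

/-- `‖f‖²_{α, n}`. -/
def empWeightSq (α : Param q) (f : Adv F) : ℝ :=
  (1 / (n : ℝ)) * ∑ i, (advAt f (obsX (D i)) ⬝ᵥ α.W (D i)) ^ 2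

variable (F) in
/-- The penalized sample criterion `Φ̂_n(α)`. -/
def PhiHat (H : NormedFunctionSpace (Param q)) (αinit : Param q) (lam mu : ℝ) (α : H.carrier) :
    ℝ :=
  (⨆ f : Adv F, (PsiN D (α : Param q) f - empWeightSq D αinit f - lam * normF f ^ 2))
    + mu * H.norm α ^ 2

variable (F) in
/-- The coordinate classes of `F_B = {f : ‖f‖_F² ≤ B}`. -/
def advBall (B : ℝ) (k : Fin 8) : Set ((Fin q → ℝ) → ℝ) :=
  {g | ∃ f : Adv F, normF f ^ 2 ≤ B ∧ g = fun x => advAt f x k}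

variable (F) in
/-- `{W(·; α)ᵀ f(·) : α ∈ H_A, f ∈ F_B, ‖f‖_F ≤ L ‖α - α₀‖_H}`, a class of functions of `z`. -/
def productClass (H : NormedFunctionSpace (Param q)) (α₀ : H.carrier) (A B L : ℝ) :
    Set (Obs q → ℝ) :=
  {g | ∃ (α : H.carrier) (f : Adv F), H.norm α ^ 2 ≤ A ∧ normF f ^ 2 ≤ B ∧
    normF f ≤ L * H.norm (α - α₀) ∧ g = fun z => (α : Param q).W z ⬝ᵥ advAt f (obsX z)}

end Criterion

/-! ### Technical assumptions -/

section Assumptions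

variable {q : ℕ} (Q : Measure (Obs q)) [IsFiniteMeasure Q]
  (H : NormedFunctionSpace (Param q)) (F : ℕ → Fin 8 → NormedFunctionSpace ((Fin q → ℝ) → ℝ))
  (α₀ αinit : H.carrier)

/-- Measurability of the functions in the spaces and of suprema over the function classes. -/
structure MeasurableSpaces (A B L : ℝ) : Prop where
  H_meas : ∀ α : H.carrier, (α : Param q).IsMeas
  F_meas : ∀ n k, ∀ f : (F n k).carrier, Measurable (f : (Fin q → ℝ) → ℝ)
  F_sep : ∀ n k, PointwiseMeasurable (advBall (F n) B k)
  class_sep : ∀ n, PointwiseMeasurable (productClass (F n) H α₀ A B L)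

/-- Normalization: `‖α‖_{∞,2} ≤ 1` and `W(·; α) ∈ [-1, 1]⁸` on `H_A`, and `‖f‖_{∞,2} ≤ 1` on `F_B`.
The bounds hold on a set of probability one that does not depend on the function. -/
structure Normalized (A B : ℝ) : Prop where
  H_bound : ∀ᵐ z ∂Q, ∀ α : H.carrier, H.norm α ^ 2 ≤ A →
    (α : Param q).sqAt (obsX z) (obsG z) ≤ 1 ∧ ∀ k, |(α : Param q).W z k| ≤ 1
  F_bound : ∀ n, ∀ᵐ x ∂(lawX Q), ∀ f : Adv (F n), normF f ^ 2 ≤ B →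
    ∑ k, advAt f x k ^ 2 ≤ 1

/-- Identifiability and space conditions. -/
structure IdentifiabilityAndSpaces (A L : ℝ) (ηL : ℕ → ℝ) (ηS cS : ℝ) : Prop where
  moment : ∀ᵐ x ∂(lawX Q), m Q α₀ x = 0
  unique : ∀ α : H.carrier, (∀ᵐ x ∂(lawX Q), m Q α x = 0) →
    normL2 Q (α - α₀ : H.carrier) = 0
  ηL_pos : ∀ n, 0 < ηL n
  ηL_tendsto : Tendsto ηL atTop (𝓝 0)
  approx : ∀ n, ∀ α : H.carrier, H.norm α ^ 2 ≤ A →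
    ∃ f : Adv (F n), normF f ≤ L * H.norm (α - α₀) ∧
      normL2X Q (fun x => advAt f x - m Q α x) ≤ ηL n
  ηS_pos : 0 < ηS
  cS_pos : 0 < cS
  /-- `Σ_α(X)` is symmetric positive semidefinite, so this bounds its smallest singular value. -/
  nondegenerate : ∀ α : H.carrier, normL2 Q (α - α₀ : H.carrier) ≤ ηS → H.norm (α - α₀) ≤ ηS →
    ∀ᵐ x ∂(lawX Q), ∀ v : Fin 8 → ℝ, cS * (v ⬝ᵥ v) ≤ v ⬝ᵥ (Sig Q α x).mulVec v
  init : normL2 Q (αinit - α₀ : H.carrier) ≤ ηS ∧ H.norm (αinit - α₀) ≤ ηS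

/-- Rates of the tuning parameters: `δ_n = δ̄_n + C √(log(1/ζ)/n)`, where `δ̄_n` bounds the critical
radii, and `η_L ≲ η_n ≍ λ_n ≍ μ_n ≍ δ_n²`. -/
structure Parameters (A B L : ℝ) (ηL η lam mu δbar δ : ℕ → ℝ) : Prop where
  radius_F : ∀ n, criticalRadius (lawX Q) n (advBall (F n) B) ≤ δbar n
  radius_class : ∀ n,
    criticalRadius Q n (fun _ : Fin 1 => productClass (F n) H α₀ A B L) ≤ δbar n
  delta : ∃ C ζ : ℝ, 0 < C ∧ 0 < ζ ∧ ζ < 1 ∧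
    ∀ n : ℕ, δ n = δbar n + C * √(Real.log (1 / ζ) / n)
  η_pos : ∀ n, 0 < η n
  η_tendsto : Tendsto η atTop (𝓝 0)
  lam_pos : ∀ n, 0 < lam n
  mu_pos : ∀ n, 0 < mu n
  ηL_le : ηL =O[atTop] η
  η_lam : η =Θ[atTop] lam
  lam_mu : lam =Θ[atTop] mu
  mu_delta : mu =Θ[atTop] fun n => δ n ^ 2

/-- Sample criterion: `Φ̂_n(α̂_n) ≤ inf_{α ∈ H} Φ̂_n(α) + O_p(η_n)`. -/
def SampleCriterion (lam mu η : ℕ → ℝ) (αhat : ∀ n, (Fin n → Obs q) → H.carrier) : Prop :=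
  IsBigOp (sampleLaw Q)
    (fun n D => PhiHat (F n) D H αinit (lam n) (mu n) (αhat n D)
      - ⨅ α : H.carrier, PhiHat (F n) D H αinit (lam n) (mu n) α) η

/-- Curvature on the restricted space `H_{α₀, M₀, ε}`. -/
def LocalCurvature (M₀ ε : ℝ) : Prop :=
  ∃ c : ℝ, 0 < c ∧ ∀ α ∈ localSpace Q H α₀ M₀ ε,
    psDist Q (α₀ : Param q) α₀ α α₀ ≤ c * √(Phi Q α₀ α)

end Assumptions

end InvalidIVPricing

end

open InvalidIVPricing

noncomputable section

namespace InvalidIVPricing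

/-! ### Comparison of Rademacher processes -/

section Contraction

/-! The regret is controlled by the parameter error, and the parameter error by the modulus of
continuity.

Regret. Conditioning first on `(G, X, U)` and then on `X`, the value of a policy is, up to a
constant common to all policies, the mean of a parabola in the price whose coefficients are `β1` and
`β2` of `α₀` (`value_eq`). The plug-in price maximizes the estimated parabola whenever that one is
concave. Otherwise the estimate of the leading coefficient is off by at least `c`, and a crude bound
is enough (`quadratic_sub_clip_le`). So the regret is at most a constant times `‖α̂ - α₀‖_{2,2}`
(`regret_le`).

Deviations. Only an `O_p` statement is needed, so symmetrization in probability with Markov and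
Chebyshev suffices (`measure_exists_empMean_sub_gt_le`). With the contraction principle and the
star-shaped rescaling behind the critical radius, it gives uniform deviations of order `δ max(‖f‖,
δ)` for linear functionals and `θ max(‖f‖², (Kδ)²)`, with `θ` arbitrarily small, for quadratic ones.
The argument is run on countable classes stable under rational shrinking; pointwise limits then give
the original classes. The result is that samples are good with high probability
(`exists_measure_not_goodSample_le`).

Estimator. On a good sample the criterion at `α₀` is `O(δ²)`: the linear term has mean zero, and
nondegeneracy of `Σ` at the initial parameter makes the subtracted empirical square coercive. Near
minimality therefore bounds `‖α̂‖_H` and leaves every adversary a gain of at most `O(δ²)`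
(`exists_estimator_bound`). A small multiple of an adversary close to `m(·; α̂)` would gain a
multiple of `‖m(·; α̂)‖²`, up to `O(δ²)`, so this quantity is itself `O(δ²)`
(`exists_integral_vecSq_m_le`).

Large parameters. Normalization and approximation are assumed only on the ball `H_A`, whereas the
bound on `‖α̂‖_H` may be larger. Along a ray the residuals are polynomials of degree at most four,
so `W(·; α)` is a fixed combination of the residuals at five points `t_j α` inside `H_A`
(`exists_interpolation`).

Conclusion. Nondegeneracy and curvature turn `‖m(·; α̂)‖² = O(δ²)` into a pseudometric distance
`O(δ)`. Curvature is applied on a local space large enough to contain the whole ball of the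
estimator, so no separate consistency argument is needed. Finally, both the pseudometric and the
`L²` distance to `α₀` are homogeneous along segments from `α₀`; shrinking `α̂` towards `α₀` by a
fixed factor lands in the prescribed local space, at the cost of a constant
(`exists_normL2_le_modulus`). -/

lemma bddAbove_range_of_abs_le {ι : Type*} {f : ι → ℝ} {C : ℝ} (h : ∀ t, |f t| ≤ C) :
    BddAbove (Set.range f) :=
  ⟨C, by rintro _ ⟨t, rfl⟩; exact (le_abs_self _).trans (h t)⟩

lemma abs_sign (b : Bool) : |sign b| = 1 := by cases b <;> simp [sign]

lemma sign_not (b : Bool) : sign (!b) = -sign b := by cases b <;> simp [sign]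

/-- The contraction principle for a single sign. The pair of suprema is a supremum over pairs `(t,
u)`, in which only the difference `φ t - φ u` enters. -/
lemma iSup_add_iSup_sub_le {ι : Type*} [Nonempty ι] {a φ ψ : ι → ℝ} {C : ℝ}
    (ha : ∀ t, |a t| ≤ C) (hψ : ∀ t, |ψ t| ≤ C)
    (h : ∀ t u, |φ t - φ u| ≤ |ψ t - ψ u|) :
    (⨆ t, (a t + φ t)) + (⨆ t, (a t - φ t)) ≤ (⨆ t, (a t + ψ t)) + (⨆ t, (a t - ψ t)) := by
  have hb₁ : BddAbove (Set.range fun t => a t + ψ t) :=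
    bddAbove_range_of_abs_le (C := C + C) fun t =>
      (abs_add_le _ _).trans (add_le_add (ha t) (hψ t))
  have hb₂ : BddAbove (Set.range fun t => a t - ψ t) :=
    bddAbove_range_of_abs_le (C := C + C) fun t =>
      (abs_sub _ _).trans (add_le_add (ha t) (hψ t))
  have key : ∀ t u, (a t + φ t) + (a u - φ u) ≤
      (⨆ t, (a t + ψ t)) + (⨆ t, (a t - ψ t)) := by
    intro t u
    have h1 := le_ciSup hb₁ t
    have h2 := le_ciSup hb₂ u
    have h3 := le_ciSup hb₁ u
    have h4 := le_ciSup hb₂ t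
    have h5 := (le_abs_self _).trans (h t u)
    -- If `ψ t - ψ u` has the wrong sign, the roles of `t` and `u` are exchanged on the right; the
    -- terms `a t + a u` are symmetric.
    rcases abs_cases (ψ t - ψ u) with ⟨h6, -⟩ | ⟨h6, -⟩ <;> linarith
  have : ∀ t, (a t + φ t) ≤
      (⨆ t, (a t + ψ t)) + (⨆ t, (a t - ψ t)) - ⨆ t, (a t - φ t) := by
    intro t
    rw [le_sub_iff_add_le', ← le_sub_iff_add_le]
    exact ciSup_le fun u => by have := key t u; linarith
  have := ciSup_le this
  linarith

lemma sum_fin_succ_bool {n : ℕ} (f : (Fin (n + 1) → Bool) → ℝ) :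
    ∑ e, f e = ∑ e : Fin n → Bool, (f (Fin.cons true e) + f (Fin.cons false e)) := by
  rw [← (Fin.consEquiv fun _ => Bool).sum_comp, Fintype.sum_prod_type, Fintype.sum_bool,
    Finset.sum_add_distrib]
  rfl

/-- The contraction principle for Rademacher averages. -/
lemma sum_iSup_rademacher_le {ι : Type*} [Nonempty ι] {n : ℕ} :
    ∀ {a : ι → ℝ} {φ ψ : Fin n → ι → ℝ} {C : ℝ}, (∀ t, |a t| ≤ C) → (∀ i t, |φ i t| ≤ C) →
    (∀ i t, |ψ i t| ≤ C) → (∀ i t u, |φ i t - φ i u| ≤ |ψ i t - ψ i u|) →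
    ∑ e : Fin n → Bool, ⨆ t, (a t + ∑ i, sign (e i) * φ i t) ≤
      ∑ e : Fin n → Bool, ⨆ t, (a t + ∑ i, sign (e i) * ψ i t) := by
  induction n with
  | zero => intros; simp
  | succ n ih =>
    intro a φ ψ C ha hφ hψ h
    have hC : 0 ≤ C := (abs_nonneg _).trans (ha (Classical.arbitrary ι))
    -- Once the first sign is fixed, its term joins the drift `a`; this is why the induction carries
    -- an arbitrary bounded drift.
    have hcons : ∀ b : Bool,
        ∑ e : Fin n → Bool, ⨆ t, (a t + ∑ i, sign ((Fin.cons b e : Fin (n + 1) → Bool) i) * φ i t) ≤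
        ∑ e : Fin n → Bool, ⨆ t,
          ((a t + sign b * φ 0 t) + ∑ i, sign (e i) * ψ (Fin.succ i) t) := by
      intro b
      have := ih (a := fun t => a t + sign b * φ 0 t) (φ := fun i => φ i.succ)
        (ψ := fun i => ψ i.succ) (C := C + C)
        (fun t => (abs_add_le _ _).trans (add_le_add (ha t) (by
          rw [abs_mul, abs_sign, one_mul]; exact hφ 0 t)))
        (fun i t => (hφ _ t).trans (by linarith)) (fun i t => (hψ _ t).trans (by linarith))
        (fun i => h _)
      refine le_of_eq_of_le (Finset.sum_congr rfl fun e _ => ?_) this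
      congr 1; ext t
      rw [Fin.sum_univ_succ]; simp [add_assoc]
    rw [sum_fin_succ_bool, Finset.sum_add_distrib, sum_fin_succ_bool]
    refine (add_le_add (hcons true) (hcons false)).trans ?_
    rw [← Finset.sum_add_distrib]
    refine Finset.sum_le_sum fun e _ => ?_
    have hb : ∀ t, |a t + ∑ i, sign (e i) * ψ (Fin.succ i) t| ≤ C + n * C := by
      intro t
      refine (abs_add_le _ _).trans (add_le_add (ha t) ?_)
      refine (Finset.abs_sum_le_sum_abs _ _).trans ?_
      refine (Finset.sum_le_card_nsmul _ _ C fun i _ => ?_).trans (by simp)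
      rw [abs_mul, abs_sign, one_mul]; exact hψ _ t
    -- The remaining signs are now fixed, and the two values of the first sign form the pair of the
    -- one-sign lemma.
    have := iSup_add_iSup_sub_le (a := fun t => a t + ∑ i, sign (e i) * ψ (Fin.succ i) t)
      (φ := φ 0) (ψ := ψ 0) hb (fun t => (hψ 0 t).trans (by nlinarith [n.cast_nonneg (α := ℝ)]))
      (h 0)
    refine le_of_eq_of_le ?_ (this.trans (le_of_eq ?_))
    · congr 1 <;> congr 1 <;> ext t <;> simp [sign] <;> ring
    · congr 1 <;> congr 1 <;> ext t <;> rw [Fin.sum_univ_succ] <;> simp [sign] <;> ring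

/-- The contraction principle with absolute values, for processes that vanish at some index. -/
lemma sum_iSup_abs_rademacher_le {ι : Type*} {n : ℕ} {φ ψ : Fin n → ι → ℝ} {C κ : ℝ} (t₀ : ι)
    (hκ : 0 ≤ κ) (hφ₀ : ∀ i, φ i t₀ = 0) (hψ₀ : ∀ i, ψ i t₀ = 0)
    (hψ : ∀ i t, |ψ i t| ≤ C) (h : ∀ i t u, |φ i t - φ i u| ≤ κ * |ψ i t - ψ i u|) :
    ∑ e : Fin n → Bool, ⨆ t, ENNReal.ofReal |(1 / (n : ℝ)) * ∑ i, sign (e i) * φ i t| ≤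
      ENNReal.ofReal (2 * κ) *
        ∑ e : Fin n → Bool, ⨆ t, ENNReal.ofReal |(1 / (n : ℝ)) * ∑ i, sign (e i) * ψ i t| := by
  have : Nonempty ι := ⟨t₀⟩
  rcases Nat.eq_zero_or_pos n with rfl | hn
  · simp
  have hC : 0 ≤ C := (abs_nonneg _).trans (hψ ⟨0, hn⟩ t₀)
  set N : ℝ := 1 / n with hN
  have hN0 : 0 ≤ N := by positivity
  let φ' : Fin n → ι → ℝ := fun i t => N * φ i t
  let ψ' : Fin n → ι → ℝ := fun i t => N * (κ * ψ i t)
  let x : (Fin n → Bool) → ι → ℝ := fun e t => ∑ i, sign (e i) * φ' i t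
  let y : (Fin n → Bool) → ι → ℝ := fun e t => ∑ i, sign (e i) * ψ' i t
  have hφ : ∀ i t, |φ i t| ≤ κ * C := fun i t => by
    have := h i t t₀
    rw [hφ₀, hψ₀, sub_zero, sub_zero] at this
    exact this.trans (mul_le_mul_of_nonneg_left (hψ i t) hκ)
  have hφ' : ∀ i t, |φ' i t| ≤ N * (κ * C) := fun i t => by
    simp only [φ', abs_mul, abs_of_nonneg hN0]
    exact mul_le_mul_of_nonneg_left (hφ i t) hN0
  have hψ' : ∀ i t, |ψ' i t| ≤ N * (κ * C) := fun i t => by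
    simp only [ψ', abs_mul, abs_of_nonneg hN0, abs_of_nonneg hκ]
    have := hψ i t
    gcongr
  have hsum : ∀ (χ : Fin n → ι → ℝ) (D : ℝ), (∀ i t, |χ i t| ≤ D) → ∀ (e : Fin n → Bool) t,
      |∑ i, sign (e i) * χ i t| ≤ n * D := by
    intro χ D hχ e t
    refine (Finset.abs_sum_le_sum_abs _ _).trans ?_
    refine (Finset.sum_le_card_nsmul _ _ D fun i _ => ?_).trans (by simp)
    rw [abs_mul, abs_sign, one_mul]; exact hχ _ t
  have hxb : ∀ e t, |x e t| ≤ n * (N * (κ * C)) := fun e t => hsum φ' _ hφ' e t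
  have hyb : ∀ e t, |y e t| ≤ n * (N * (κ * C)) := fun e t => hsum ψ' _ hψ' e t
  have hx0 : ∀ e, x e t₀ = 0 := fun e => by simp [x, φ', hφ₀]
  have hy0 : ∀ e, y e t₀ = 0 := fun e => by simp [y, ψ', hψ₀]
  have hmain : ∑ e, ⨆ t, x e t ≤ ∑ e, ⨆ t, y e t := by
    have := sum_iSup_rademacher_le (n := n) (a := fun _ : ι => (0 : ℝ)) (φ := φ') (ψ := ψ')
      (C := N * (κ * C)) (fun t => by simp; positivity) hφ' hψ' (fun i t u => by
        simp only [φ', ψ', ← mul_sub, abs_mul, abs_of_nonneg hN0, abs_of_nonneg hκ]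
        exact mul_le_mul_of_nonneg_left (h i t u) hN0)
    simpa [x, y] using this
  have hxs : ∀ e, 0 ≤ ⨆ t, x e t := fun e =>
    (hx0 e).symm.le.trans (le_ciSup (bddAbove_range_of_abs_le (hxb e)) t₀)
  have hys : ∀ e, 0 ≤ ⨆ t, y e t := fun e =>
    (hy0 e).symm.le.trans (le_ciSup (bddAbove_range_of_abs_le (hyb e)) t₀)
  have hneg : ∀ e t, x (fun i => !e i) t = -x e t := fun e t => by
    simp [x, sign_not]
  -- Vanishing at `t₀` makes both one-sided suprema nonnegative, so their sum dominates the absolute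
  -- value. Flipping all signs permutes the sum over `e`; hence the factor 2.
  have h1 : ∀ e, (⨆ t, ENNReal.ofReal |N * ∑ i, sign (e i) * φ i t|) ≤
      ENNReal.ofReal (⨆ t, x e t) + ENNReal.ofReal (⨆ t, x (fun i => !e i) t) := by
    intro e
    refine iSup_le fun t => ?_
    have hx : N * ∑ i, sign (e i) * φ i t = x e t := by
      simp only [x, φ', Finset.mul_sum]
      exact Finset.sum_congr rfl fun i _ => by ring
    rw [hx, ← ENNReal.ofReal_add (hxs _) (hxs _)]
    refine ENNReal.ofReal_le_ofReal ?_
    have h1 := le_ciSup (bddAbove_range_of_abs_le (hxb e)) t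
    have h2 := le_ciSup (bddAbove_range_of_abs_le (hxb fun i => !e i)) t
    rw [hneg] at h2
    have := hxs e
    have := hxs fun i => !e i
    rcases abs_cases (x e t) with ⟨h6, -⟩ | ⟨h6, -⟩ <;> rw [h6] <;> linarith
  have h2 : ∀ e, ENNReal.ofReal (⨆ t, y e t) ≤ ENNReal.ofReal κ *
      ⨆ t, ENNReal.ofReal |N * ∑ i, sign (e i) * ψ i t| := by
    intro e
    rw [ENNReal.mul_iSup]
    have hy : ∀ t, ENNReal.ofReal κ * ENNReal.ofReal |N * ∑ i, sign (e i) * ψ i t| =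
        ENNReal.ofReal |y e t| := fun t => by
      rw [← ENNReal.ofReal_mul hκ]
      congr 1
      nth_rw 1 [← abs_of_nonneg hκ]
      rw [← abs_mul]
      congr 1
      simp only [y, ψ', Finset.mul_sum]
      exact Finset.sum_congr rfl fun i _ => by ring
    simp_rw [hy]
    have hfin : (⨆ t, ENNReal.ofReal |y e t|) ≠ ⊤ := ne_top_of_le_ne_top ENNReal.ofReal_ne_top
      (iSup_le fun t => ENNReal.ofReal_le_ofReal (hyb e t))
    refine ENNReal.ofReal_le_of_le_toReal (ciSup_le fun t => ?_)
    refine (le_abs_self _).trans ?_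
    rw [← ENNReal.ofReal_le_iff_le_toReal hfin]
    exact le_iSup (fun t => ENNReal.ofReal |y e t|) t
  let flip : (Fin n → Bool) ≃ (Fin n → Bool) :=
    Function.Involutive.toPerm (fun e i => !e i) fun e => by ext i; simp
  have hflip : ∑ e : Fin n → Bool, ENNReal.ofReal (⨆ t, x (fun i => !e i) t) =
      ∑ e, ENNReal.ofReal (⨆ t, x e t) :=
    flip.sum_comp fun e => ENNReal.ofReal (⨆ t, x e t)
  calc _ ≤ ∑ e, (ENNReal.ofReal (⨆ t, x e t) + ENNReal.ofReal (⨆ t, x (fun i => !e i) t)) :=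
        Finset.sum_le_sum fun e _ => h1 e
    _ = 2 * ENNReal.ofReal (∑ e, ⨆ t, x e t) := by
        rw [Finset.sum_add_distrib, hflip, ← two_mul, ENNReal.ofReal_sum_of_nonneg fun e _ => hxs e]
    _ ≤ 2 * ENNReal.ofReal (∑ e, ⨆ t, y e t) := by gcongr
    _ = 2 * ∑ e, ENNReal.ofReal (⨆ t, y e t) := by
        rw [ENNReal.ofReal_sum_of_nonneg fun e _ => hys e]
    _ ≤ 2 * ∑ e : Fin n → Bool,
          ENNReal.ofReal κ * ⨆ t, ENNReal.ofReal |N * ∑ i, sign (e i) * ψ i t| := by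
        gcongr with e; exact h2 e
    _ = _ := by
        rw [← Finset.mul_sum, ENNReal.ofReal_mul zero_le_two, mul_assoc]
        simp

end Contraction

/-! ### Symmetrization in probability -/

section Symmetrization

variable {S : Type*} [MeasurableSpace S]

/-- The empirical mean `n⁻¹ ∑ g(s_i)`. -/
def empMean {S : Type*} {n : ℕ} (s : Fin n → S) (g : S → ℝ) : ℝ := (1 / (n : ℝ)) * ∑ i, g (s i)

instance (Q : Measure S) [IsProbabilityMeasure Q] (n : ℕ) :
    IsProbabilityMeasure (sampleLaw Q n) := by unfold sampleLaw; infer_instance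

lemma measurable_empMean {n : ℕ} {g : S → ℝ} (hg : Measurable g) :
    Measurable fun s : Fin n → S => empMean s g := by
  unfold empMean; fun_prop

lemma empMean_nonneg {S : Type*} {n : ℕ} {g : S → ℝ} (hg : ∀ s, 0 ≤ g s) (s : Fin n → S) :
    0 ≤ empMean s g :=
  mul_nonneg (by positivity) (Finset.sum_nonneg fun _ _ => hg _)

lemma measurePreserving_eval_sampleLaw (Q : Measure S) [IsProbabilityMeasure Q] {n : ℕ}
    (i : Fin n) : MeasurePreserving (fun s : Fin n → S => s i) (sampleLaw Q n) Q :=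
  measurePreserving_eval (fun _ => Q) i

lemma ae_sampleLaw {Q : Measure S} [IsProbabilityMeasure Q] {n : ℕ} {p : S → Prop}
    (h : ∀ᵐ z ∂Q, p z) : ∀ᵐ s ∂(sampleLaw Q n), ∀ i, p (s i) :=
  ae_all_iff.2 fun i => (measurePreserving_eval_sampleLaw Q i).quasiMeasurePreserving.ae h

lemma integrable_empMean {Q : Measure S} [IsProbabilityMeasure Q] {n : ℕ} {g : S → ℝ}
    (hg : Integrable g Q) : Integrable (fun s : Fin n → S => empMean s g) (sampleLaw Q n) := by
  unfold empMean
  exact (integrable_finsetSum _ fun i _ =>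
    (measurePreserving_eval_sampleLaw Q i).integrable_comp_of_integrable hg).const_mul _

lemma integral_empMean {Q : Measure S} [IsProbabilityMeasure Q] {n : ℕ} (hn : 0 < n) {g : S → ℝ}
    (hg : Integrable g Q) : ∫ s, empMean (n := n) s g ∂(sampleLaw Q n) = ∫ z, g z ∂Q := by
  unfold empMean
  have hi : ∀ i : Fin n, Integrable (fun s : Fin n → S => g (s i)) (sampleLaw Q n) := fun i =>
    (measurePreserving_eval_sampleLaw Q i).integrable_comp_of_integrable hg
  rw [integral_const_mul, integral_finsetSum _ fun i _ => hi i]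
  have : ∀ i : Fin n, ∫ s, g (s i) ∂(sampleLaw Q n) = ∫ z, g z ∂Q := fun i => by
    have h := measurePreserving_eval_sampleLaw Q i
    have h2 := integral_map h.measurable.aemeasurable (f := g) (by
      rw [h.map_eq]; exact hg.aestronglyMeasurable)
    rw [h.map_eq] at h2
    exact h2.symm
  simp [this]
  field_simp

/-- Chebyshev's inequality for the empirical mean. -/
lemma measure_empMean_sub_gt_le {Q : Measure S} [IsProbabilityMeasure Q] {n : ℕ} (hn : 0 < n)
    {g : S → ℝ} (hg : MemLp g 2 Q) {t : ℝ} (ht : 0 < t) :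
    sampleLaw Q n {s | t < |empMean s g - ∫ z, g z ∂Q|} ≤
      ENNReal.ofReal ((∫ z, g z ^ 2 ∂Q) / (n * t ^ 2)) := by
  have hn' : (0 : ℝ) < n := by exact_mod_cast hn
  have hL : MemLp (fun s : Fin n → S => empMean s g) 2 (sampleLaw Q n) := by
    unfold empMean
    exact (memLp_finsetSum _ fun i _ =>
      hg.comp_measurePreserving (measurePreserving_eval_sampleLaw Q i)).const_mul _
  have hi := integral_empMean (Q := Q) hn (hg.integrable one_le_two)
  have hvar : Var[fun s : Fin n → S => empMean s g; sampleLaw Q n] = Var[g; Q] / n := by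
    have h1 : (fun s : Fin n → S => empMean s g) =
        fun s => (1 / (n : ℝ)) * (∑ i, fun s : Fin n → S => g (s i)) s := by
      ext s; simp [empMean]
    have h2 : Var[∑ i, fun s : Fin n → S => g (s i); sampleLaw Q n] = n * Var[g; Q] := by
      unfold sampleLaw
      rw [variance_sum_pi (μ := fun _ : Fin n => Q) (X := fun _ => g) fun _ => hg]
      simp
    rw [h1, variance_const_mul, h2]
    field_simp
  have hch := meas_ge_le_variance_div_sq hL ht
  rw [hi, hvar] at hch
  refine (measure_mono fun s hs => ?_).trans (hch.trans (ENNReal.ofReal_le_ofReal ?_))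
  · exact (show t < |empMean s g - ∫ z, g z ∂Q| from hs).le
  · have : Var[g; Q] ≤ ∫ z, g z ^ 2 ∂Q := variance_le_expectation_sq hg.aestronglyMeasurable
    rw [div_div]
    gcongr

lemma measure_empMean_gt_le {Q : Measure S} [IsProbabilityMeasure Q] {n : ℕ} (hn : 0 < n)
    {g : S → ℝ} (hg : Integrable g Q) (h0 : ∀ z, 0 ≤ g z) {ρ : ℝ} (hρ : 0 < ρ) :
    sampleLaw Q n {s | ρ < empMean s g} ≤ ENNReal.ofReal ((∫ z, g z ∂Q) / ρ) := by
  have h := mul_meas_ge_le_integral_of_nonneg (ae_of_all _ fun s => empMean_nonneg h0 s)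
    (integrable_empMean (n := n) hg) ρ
  rw [integral_empMean hn hg] at h
  rw [← ENNReal.ofReal_toReal (measure_ne_top (sampleLaw Q n) {s | ρ < empMean s g})]
  refine ENNReal.ofReal_le_ofReal ?_
  rw [le_div_iff₀' hρ]
  refine le_trans (mul_le_mul_of_nonneg_left ?_ hρ.le) h
  exact measureReal_mono fun s (hs : ρ < _) => hs.le

/-- The ghost sample inequality. -/
lemma measure_le_two_mul_prod {A B : Type*} [MeasurableSpace A] [MeasurableSpace B]
    {μ : Measure A} {ν : Measure B} [SFinite ν] {E : Set A} {E' : Set (A × B)}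
    (h : ∀ x ∈ E, (2 : ENNReal)⁻¹ ≤ ν {y | (x, y) ∈ E'}) : μ E ≤ 2 * (μ.prod ν) E' := by
  -- Markov is applied to the sections of a measurable hull of `E'`, so neither `E` nor `E'` has to
  -- be measurable.
  have hm := measurableSet_toMeasurable (μ.prod ν) E'
  rw [← measure_toMeasurable E', Measure.prod_apply hm]
  have h1 := mul_meas_ge_le_lintegral (μ := μ) (measurable_measure_prodMk_left (ν := ν) hm)
    (2 : ENNReal)⁻¹
  have h2 : μ E ≤ μ {x | (2 : ENNReal)⁻¹ ≤
      ν (Prod.mk x ⁻¹' toMeasurable (μ.prod ν) E')} :=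
    measure_mono fun x hx => (h x hx).trans (measure_mono fun y hy =>
      subset_toMeasurable (μ.prod ν) E' hy)
  calc μ E = 2 * ((2 : ENNReal)⁻¹ * μ E) := by
        rw [← mul_assoc, ENNReal.mul_inv_cancel two_ne_zero ENNReal.ofNat_ne_top, one_mul]
    _ ≤ _ := by gcongr; exact (mul_le_mul_right h2 _).trans h1

/-- Exchange the `i`-th entries of a pair of samples when `e i` is false. -/
def exchange {S : Type*} {n : ℕ} (e : Fin n → Bool) (w : (Fin n → S) × (Fin n → S)) :
    (Fin n → S) × (Fin n → S) :=
  (fun i => if e i then w.1 i else w.2 i, fun i => if e i then w.2 i else w.1 i)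

lemma measurePreserving_exchange (Q : Measure S) [IsProbabilityMeasure Q] {n : ℕ}
    (e : Fin n → Bool) : MeasurePreserving (exchange e)
      ((sampleLaw Q n).prod (sampleLaw Q n)) ((sampleLaw Q n).prod (sampleLaw Q n)) := by
  have h1 := measurePreserving_arrowProdEquivProdArrow S S (Fin n) (fun _ => Q) (fun _ => Q)
  have h2 : MeasurePreserving
      (fun (w : Fin n → S × S) i => (if e i then id else Prod.swap) (w i))
      (Measure.pi fun _ => Q.prod Q) (Measure.pi fun _ => Q.prod Q) := by
    refine measurePreserving_pi (fun _ => Q.prod Q) (fun _ => Q.prod Q) fun i => ?_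
    split_ifs
    · exact MeasurePreserving.id _
    · exact Measure.measurePreserving_swap
  have h3 := (h1.comp h2).comp h1.symm
  unfold sampleLaw
  convert h3 using 1
  ext w i <;> simp [exchange, MeasurableEquiv.arrowProdEquivProdArrow,
    Equiv.arrowProdEquivProdArrow, Function.comp] <;> split_ifs <;> rfl

/-- Symmetrization that keeps the localization `empMean s (N i) ≤ ρ`: an independent ghost sample
replaces the mean, and exchanging entries of the two samples introduces signs while leaving the sum
of the two empirical values of `N i` unchanged. This is why the radius only doubles. The constant is
2 (ghost sample) times 2 (two samples) times `4 / t` (Markov). -/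
lemma measure_exists_empMean_sub_gt_le {ι : Type*} [Countable ι] {Q : Measure S}
    [IsProbabilityMeasure Q] {n : ℕ} (hn : 0 < n) {a N : ι → S → ℝ} (ha : ∀ i, Measurable (a i))
    (hN : ∀ i, Measurable (N i)) (hN0 : ∀ i s, 0 ≤ N i s) (hNi : ∀ i, Integrable (N i) Q)
    (hai : ∀ i, MemLp (a i) 2 Q) {ρ t : ℝ} (hρ : 0 < ρ) (ht : 0 < t)
    (hNρ : ∀ i, ∫ z, N i z ∂Q ≤ ρ / 4) (hat : ∀ i, ∫ z, a i z ^ 2 ∂Q ≤ n * t ^ 2 / 16) :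
    sampleLaw Q n {s | ∃ i, empMean s (N i) ≤ ρ ∧ t < |empMean s (a i) - ∫ z, a i z ∂Q|} ≤
      ENNReal.ofReal (16 / t) * ∫⁻ s, (2 ^ n : ENNReal)⁻¹ * ∑ e : Fin n → Bool,
        ⨆ i, ⨆ (_ : empMean s (N i) ≤ 2 * ρ),
          ENNReal.ofReal |(1 / (n : ℝ)) * ∑ j, sign (e j) * a i (s j)| ∂(sampleLaw Q n) := by
  have hn' : (0 : ℝ) < n := by exact_mod_cast hn
  set P := sampleLaw Q n with hP
  let E' : Set ((Fin n → S) × (Fin n → S)) := {w | ∃ i,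
    t / 2 < |empMean w.1 (a i) - empMean w.2 (a i)| ∧
      empMean w.1 (N i) + empMean w.2 (N i) ≤ 2 * ρ}
  have hmA : ∀ i, Measurable fun s : Fin n → S => empMean s (a i) := fun i =>
    measurable_empMean (ha i)
  have hmN : ∀ i, Measurable fun s : Fin n → S => empMean s (N i) := fun i =>
    measurable_empMean (hN i)
  have hE' : MeasurableSet E' := by
    have : E' = ⋃ i, ({w | t / 2 < |empMean w.1 (a i) - empMean w.2 (a i)|} ∩
      {w | empMean w.1 (N i) + empMean w.2 (N i) ≤ 2 * ρ}) := by
      ext w; simp [E']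
    rw [this]
    refine MeasurableSet.iUnion fun i => ?_
    have h1 : Measurable fun w : (Fin n → S) × (Fin n → S) => empMean w.1 (a i) :=
      (hmA i).comp measurable_fst
    have h2 : Measurable fun w : (Fin n → S) × (Fin n → S) => empMean w.2 (a i) :=
      (hmA i).comp measurable_snd
    have h3 : Measurable fun w : (Fin n → S) × (Fin n → S) => empMean w.1 (N i) :=
      (hmN i).comp measurable_fst
    have h4 : Measurable fun w : (Fin n → S) × (Fin n → S) => empMean w.2 (N i) :=
      (hmN i).comp measurable_snd
    exact (measurableSet_lt measurable_const (h1.sub h2).abs).inter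
      (measurableSet_le (h3.add h4) measurable_const)
  -- For a fixed `i`, Markov for `N i` and Chebyshev for `a i` each fail with probability at most
  -- 1/4.
  have hghost : ∀ i, (2 : ENNReal)⁻¹ ≤
      P {s | empMean s (N i) ≤ ρ ∧ |empMean s (a i) - ∫ z, a i z ∂Q| ≤ t / 2} := by
    intro i
    have hms : MeasurableSet
        {s : Fin n → S | empMean s (N i) ≤ ρ ∧ |empMean s (a i) - ∫ z, a i z ∂Q| ≤ t / 2} :=
      (measurableSet_le (hmN i) measurable_const).inter
        (measurableSet_le ((hmA i).sub_const _).abs measurable_const)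
    have h1 := measure_empMean_gt_le (n := n) hn (hNi i) (hN0 i) hρ
    have h2 := measure_empMean_sub_gt_le (n := n) hn (hai i) (half_pos ht)
    have hc : P {s | empMean s (N i) ≤ ρ ∧ |empMean s (a i) - ∫ z, a i z ∂Q| ≤ t / 2}ᶜ ≤
        2⁻¹ := by
      refine (measure_mono (t := {s | ρ < empMean s (N i)} ∪
        {s | t / 2 < |empMean s (a i) - ∫ z, a i z ∂Q|}) fun s hs => ?_).trans ?_
      · simp only [Set.mem_compl_iff, Set.mem_ofPred_eq, not_and_or, not_le] at hs
        exact hs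
      · refine (measure_union_le _ _).trans ((add_le_add h1 h2).trans ?_)
        rw [← ENNReal.ofReal_add (div_nonneg (integral_nonneg (hN0 i)) hρ.le)
          (div_nonneg (integral_nonneg fun _ => sq_nonneg _) (by positivity))]
        have : (2 : ENNReal)⁻¹ = ENNReal.ofReal (1 / 2) := by
          rw [one_div, ENNReal.ofReal_inv_of_pos two_pos]; simp
        rw [this]
        refine ENNReal.ofReal_le_ofReal ?_
        have e1 : (∫ z, N i z ∂Q) / ρ ≤ 1 / 4 := by
          rw [div_le_iff₀ hρ]; linarith [hNρ i]
        have e2 : (∫ z, a i z ^ 2 ∂Q) / (n * (t / 2) ^ 2) ≤ 1 / 4 := by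
          rw [div_le_iff₀ (by positivity)]; nlinarith [hat i]
        linarith
    rw [prob_compl_eq_one_sub hms] at hc
    have := tsub_le_iff_left.1 hc
    by_contra hlt
    push Not at hlt
    have h3 : (1 : ENNReal) < 2⁻¹ + 2⁻¹ := this.trans_lt (by
      gcongr
      simp)
    rw [ENNReal.inv_two_add_inv_two] at h3
    exact lt_irrefl _ h3
  have hghost : P {s | ∃ i, empMean s (N i) ≤ ρ ∧ t < |empMean s (a i) - ∫ z, a i z ∂Q|} ≤
      2 * (P.prod P) E' := by
    refine measure_le_two_mul_prod fun s hs => ?_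
    obtain ⟨i, hi1, hi2⟩ := hs
    refine (hghost i).trans (measure_mono fun s' hs' => ⟨i, ?_, ?_⟩)
    · have := abs_sub_abs_le_abs_sub (empMean s (a i) - ∫ z, a i z ∂Q)
        (empMean s' (a i) - ∫ z, a i z ∂Q)
      rw [sub_sub_sub_cancel_right] at this
      have := hs'.2
      dsimp only at *
      linarith
    · have := hs'.1
      dsimp only at *
      linarith
  let Be : (Fin n → Bool) → Set (Fin n → S) := fun e => {s | ∃ i,
    t / 4 < |(1 / (n : ℝ)) * ∑ j, sign (e j) * a i (s j)| ∧ empMean s (N i) ≤ 2 * ρ}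
  -- After the exchange, the difference of means is a difference of two signed averages. One of them
  -- exceeds `t / 4`, and nonnegativity of `N i` bounds its own localization by `2 * ρ`.
  have hswap : ∀ e, (P.prod P) E' ≤ 2 * P (Be e) := by
    intro e
    rw [← (measurePreserving_exchange Q e).measure_preimage hE'.nullMeasurableSet]
    refine (measure_mono (t := Prod.fst ⁻¹' Be e ∪ Prod.snd ⁻¹' Be e) ?_).trans ?_
    · rintro w ⟨i, hi1, hi2⟩
      have hN' : empMean (exchange e w).1 (N i) + empMean (exchange e w).2 (N i) =
          empMean w.1 (N i) + empMean w.2 (N i) := by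
        simp only [empMean, ← mul_add, ← Finset.sum_add_distrib]
        congr 1
        refine Finset.sum_congr rfl fun j _ => ?_
        simp only [exchange]
        split_ifs <;> ring
      have ha' : empMean (exchange e w).1 (a i) - empMean (exchange e w).2 (a i) =
          (1 / (n : ℝ)) * ∑ j, sign (e j) * a i (w.1 j)
            - (1 / (n : ℝ)) * ∑ j, sign (e j) * a i (w.2 j) := by
        simp only [empMean, ← mul_sub, ← Finset.sum_sub_distrib]
        congr 1
        refine Finset.sum_congr rfl fun j _ => ?_
        simp only [exchange, sign]
        split_ifs <;> ring
      rw [hN'] at hi2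
      rw [ha'] at hi1
      have hn1 := empMean_nonneg (hN0 i) w.1
      have hn2 := empMean_nonneg (hN0 i) w.2
      have := abs_sub ((1 / (n : ℝ)) * ∑ j, sign (e j) * a i (w.1 j))
        ((1 / (n : ℝ)) * ∑ j, sign (e j) * a i (w.2 j))
      by_cases hc : t / 4 < |(1 / (n : ℝ)) * ∑ j, sign (e j) * a i (w.1 j)|
      · exact Or.inl ⟨i, hc, by linarith⟩
      · exact Or.inr ⟨i, by push Not at hc; linarith, by linarith⟩
    · have hf : (P.prod P) (Prod.fst ⁻¹' Be e) ≤ P (Be e) :=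
        (measurePreserving_fst (μ := P) (ν := P)).measure_preimage_le _
      have hs : (P.prod P) (Prod.snd ⁻¹' Be e) ≤ P (Be e) :=
        (measurePreserving_snd (μ := P) (ν := P)).measure_preimage_le _
      rw [two_mul]
      exact (measure_union_le _ _).trans (add_le_add hf hs)
  let F : (Fin n → Bool) → (Fin n → S) → ENNReal := fun e s =>
    ⨆ i, ⨆ (_ : empMean s (N i) ≤ 2 * ρ),
      ENNReal.ofReal |(1 / (n : ℝ)) * ∑ j, sign (e j) * a i (s j)|
  have hF : ∀ e, Measurable (F e) := by
    intro e
    refine Measurable.iSup fun i => ?_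
    have hx : Measurable fun s : Fin n → S =>
        ENNReal.ofReal |(1 / (n : ℝ)) * ∑ j, sign (e j) * a i (s j)| := by
      have := ha i
      fun_prop
    have hs : MeasurableSet {s : Fin n → S | empMean s (N i) ≤ 2 * ρ} :=
      measurableSet_le (hmN i) measurable_const
    convert hx.indicator hs using 1
    ext s
    by_cases h : empMean s (N i) ≤ 2 * ρ <;> simp [h, Set.indicator]
  have hmarkov : ∀ e, P (Be e) ≤ ENNReal.ofReal (4 / t) * ∫⁻ s, F e s ∂P := by
    intro e
    have h1 := mul_meas_ge_le_lintegral (μ := P) (hF e) (ENNReal.ofReal (t / 4))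
    have h2 : P (Be e) ≤ P {s | ENNReal.ofReal (t / 4) ≤ F e s} := by
      refine measure_mono fun s hs => ?_
      obtain ⟨i, hi1, hi2⟩ := hs
      exact (ENNReal.ofReal_le_ofReal hi1.le).trans (le_iSup₂_of_le i hi2 le_rfl)
    calc P (Be e) = ENNReal.ofReal (4 / t) * (ENNReal.ofReal (t / 4) * P (Be e)) := by
          rw [← mul_assoc, ← ENNReal.ofReal_mul (by positivity)]
          have : 4 / t * (t / 4) = 1 := by field_simp
          rw [this]; simp
      _ ≤ _ := by gcongr; exact (mul_le_mul_right h2 _).trans h1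
  have hcard : (2 ^ n : ENNReal)⁻¹ * ∑ _e : Fin n → Bool, (P.prod P) E' = (P.prod P) E' := by
    rw [Finset.sum_const, Finset.card_univ, Fintype.card_fun, Fintype.card_bool, Fintype.card_fin,
      nsmul_eq_mul, ← mul_assoc]
    push_cast
    rw [ENNReal.inv_mul_cancel (by positivity) (by simp), one_mul]
  calc _ ≤ 2 * (P.prod P) E' := hghost
    _ = 2 * ((2 ^ n : ENNReal)⁻¹ * ∑ _e : Fin n → Bool, (P.prod P) E') := by rw [hcard]
    _ ≤ 2 * ((2 ^ n : ENNReal)⁻¹ * ∑ e : Fin n → Bool,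
          2 * (ENNReal.ofReal (4 / t) * ∫⁻ s, F e s ∂P)) := by
        gcongr with e
        exact (hswap e).trans (by gcongr; exact hmarkov e)
    _ = ENNReal.ofReal (16 / t) * ∫⁻ s, (2 ^ n : ENNReal)⁻¹ * ∑ e, F e s ∂P := by
        rw [lintegral_const_mul' _ _ (by simp), lintegral_finsetSum _ fun e _ => hF e,
          ← Finset.mul_sum, ← Finset.mul_sum]
        have : ENNReal.ofReal (16 / t) = 4 * ENNReal.ofReal (4 / t) := by
          rw [← ENNReal.ofReal_ofNat 4, ← ENNReal.ofReal_mul (by norm_num)]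
          congr 1; ring
        rw [this, show (4 : ENNReal) = 2 * 2 by norm_num]
        ring

end Symmetrization

/-! ### Local Rademacher averages -/

section RademacherAverages

variable {S : Type*}

/-- The Rademacher average conditional on the sample. -/
def radAvg {n : ℕ} (s : Fin n → S) (δ : ℝ) (𝒢 : Set (S → ℝ)) : ENNReal :=
  (2 ^ n : ENNReal)⁻¹ * ∑ e : Fin n → Bool,
    ⨆ g ∈ {g | g ∈ 𝒢 ∧ empNorm s g ≤ δ},
      ENNReal.ofReal |(1 / (n : ℝ)) * ∑ i, sign (e i) * g (s i)|

lemma localRademacher_eq [MeasurableSpace S] (Q : Measure S) (n : ℕ) (δ : ℝ) (𝒢 : Set (S → ℝ)) :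
    localRademacher Q n δ 𝒢 = ∫⁻ s, radAvg s δ 𝒢 ∂(sampleLaw Q n) := rfl

lemma radAvg_mono {n : ℕ} (s : Fin n → S) (δ : ℝ) {𝒢 𝒢' : Set (S → ℝ)} (h : 𝒢 ⊆ 𝒢') :
    radAvg s δ 𝒢 ≤ radAvg s δ 𝒢' := by
  unfold radAvg
  refine mul_le_mul_right (Finset.sum_le_sum fun e _ => ?_) _
  exact biSup_mono fun g hg => ⟨h hg.1, hg.2⟩

lemma localRademacher_mono [MeasurableSpace S] (Q : Measure S) (n : ℕ) (δ : ℝ)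
    {𝒢 𝒢' : Set (S → ℝ)} (h : 𝒢 ⊆ 𝒢') : localRademacher Q n δ 𝒢 ≤ localRademacher Q n δ 𝒢' :=
  lintegral_mono fun s => radAvg_mono s δ h

lemma empNorm_smul {n : ℕ} (s : Fin n → S) (g : S → ℝ) {r : ℝ} (hr : 0 ≤ r) :
    empNorm s (r • g) = r * empNorm s g := by
  unfold empNorm
  rw [← Real.sqrt_sq hr, ← Real.sqrt_mul (sq_nonneg r), Real.sqrt_sq hr]
  congr 1
  simp only [Pi.smul_apply, smul_eq_mul, mul_pow, ← Finset.mul_sum]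
  ring

/-- Multiplication by `r` carries the part of the class of empirical radius `τ` into the part of
radius `δ`. Consequently the complexity of a star-shaped class grows at most linearly in the radius.
-/
lemma radAvg_le_of_smul {n : ℕ} (s : Fin n → S) {𝒢 : Set (S → ℝ)} {r τ δ : ℝ} (hr : 0 < r)
    (hs : ∀ g ∈ 𝒢, r • g ∈ 𝒢) (hτ : r * τ ≤ δ) :
    radAvg s τ 𝒢 ≤ ENNReal.ofReal (1 / r) * radAvg s δ 𝒢 := by
  unfold radAvg
  rw [mul_left_comm, Finset.mul_sum _ _ (ENNReal.ofReal (1 / r))]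
  refine mul_le_mul_right (Finset.sum_le_sum fun e _ => ?_) _
  refine iSup₂_le fun g hg => ?_
  have h1 : (1 / (n : ℝ)) * ∑ i, sign (e i) * g (s i) =
      (1 / r) * ((1 / (n : ℝ)) * ∑ i, sign (e i) * (r • g) (s i)) := by
    simp only [Pi.smul_apply, smul_eq_mul, mul_left_comm _ r, ← Finset.mul_sum]
    field_simp
  rw [h1, abs_mul, ENNReal.ofReal_mul (abs_nonneg _), abs_of_pos (by positivity)]
  gcongr
  refine le_iSup₂_of_le (r • g) ⟨hs g hg.1, ?_⟩ le_rfl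
  rw [empNorm_smul s g hr.le]
  exact (mul_le_mul_of_nonneg_left hg.2 hr.le).trans hτ

lemma localRademacher_le_of_smul [MeasurableSpace S] (Q : Measure S) (n : ℕ) {𝒢 : Set (S → ℝ)}
    {r τ δ : ℝ} (hr : 0 < r) (hs : ∀ g ∈ 𝒢, r • g ∈ 𝒢) (hτ : r * τ ≤ δ) :
    localRademacher Q n τ 𝒢 ≤ ENNReal.ofReal (1 / r) * localRademacher Q n δ 𝒢 := by
  rw [localRademacher_eq, localRademacher_eq, ← lintegral_const_mul' _ _ ENNReal.ofReal_ne_top]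
  exact lintegral_mono fun s => radAvg_le_of_smul s hr hs hτ

lemma abs_rademacher_le_empNorm {n : ℕ} (s : Fin n → S) (g : S → ℝ) (e : Fin n → Bool) :
    |(1 / (n : ℝ)) * ∑ i, sign (e i) * g (s i)| ≤ empNorm s g := by
  unfold empNorm
  refine Real.abs_le_sqrt ?_
  rcases Nat.eq_zero_or_pos n with rfl | hn
  · simp
  have hn' : (0 : ℝ) < n := by exact_mod_cast hn
  have h := Finset.sum_mul_sq_le_sq_mul_sq Finset.univ (fun i => sign (e i)) fun i => g (s i)
  have h1 : ∀ i, sign (e i) ^ 2 = 1 := fun i => by rw [← sq_abs, abs_sign, one_pow]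
  simp only [h1, Finset.sum_const, Finset.card_univ, Fintype.card_fin, nsmul_eq_mul, mul_one] at h
  rw [mul_pow, div_pow, one_pow, sq (n : ℝ), div_mul_eq_mul_div, one_mul, div_mul_eq_mul_div,
    one_mul, div_le_div_iff₀ (by positivity) hn']
  nlinarith

/-- Cauchy–Schwarz bounds each signed average by the empirical norm. In particular `δ = 1` always
satisfies the critical inequality, so the critical radius is an infimum over a nonempty set. -/
lemma localRademacher_le_self [MeasurableSpace S] (Q : Measure S) [IsProbabilityMeasure Q] (n : ℕ)
    (δ : ℝ) (𝒢 : Set (S → ℝ)) : localRademacher Q n δ 𝒢 ≤ ENNReal.ofReal δ := by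
  rw [localRademacher_eq]
  have : ∀ s : Fin n → S, radAvg s δ 𝒢 ≤ ENNReal.ofReal δ := by
    intro s
    unfold radAvg
    calc _ ≤ (2 ^ n : ENNReal)⁻¹ * ∑ _e : Fin n → Bool, ENNReal.ofReal δ := by
          gcongr with e
          exact iSup₂_le fun g hg =>
            ENNReal.ofReal_le_ofReal ((abs_rademacher_le_empNorm s g e).trans hg.2)
      _ = ENNReal.ofReal δ := by
          rw [Finset.sum_const, Finset.card_univ, Fintype.card_fun, Fintype.card_bool,
            Fintype.card_fin, nsmul_eq_mul, ← mul_assoc]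
          push_cast
          rw [ENNReal.inv_mul_cancel (by positivity) (by simp), one_mul]
  exact (lintegral_mono this).trans (by simp)

lemma starHull_smul_mem {𝒢 : Set (S → ℝ)} {r : ℝ} (h0 : 0 ≤ r) (h1 : r ≤ 1) :
    ∀ g ∈ starHull 𝒢, r • g ∈ starHull 𝒢 := by
  rintro _ ⟨g, hg, r', h0', h1', rfl⟩
  exact ⟨g, hg, r * r', mul_nonneg h0 h0', mul_le_one₀ h1 h0' h1', smul_smul _ _ _⟩

lemma criticalRadius_nonneg [MeasurableSpace S] {d : ℕ} (Q : Measure S) (n : ℕ)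
    (𝒢 : Fin d → Set (S → ℝ)) : 0 ≤ criticalRadius Q n 𝒢 :=
  Real.sInf_nonneg fun _ h => h.1.le

/-- Above the critical radius, the local Rademacher complexity is below the parabola. -/
lemma localRademacher_le_sq [MeasurableSpace S] {d : ℕ} (Q : Measure S) [IsProbabilityMeasure Q]
    (n : ℕ) (𝒢 : Fin d → Set (S → ℝ)) {δ : ℝ} (hδ : criticalRadius Q n 𝒢 < δ) (k : Fin d) :
    localRademacher Q n δ (starHull (𝒢 k)) ≤ ENNReal.ofReal (δ ^ 2) := by
  have hne : {δ : ℝ | 0 < δ ∧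
      ∀ k, localRademacher Q n δ (starHull (𝒢 k)) ≤ ENNReal.ofReal (δ ^ 2)}.Nonempty :=
    ⟨1, one_pos, fun k => (localRademacher_le_self Q n 1 _).trans (by simp)⟩
  -- The infimum need not be attained, so an admissible `δ'` strictly below `δ` is rescaled, with
  -- result `δ * δ' ≤ δ ^ 2`.
  obtain ⟨δ', ⟨h0, hδ'⟩, hlt⟩ := exists_lt_of_csInf_lt hne hδ
  have hpos : 0 < δ := h0.trans hlt
  refine (localRademacher_le_of_smul Q n (r := δ' / δ) (δ := δ') (by positivity)
    (starHull_smul_mem (by positivity) ((div_le_one hpos).2 hlt.le)) (by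
      rw [div_mul_cancel₀ _ hpos.ne'])).trans ?_
  refine (mul_le_mul_right (hδ' k) _).trans ?_
  rw [← ENNReal.ofReal_mul (by positivity)]
  refine ENNReal.ofReal_le_ofReal ?_
  have : 1 / (δ' / δ) * δ' ^ 2 = δ * δ' := by field_simp
  rw [this, sq]
  gcongr

end RademacherAverages

/-! ### Vector-valued classes -/

section VectorClasses

variable {S : Type*} {d : ℕ}

/-- The squared Euclidean length of a vector-valued function. -/
def vecSq (f : S → Fin d → ℝ) (s : S) : ℝ := ∑ k, f s k ^ 2

/-- The weighted combination `∑ w_k f_k`. -/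
def wComb (w f : S → Fin d → ℝ) (s : S) : ℝ := ∑ k, w s k * f s k

/-- The `k`-th coordinate class. -/
def coordSet (𝒱 : Set (S → Fin d → ℝ)) (k : Fin d) : Set (S → ℝ) :=
  (fun f s => f s k) '' 𝒱

lemma vecSq_nonneg (f : S → Fin d → ℝ) (s : S) : 0 ≤ vecSq f s :=
  Finset.sum_nonneg fun _ _ => sq_nonneg _

lemma vecSq_smul (r : ℝ) (f : S → Fin d → ℝ) : vecSq (r • f) = r ^ 2 • vecSq f := by
  ext s; simp [vecSq, mul_pow, Finset.mul_sum]

lemma wComb_smul (w : S → Fin d → ℝ) (r : ℝ) (f : S → Fin d → ℝ) :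
    wComb w (r • f) = r • wComb w f := by
  ext s; simp only [wComb, Pi.smul_apply, smul_eq_mul, Finset.mul_sum]
  exact Finset.sum_congr rfl fun k _ => by ring

lemma empMean_smul {n : ℕ} (s : Fin n → S) (r : ℝ) (g : S → ℝ) :
    empMean s (r • g) = r * empMean s g := by
  simp only [empMean, Pi.smul_apply, smul_eq_mul, ← Finset.mul_sum]; ring

lemma wComb_sq_le {w f : S → Fin d → ℝ} {b : ℝ} {s : S} (hw : ∀ k, |w s k| ≤ b) :
    wComb w f s ^ 2 ≤ d * b ^ 2 * vecSq f s := by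
  unfold wComb vecSq
  refine (Finset.sum_mul_sq_le_sq_mul_sq _ _ _).trans ?_
  have : ∑ k, w s k ^ 2 ≤ d * b ^ 2 := by
    refine (Finset.sum_le_card_nsmul _ _ (b ^ 2) fun k _ => ?_).trans (by simp)
    rw [← sq_abs]
    exact pow_le_pow_left₀ (abs_nonneg _) (hw k) 2
  exact mul_le_mul_of_nonneg_right this (Finset.sum_nonneg fun _ _ => sq_nonneg _)

lemma abs_coord_le {n : ℕ} {s : Fin n → S} {f : S → Fin d → ℝ} {τ : ℝ}
    (h : empMean s (vecSq f) ≤ τ ^ 2) (k : Fin d) (i : Fin n) : |f (s i) k| ≤ √(n * τ ^ 2) := by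
  refine Real.abs_le_sqrt ?_
  have hn : (0 : ℝ) < n := by exact_mod_cast i.pos
  unfold empMean at h
  rw [one_div, inv_mul_le_iff₀ hn] at h
  calc f (s i) k ^ 2 ≤ vecSq f (s i) :=
        Finset.single_le_sum (f := fun k => f (s i) k ^ 2) (fun _ _ => sq_nonneg _)
          (Finset.mem_univ k)
    _ ≤ ∑ i, vecSq f (s i) :=
        Finset.single_le_sum (f := fun i => vecSq f (s i)) (fun _ _ => vecSq_nonneg _ _)
          (Finset.mem_univ i)
    _ ≤ _ := h

lemma empNorm_coord_le {n : ℕ} {s : Fin n → S} {f : S → Fin d → ℝ} {τ : ℝ} (hτ : 0 ≤ τ)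
    (h : empMean s (vecSq f) ≤ τ ^ 2) (k : Fin d) : empNorm s (fun s => f s k) ≤ τ := by
  unfold empNorm
  refine Real.sqrt_le_iff.2 ⟨hτ, le_trans ?_ h⟩
  unfold empMean
  gcongr with i
  exact Finset.single_le_sum (f := fun k => f (s i) k ^ 2) (fun _ _ => sq_nonneg _)
    (Finset.mem_univ k)

variable {ι : Type*} {n : ℕ} {s : Fin n → S} {F : ι → S → Fin d → ℝ} {𝒢 : Fin d → Set (S → ℝ)}
  {τ : ℝ} {t₀ : ι}

/-- Rademacher averages of sums of coordinatewise contractions of a vector-valued class. -/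
lemma rademacher_sum_contraction_le {φ : Fin d → S → ℝ → ℝ} {κ : ℝ} (hκ : 0 ≤ κ) (hτ : 0 ≤ τ)
    (h0 : F t₀ = 0) (hF : ∀ t k, (fun s => F t s k) ∈ 𝒢 k)
    (hs : ∀ t, empMean s (vecSq (F t)) ≤ τ ^ 2) (hφ0 : ∀ k z, φ k z 0 = 0)
    (hφ : ∀ k i t u, |φ k (s i) (F t (s i) k) - φ k (s i) (F u (s i) k)| ≤
      κ * |F t (s i) k - F u (s i) k|) :
    (2 ^ n : ENNReal)⁻¹ * ∑ e : Fin n → Bool, ⨆ t,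
        ENNReal.ofReal |(1 / (n : ℝ)) * ∑ j, sign (e j) * ∑ k, φ k (s j) (F t (s j) k)| ≤
      ENNReal.ofReal (2 * κ) * ∑ k, radAvg s τ (𝒢 k) := by
  have h1 : ∀ e : Fin n → Bool, (⨆ t,
        ENNReal.ofReal |(1 / (n : ℝ)) * ∑ j, sign (e j) * ∑ k, φ k (s j) (F t (s j) k)|) ≤
      ∑ k, ⨆ t, ENNReal.ofReal |(1 / (n : ℝ)) * ∑ j, sign (e j) * φ k (s j) (F t (s j) k)| := by
    intro e
    refine iSup_le fun t => ?_
    have hsum : (1 / (n : ℝ)) * ∑ j, sign (e j) * ∑ k, φ k (s j) (F t (s j) k) =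
        ∑ k, (1 / (n : ℝ)) * ∑ j, sign (e j) * φ k (s j) (F t (s j) k) := by
      simp only [Finset.mul_sum]
      exact Finset.sum_comm
    rw [hsum]
    refine (ENNReal.ofReal_le_ofReal (Finset.abs_sum_le_sum_abs _ _)).trans ?_
    rw [ENNReal.ofReal_sum_of_nonneg fun _ _ => abs_nonneg _]
    gcongr with k
    exact le_iSup (fun t => ENNReal.ofReal
      |(1 / (n : ℝ)) * ∑ j, sign (e j) * φ k (s j) (F t (s j) k)|) t
  have h2 : ∀ k, ∑ e : Fin n → Bool, ⨆ t,
        ENNReal.ofReal |(1 / (n : ℝ)) * ∑ j, sign (e j) * φ k (s j) (F t (s j) k)| ≤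
      ENNReal.ofReal (2 * κ) * ∑ e : Fin n → Bool, ⨆ t,
        ENNReal.ofReal |(1 / (n : ℝ)) * ∑ j, sign (e j) * F t (s j) k| := fun k =>
    sum_iSup_abs_rademacher_le (φ := fun j t => φ k (s j) (F t (s j) k))
      (ψ := fun j t => F t (s j) k) t₀ hκ (fun i => by simp [h0, hφ0]) (fun i => by simp [h0])
      (fun i t => abs_coord_le (hs t) k i) (fun i t u => hφ k i t u)
  calc _ ≤ (2 ^ n : ENNReal)⁻¹ * ∑ e : Fin n → Bool, ∑ k, ⨆ t,
        ENNReal.ofReal |(1 / (n : ℝ)) * ∑ j, sign (e j) * φ k (s j) (F t (s j) k)| := by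
        gcongr with e; exact h1 e
    _ ≤ (2 ^ n : ENNReal)⁻¹ * ∑ k, ENNReal.ofReal (2 * κ) * ∑ e : Fin n → Bool, ⨆ t,
        ENNReal.ofReal |(1 / (n : ℝ)) * ∑ j, sign (e j) * F t (s j) k| := by
        rw [Finset.sum_comm]; gcongr with k; exact h2 k
    _ ≤ (2 ^ n : ENNReal)⁻¹ * ∑ k, ENNReal.ofReal (2 * κ) * ∑ e : Fin n → Bool,
        ⨆ g ∈ {g | g ∈ 𝒢 k ∧ empNorm s g ≤ τ},
          ENNReal.ofReal |(1 / (n : ℝ)) * ∑ i, sign (e i) * g (s i)| := by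
        gcongr with k _ e
        exact iSup_le fun t => le_iSup₂_of_le (fun s => F t s k)
          ⟨hF t k, empNorm_coord_le hτ (hs t) k⟩ le_rfl
    _ = _ := by
        simp only [radAvg, Finset.mul_sum]
        refine Finset.sum_congr rfl fun k _ => Finset.sum_congr rfl fun e _ => ?_
        ring

lemma rademacher_wComb_le {w : S → Fin d → ℝ} {b : ℝ} (hb : 0 ≤ b) (hτ : 0 ≤ τ)
    (h0 : F t₀ = 0) (hF : ∀ t k, (fun s => F t s k) ∈ 𝒢 k)
    (hs : ∀ t, empMean s (vecSq (F t)) ≤ τ ^ 2) (hw : ∀ i k, |w (s i) k| ≤ b) :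
    (2 ^ n : ENNReal)⁻¹ * ∑ e : Fin n → Bool, ⨆ t,
        ENNReal.ofReal |(1 / (n : ℝ)) * ∑ j, sign (e j) * wComb w (F t) (s j)| ≤
      ENNReal.ofReal (2 * b) * ∑ k, radAvg s τ (𝒢 k) := by
  refine rademacher_sum_contraction_le (φ := fun k z x => w z k * x) hb hτ h0 hF hs (by simp) ?_
  intro k i t u
  rw [← mul_sub, abs_mul]
  exact mul_le_mul_of_nonneg_right (hw i k) (abs_nonneg _)

lemma abs_sq_sub_sq_le {x y b : ℝ} (hx : |x| ≤ b) (hy : |y| ≤ b) :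
    |x ^ 2 - y ^ 2| ≤ 2 * b * |x - y| := by
  rw [sq_sub_sq, abs_mul]
  refine mul_le_mul_of_nonneg_right ((abs_add_le _ _).trans (by linarith)) (abs_nonneg _)

lemma rademacher_vecSq_le (hτ : 0 ≤ τ)
    (h0 : F t₀ = 0) (hF : ∀ t k, (fun s => F t s k) ∈ 𝒢 k)
    (hs : ∀ t, empMean s (vecSq (F t)) ≤ τ ^ 2) (hb : ∀ t i k, |F t (s i) k| ≤ 1) :
    (2 ^ n : ENNReal)⁻¹ * ∑ e : Fin n → Bool, ⨆ t,
        ENNReal.ofReal |(1 / (n : ℝ)) * ∑ j, sign (e j) * vecSq (F t) (s j)| ≤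
      ENNReal.ofReal 4 * ∑ k, radAvg s τ (𝒢 k) := by
  have := rademacher_sum_contraction_le (φ := fun k z x => x ^ 2) (κ := 2) zero_le_two hτ h0 hF hs
    (by simp) fun k i t u => by simpa using abs_sq_sub_sq_le (hb t i k) (hb u i k)
  norm_num at this
  simpa [vecSq] using this

/-- Two contractions in a row: squaring is `2 * b'`-Lipschitz on `[-b', b']`, and then each
coordinate is multiplied by a weight of size at most `b`. Each contraction costs a further factor 2
for the absolute values. -/
lemma rademacher_wComb_sq_le {w : S → Fin d → ℝ} {b b' : ℝ} (hb : 0 ≤ b) (hb' : 0 ≤ b')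
    (hτ : 0 ≤ τ) (h0 : F t₀ = 0) (hF : ∀ t k, (fun s => F t s k) ∈ 𝒢 k)
    (hs : ∀ t, empMean s (vecSq (F t)) ≤ τ ^ 2) (hw : ∀ i k, |w (s i) k| ≤ b)
    (hh : ∀ t i, |wComb w (F t) (s i)| ≤ b') :
    (2 ^ n : ENNReal)⁻¹ * ∑ e : Fin n → Bool, ⨆ t,
        ENNReal.ofReal |(1 / (n : ℝ)) * ∑ j, sign (e j) * wComb w (F t) (s j) ^ 2| ≤
      ENNReal.ofReal (2 * (2 * b') * (2 * b)) * ∑ k, radAvg s τ (𝒢 k) := by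
  have h1 := sum_iSup_abs_rademacher_le (n := n) (φ := fun j t => wComb w (F t) (s j) ^ 2)
    (ψ := fun j t => wComb w (F t) (s j)) (C := b') (κ := 2 * b') t₀ (by positivity)
    (fun i => by simp [h0, wComb]) (fun i => by simp [h0, wComb]) (fun i t => hh t i)
    fun i t u => abs_sq_sub_sq_le (hh t i) (hh u i)
  have h2 := rademacher_wComb_le hb hτ h0 hF hs hw
  rw [ENNReal.ofReal_mul (by positivity), mul_assoc]
  refine le_trans (mul_le_mul_right h1 _) ?_
  rw [mul_left_comm]
  exact mul_le_mul_right h2 _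

end VectorClasses

/-! ### Uniform deviation bounds -/

section Deviation

variable {S : Type*} [MeasurableSpace S] {d : ℕ}

lemma measurable_radAvg {n : ℕ} {𝒢 : Set (S → ℝ)} (hc : 𝒢.Countable)
    (hm : ∀ g ∈ 𝒢, Measurable g) (δ : ℝ) : Measurable fun s : Fin n → S => radAvg s δ 𝒢 := by
  unfold radAvg
  refine (Finset.measurable_sum _ fun e _ => ?_).const_mul _
  -- The index set depends on the sample. Since suprema in `[0, ∞]` ignore zeros, the constraint can
  -- be moved into an indicator, leaving a fixed countable index set.
  have : (fun s : Fin n → S => ⨆ g ∈ {g | g ∈ 𝒢 ∧ empNorm s g ≤ δ},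
      ENNReal.ofReal |(1 / (n : ℝ)) * ∑ i, sign (e i) * g (s i)|) =
      fun s => ⨆ g ∈ 𝒢, Set.indicator {s : Fin n → S | empNorm s g ≤ δ}
        (fun s => ENNReal.ofReal |(1 / (n : ℝ)) * ∑ i, sign (e i) * g (s i)|) s := by
    ext s
    refine le_antisymm (iSup₂_le fun g hg => le_iSup₂_of_le g hg.1 ?_)
      (iSup₂_le fun g hg => ?_)
    · rw [Set.indicator_of_mem (show s ∈ {s : Fin n → S | empNorm s g ≤ δ} from hg.2)]
    · by_cases h : empNorm s g ≤ δ
      · rw [Set.indicator_of_mem (show s ∈ {s : Fin n → S | empNorm s g ≤ δ} from h)]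
        exact le_iSup₂_of_le g ⟨hg, h⟩ le_rfl
      · rw [Set.indicator_of_notMem (show s ∉ {s : Fin n → S | empNorm s g ≤ δ} from h)]
        exact zero_le
  rw [this]
  refine Measurable.biSup 𝒢 hc fun g hg => ?_
  have := hm g hg
  refine Measurable.indicator (by fun_prop) (measurableSet_le ?_ measurable_const)
  unfold empNorm
  fun_prop

/-- A countable vector-valued class, bounded by one and stable under shrinking by rational
factors, whose coordinates have local Rademacher complexity at most `δ²` at radius `δ`. -/
structure IsRademacherClass (Q : Measure S) (n : ℕ) (δ : ℝ) (𝒱 : Set (S → Fin d → ℝ)) : Prop where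
  countable : 𝒱.Countable
  zero_mem : (0 : S → Fin d → ℝ) ∈ 𝒱
  meas : ∀ f ∈ 𝒱, Measurable f
  smul_mem : ∀ f ∈ 𝒱, ∀ q : ℚ, 0 ≤ q → q ≤ 1 → (q : ℝ) • f ∈ 𝒱
  bound : ∀ f ∈ 𝒱, ∀ᵐ z ∂Q, ∀ k, |f z k| ≤ 1
  rad : ∀ k, localRademacher Q n δ (coordSet 𝒱 k) ≤ ENNReal.ofReal (δ ^ 2)

lemma measurable_vecSq {f : S → Fin d → ℝ} (hf : Measurable f) : Measurable (vecSq f) := by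
  unfold vecSq; fun_prop

lemma measurable_wComb {w f : S → Fin d → ℝ} (hw : Measurable w) (hf : Measurable f) :
    Measurable (wComb w f) := by
  unfold wComb; fun_prop

lemma vecSq_le {S : Type*} {f : S → Fin d → ℝ} {z : S} (h : ∀ k, |f z k| ≤ 1) : vecSq f z ≤ d := by
  refine (Finset.sum_le_card_nsmul _ _ 1 fun k _ => ?_).trans (by simp)
  rw [← sq_abs]; exact pow_le_one₀ (abs_nonneg _) (h k)

lemma abs_wComb_le {S : Type*} {w f : S → Fin d → ℝ} {b : ℝ} {z : S} (hw : ∀ k, |w z k| ≤ b)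
    (h : ∀ k, |f z k| ≤ 1) : |wComb w f z| ≤ d * b := by
  refine (Finset.abs_sum_le_sum_abs _ _).trans ?_
  refine (Finset.sum_le_card_nsmul _ _ b fun k _ => ?_).trans (by simp)
  rw [abs_mul]
  calc |w z k| * |f z k| ≤ b * 1 := mul_le_mul (hw k) (h k) (abs_nonneg _)
        ((abs_nonneg _).trans (hw k))
    _ = b := mul_one b

namespace IsRademacherClass

variable {Q : Measure S} {n : ℕ} {δ : ℝ} {𝒱 : Set (S → Fin d → ℝ)}

lemma coord_smul_mem (h : IsRademacherClass Q n δ 𝒱) {q : ℚ} (h0 : 0 ≤ q) (h1 : q ≤ 1)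
    (k : Fin d) : ∀ g ∈ coordSet 𝒱 k, (q : ℝ) • g ∈ coordSet 𝒱 k := by
  rintro _ ⟨f, hf, rfl⟩
  exact ⟨_, h.smul_mem f hf q h0 h1, by ext; simp⟩

lemma measurable_radAvg_coord (h : IsRademacherClass Q n δ 𝒱) (k : Fin d) (τ : ℝ) :
    Measurable fun s : Fin n → S => radAvg s τ (coordSet 𝒱 k) := by
  refine measurable_radAvg (h.countable.image _) ?_ τ
  rintro _ ⟨f, hf, rfl⟩
  have := h.meas f hf
  fun_prop

/-- Shrinking from radius `τ` to `δ` multiplies the bound `δ ^ 2` by `τ / δ`. The shrinking factor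
must be rational, hence is only taken between `δ / (2 * τ)` and `δ / τ`, which costs the factor 2.
-/
lemma lintegral_sum_radAvg_le (h : IsRademacherClass Q n δ 𝒱) (hδ : 0 < δ) {τ : ℝ} (hτ : δ ≤ τ) :
    ∫⁻ s, ∑ k, radAvg s τ (coordSet 𝒱 k) ∂(sampleLaw Q n) ≤ ENNReal.ofReal (d * (2 * τ * δ)) := by
  rw [lintegral_finsetSum _ fun k _ => h.measurable_radAvg_coord k τ]
  have hτ0 : 0 < τ := hδ.trans_le hτ
  obtain ⟨q, hq1, hq2⟩ := exists_rat_btwn (show δ / (2 * τ) < δ / τ by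
    rw [div_lt_div_iff₀ (by positivity) hτ0]; nlinarith)
  have hq0 : (0 : ℝ) < q := lt_trans (by positivity) hq1
  have hq3 : (q : ℝ) ≤ 1 := hq2.le.trans ((div_le_one hτ0).2 hτ)
  have hk : ∀ k, ∫⁻ s, radAvg s τ (coordSet 𝒱 k) ∂(sampleLaw Q n) ≤
      ENNReal.ofReal (2 * τ * δ) := by
    intro k
    refine (localRademacher_le_of_smul Q n (δ := δ) hq0 (h.coord_smul_mem (by exact_mod_cast hq0.le)
      (by exact_mod_cast hq3) k) ?_).trans ?_
    · rw [lt_div_iff₀ hτ0] at hq2; exact hq2.le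
    · refine (mul_le_mul_right (h.rad k) _).trans ?_
      rw [← ENNReal.ofReal_mul (by positivity)]
      refine ENNReal.ofReal_le_ofReal ?_
      rw [one_div, inv_mul_le_iff₀ hq0]
      rw [div_lt_iff₀ (by positivity)] at hq1
      nlinarith
  refine (Finset.sum_le_sum fun k _ => hk k).trans ?_
  rw [Finset.sum_const, Finset.card_univ, Fintype.card_fin, nsmul_eq_mul,
    ENNReal.ofReal_mul (Nat.cast_nonneg d), ENNReal.ofReal_natCast]

variable [IsProbabilityMeasure Q]

lemma integrable_vecSq (h : IsRademacherClass Q n δ 𝒱) {f : S → Fin d → ℝ} (hf : f ∈ 𝒱) :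
    Integrable (vecSq f) Q := by
  refine Integrable.of_bound (measurable_vecSq (h.meas f hf)).aestronglyMeasurable (d : ℝ) ?_
  filter_upwards [h.bound f hf] with z hz
  rw [Real.norm_of_nonneg (vecSq_nonneg _ _)]
  exact vecSq_le hz

lemma ae_bound (h : IsRademacherClass Q n δ 𝒱) :
    ∀ᵐ s ∂(sampleLaw Q n), ∀ i, ∀ f ∈ 𝒱, ∀ k, |f (s i) k| ≤ 1 :=
  ae_sampleLaw ((ae_ball_iff h.countable).2 h.bound)

/-- A functional of the class that is dominated by it, pointwise and in Rademacher average. -/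
structure IsDominated (Q : Measure S) (n : ℕ) (𝒱 : Set (S → Fin d → ℝ))
    (a : (S → Fin d → ℝ) → S → ℝ) (Ca Cr : ℝ) : Prop where
  meas : ∀ f ∈ 𝒱, Measurable (a f)
  nonneg : 0 ≤ Ca ∧ 0 ≤ Cr
  sq_le : ∀ f ∈ 𝒱, ∀ᵐ z ∂Q, a f z ^ 2 ≤ Ca * vecSq f z
  rad : ∀ᵐ s ∂(sampleLaw Q n), ∀ τ, 0 ≤ τ → (2 ^ n : ENNReal)⁻¹ * ∑ e : Fin n → Bool,
    ⨆ f : {f // f ∈ 𝒱 ∧ empMean s (vecSq f) ≤ τ ^ 2},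
      ENNReal.ofReal |(1 / (n : ℝ)) * ∑ j, sign (e j) * a f.1 (s j)| ≤
        ENNReal.ofReal Cr * ∑ k, radAvg s τ (coordSet 𝒱 k)

lemma isDominated_vecSq (h : IsRademacherClass Q n δ 𝒱) : IsDominated Q n 𝒱 vecSq d 4 where
  meas f hf := measurable_vecSq (h.meas f hf)
  nonneg := ⟨by positivity, by norm_num⟩
  sq_le f hf := by
    filter_upwards [h.bound f hf] with z hz
    rw [sq]
    exact mul_le_mul_of_nonneg_right (vecSq_le hz) (vecSq_nonneg _ _)
  rad := by
    filter_upwards [h.ae_bound] with s hs τ hτ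
    refine rademacher_vecSq_le (F := fun t : {f // f ∈ 𝒱 ∧ empMean s (vecSq f) ≤ τ ^ 2} => t.1)
      (t₀ := ⟨0, h.zero_mem, ?_⟩) hτ rfl (fun t k => ⟨t.1, t.2.1, rfl⟩) (fun t => t.2.2)
      (fun t i k => hs i t.1 t.2.1 k)
    simp only [empMean, vecSq, Pi.zero_apply]
    simp only [ne_eq, OfNat.ofNat_ne_zero, not_false_eq_true, zero_pow, Finset.sum_const_zero,
      mul_zero]
    positivity

lemma isDominated_wComb (h : IsRademacherClass Q n δ 𝒱) {w : S → Fin d → ℝ} (hw : Measurable w)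
    {b : ℝ} (hb : 0 ≤ b) (hwb : ∀ᵐ z ∂Q, ∀ k, |w z k| ≤ b) :
    IsDominated Q n 𝒱 (wComb w) (d * b ^ 2) (2 * b) where
  meas f hf := measurable_wComb hw (h.meas f hf)
  nonneg := ⟨by positivity, by positivity⟩
  sq_le f hf := by
    filter_upwards [hwb] with z hz using wComb_sq_le hz
  rad := by
    filter_upwards [ae_sampleLaw hwb] with s hs τ hτ
    refine rademacher_wComb_le (F := fun t : {f // f ∈ 𝒱 ∧ empMean s (vecSq f) ≤ τ ^ 2} => t.1)
      (t₀ := ⟨0, h.zero_mem, ?_⟩) hb hτ rfl (fun t k => ⟨t.1, t.2.1, rfl⟩) (fun t => t.2.2) hs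
    simp only [empMean, vecSq, Pi.zero_apply]
    simp only [ne_eq, OfNat.ofNat_ne_zero, not_false_eq_true, zero_pow, Finset.sum_const_zero,
      mul_zero]
    positivity

/-- Members of the class are bounded by one, so the weighted combination has size at most `d * b`;
this is the range on which squaring is Lipschitz. -/
lemma isDominated_wComb_sq (h : IsRademacherClass Q n δ 𝒱) {w : S → Fin d → ℝ}
    (hw : Measurable w) {b : ℝ} (hb : 0 ≤ b) (hwb : ∀ᵐ z ∂Q, ∀ k, |w z k| ≤ b) :
    IsDominated Q n 𝒱 (fun f z => wComb w f z ^ 2) ((d * b) ^ 2 * (d * b ^ 2))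
      (2 * (2 * (d * b)) * (2 * b)) where
  meas f hf := (measurable_wComb hw (h.meas f hf)).pow_const 2
  nonneg := ⟨by positivity, by positivity⟩
  sq_le f hf := by
    filter_upwards [hwb, h.bound f hf] with z hz hz'
    have h1 := wComb_sq_le (f := f) hz
    have h2 : wComb w f z ^ 2 ≤ (d * b) ^ 2 := by
      rw [← sq_abs]; exact pow_le_pow_left₀ (abs_nonneg _) (abs_wComb_le hz hz') 2
    rw [sq (wComb w f z ^ 2), mul_assoc]
    exact mul_le_mul h2 h1 (sq_nonneg _) (by positivity)
  rad := by
    filter_upwards [ae_sampleLaw hwb, h.ae_bound] with s hs hs' τ hτ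
    refine rademacher_wComb_sq_le
      (F := fun t : {f // f ∈ 𝒱 ∧ empMean s (vecSq f) ≤ τ ^ 2} => t.1)
      (t₀ := ⟨0, h.zero_mem, ?_⟩) hb (by positivity) hτ rfl (fun t k => ⟨t.1, t.2.1, rfl⟩)
      (fun t => t.2.2) hs (fun t i => abs_wComb_le (hs i) (hs' i t.1 t.2.1))
    simp only [empMean, vecSq, Pi.zero_apply]
    simp only [ne_eq, OfNat.ofNat_ne_zero, not_false_eq_true, zero_pow, Finset.sum_const_zero,
      mul_zero]
    positivity

lemma IsDominated.memLp (h : IsRademacherClass Q n δ 𝒱) {a : (S → Fin d → ℝ) → S → ℝ} {Ca Cr : ℝ}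
    (ha : IsDominated Q n 𝒱 a Ca Cr) {f : S → Fin d → ℝ} (hf : f ∈ 𝒱) : MemLp (a f) 2 Q := by
  refine MemLp.of_bound (ha.meas f hf).aestronglyMeasurable (√(Ca * d)) ?_
  filter_upwards [ha.sq_le f hf, h.bound f hf] with z hz hz'
  exact Real.abs_le_sqrt (hz.trans (mul_le_mul_of_nonneg_left (vecSq_le hz') ha.nonneg.1))

/-- Deviations over the part of the class with small population and empirical norms. -/
lemma measure_deviation_le (h : IsRademacherClass Q n δ 𝒱) (hn : 0 < n) (hδ : 0 < δ)
    {a : (S → Fin d → ℝ) → S → ℝ} {Ca Cr : ℝ} (ha : IsDominated Q n 𝒱 a Ca Cr)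
    {σ ρ t : ℝ} (hρ : 0 < ρ) (ht : 0 < t) (hσρ : 4 * σ ^ 2 ≤ ρ) (hρδ : δ ^ 2 ≤ 2 * ρ)
    (hσt : 16 * (Ca * σ ^ 2) ≤ n * t ^ 2) :
    sampleLaw Q n {s | ∃ f ∈ 𝒱, ∫ z, vecSq f z ∂Q ≤ σ ^ 2 ∧ empMean s (vecSq f) ≤ ρ ∧
      t < |empMean s (a f) - ∫ z, a f z ∂Q|} ≤
      ENNReal.ofReal (32 * d * Cr * √(2 * ρ) * δ / t) := by
  have : Countable {f // f ∈ 𝒱 ∧ ∫ z, vecSq f z ∂Q ≤ σ ^ 2} :=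
    (h.countable.mono fun f hf => hf.1 : {f | f ∈ 𝒱 ∧ ∫ z, vecSq f z ∂Q ≤ σ ^ 2}.Countable).to_subtype
  have hmain := measure_exists_empMean_sub_gt_le (Q := Q) (n := n) hn
    (a := fun f : {f // f ∈ 𝒱 ∧ ∫ z, vecSq f z ∂Q ≤ σ ^ 2} => a f.1)
    (N := fun f => vecSq f.1) (fun f => ha.meas _ f.2.1)
    (fun f => measurable_vecSq (h.meas _ f.2.1)) (fun f => vecSq_nonneg _)
    (fun f => h.integrable_vecSq f.2.1) (fun f => IsDominated.memLp h ha f.2.1) hρ ht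
    (fun f => f.2.2.trans (by linarith)) (fun f => by
      have : ∫ z, a f.1 z ^ 2 ∂Q ≤ ∫ z, Ca * vecSq f.1 z ∂Q :=
        integral_mono_ae (IsDominated.memLp h ha f.2.1).integrable_sq
          ((h.integrable_vecSq f.2.1).const_mul _) (ha.sq_le _ f.2.1)
      rw [integral_const_mul] at this
      have := this.trans (mul_le_mul_of_nonneg_left f.2.2 ha.nonneg.1)
      linarith)
  have hτ0 : 0 ≤ √(2 * ρ) := Real.sqrt_nonneg _
  -- Symmetrization leaves functions of empirical radius `√(2 * ρ)`. Since this is at least `δ`,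
  -- their complexity is linear in the radius.
  have hτ : δ ≤ √(2 * ρ) := Real.le_sqrt_of_sq_le hρδ
  have hsq : √(2 * ρ) ^ 2 = 2 * ρ := Real.sq_sqrt (by positivity)
  refine le_trans (measure_mono ?_) (hmain.trans ?_)
  · rintro s ⟨f, hf, h1, h2, h3⟩
    exact ⟨⟨f, hf, h1⟩, h2, h3⟩
  · have hint : ∫⁻ s, (2 ^ n : ENNReal)⁻¹ * ∑ e : Fin n → Bool,
        ⨆ f : {f // f ∈ 𝒱 ∧ ∫ z, vecSq f z ∂Q ≤ σ ^ 2}, ⨆ (_ : empMean s (vecSq f.1) ≤ 2 * ρ),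
          ENNReal.ofReal |(1 / (n : ℝ)) * ∑ j, sign (e j) * a f.1 (s j)| ∂(sampleLaw Q n) ≤
        ENNReal.ofReal Cr * ENNReal.ofReal (d * (2 * √(2 * ρ) * δ)) := by
      refine (lintegral_mono_ae ?_).trans ((lintegral_const_mul' (ENNReal.ofReal Cr)
        (fun s : Fin n → S => ∑ k, radAvg s (√(2 * ρ)) (coordSet 𝒱 k))
        ENNReal.ofReal_ne_top).trans_le (mul_le_mul_right (h.lintegral_sum_radAvg_le hδ hτ) _))
      filter_upwards [ha.rad] with s hs
      refine le_trans (mul_le_mul_right (Finset.sum_le_sum fun e _ => ?_) _) (hs _ hτ0)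
      refine iSup₂_le fun f hf => ?_
      exact le_iSup (fun f : {f // f ∈ 𝒱 ∧ empMean s (vecSq f) ≤ √(2 * ρ) ^ 2} =>
        ENNReal.ofReal |(1 / (n : ℝ)) * ∑ j, sign (e j) * a f.1 (s j)|)
        ⟨f.1, f.2.1, hf.trans hsq.ge⟩
    refine (mul_le_mul_right hint _).trans ?_
    have := ha.nonneg.2
    rw [← ENNReal.ofReal_mul this, ← ENNReal.ofReal_mul (by positivity)]
    refine ENNReal.ofReal_le_ofReal (le_of_eq ?_)
    field_simp
    ring

end IsRademacherClass

end Deviation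

/-! ### Deviation bounds at all scales, by rescaling within a star-shaped class. -/

section Deviation

variable {S : Type*} [MeasurableSpace S] {d : ℕ}

namespace IsRademacherClass

variable {Q : Measure S} [IsProbabilityMeasure Q]

/-- Uniform comparison of the empirical norm with the population norm. -/
lemma exists_measure_empMean_vecSq_gt_le (Q : Measure S) [IsProbabilityMeasure Q] (d : ℕ)
    {c₀ ζ : ℝ} (hc₀ : 0 < c₀) (hζ : 0 < ζ) :
    ∃ K : ℝ, 1 ≤ K ∧ ∀ (n : ℕ) (δ : ℝ) (𝒱 : Set (S → Fin d → ℝ)), 0 < n → 0 < δ →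
      c₀ ≤ n * δ ^ 2 → IsRademacherClass Q n δ 𝒱 →
      sampleLaw Q n {s | ∃ f ∈ 𝒱, K ^ 2 * max (∫ z, vecSq f z ∂Q) (δ ^ 2) <
        empMean s (vecSq f)} ≤ ENNReal.ofReal ζ := by
  -- `2 ≤ K` makes `δ ^ 2` at most a quarter of `(K * δ) ^ 2`; `256 * d ≤ K * c₀` supplies the
  -- second-moment condition; `1024 * d ≤ K * ζ` brings the final probability below `ζ`.
  obtain ⟨K, hK⟩ : ∃ K : ℝ, 2 ≤ K ∧ 256 * d ≤ K * c₀ ∧ 1024 * d ≤ K * ζ := by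
    refine ⟨2 + 256 * d / c₀ + 1024 * d / ζ, ?_, ?_, ?_⟩
    · have : (0 : ℝ) ≤ 256 * d / c₀ + 1024 * d / ζ := by positivity
      linarith
    · have : (2 + 256 * d / c₀ + 1024 * d / ζ) * c₀ = 256 * d + (2 + 1024 * d / ζ) * c₀ := by
        field_simp; ring
      rw [this]
      exact le_add_of_nonneg_right (by positivity)
    · have : (2 + 256 * d / c₀ + 1024 * d / ζ) * ζ = 1024 * d + (2 + 256 * d / c₀) * ζ := by
        field_simp; ring
      rw [this]
      exact le_add_of_nonneg_right (by positivity)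
  obtain ⟨hK2, hK3, hK4⟩ := hK
  have hK0 : 0 < K := by linarith
  refine ⟨K, by linarith, fun n δ 𝒱 hn hδ hnδ h => ?_⟩
  have hn' : (0 : ℝ) < n := by exact_mod_cast hn
  have hKδ : 0 < K * δ := by positivity
  have hKδ4 : 4 * δ ^ 2 ≤ (K * δ) ^ 2 := by
    calc 4 * δ ^ 2 = (2 * δ) ^ 2 := by ring
      _ ≤ (K * δ) ^ 2 := by gcongr
  have hdev := h.measure_deviation_le hn hδ h.isDominated_vecSq (σ := δ) (ρ := (K * δ) ^ 2)
    (t := (K * δ) ^ 2 / 4) (by positivity) (by positivity) hKδ4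
    (by nlinarith [sq_nonneg δ]) (by
      have h1 : 256 * d ≤ K ^ 4 * (n * δ ^ 2) := by
        have hK14 : K ≤ K ^ 4 := le_self_pow₀ (by linarith) (by norm_num)
        calc (256 * d : ℝ) ≤ K * c₀ := hK3
          _ ≤ K ^ 4 * (n * δ ^ 2) := by gcongr
      have h2 := mul_le_mul_of_nonneg_right h1 (sq_nonneg δ)
      nlinarith)
  refine le_trans (measure_mono ?_) (hdev.trans (ENNReal.ofReal_le_ofReal ?_))
  · rintro s ⟨f, hf, hs⟩
    set E := empMean s (vecSq f)
    set V := ∫ z, vecSq f z ∂Q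
    have hE1 : K ^ 2 * δ ^ 2 < E := lt_of_le_of_lt (by gcongr; exact le_max_right _ _) hs
    have hE2 : K ^ 2 * V < E := lt_of_le_of_lt (by gcongr; exact le_max_left _ _) hs
    have hE0 : 0 < E := lt_of_le_of_lt (by positivity) hE1
    -- A violating `f` is shrunk until its empirical square lies between `(K * δ) ^ 2 / 2` and `(K *
    -- δ) ^ 2`. Its population square is then at most `δ ^ 2`, so it deviates by more than `(K * δ)
    -- ^ 2 / 4`.
    obtain ⟨q, hq1, hq2⟩ := exists_rat_btwn (show K * δ / √(2 * E) < K * δ / √E by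
      refine div_lt_div_of_pos_left hKδ (Real.sqrt_pos.2 hE0) ?_
      exact Real.sqrt_lt_sqrt hE0.le (by linarith))
    have hq0 : (0 : ℝ) < q := lt_trans (by positivity) hq1
    have hlow : (K * δ) ^ 2 < q ^ 2 * (2 * E) := by
      rw [div_lt_iff₀ (by positivity)] at hq1
      calc (K * δ) ^ 2 < (q * √(2 * E)) ^ 2 := by gcongr
        _ = q ^ 2 * (2 * E) := by rw [mul_pow, Real.sq_sqrt (by positivity)]
    have hup : (q : ℝ) ^ 2 * E < (K * δ) ^ 2 := by
      rw [lt_div_iff₀ (by positivity)] at hq2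
      calc (q : ℝ) ^ 2 * E = (q * √E) ^ 2 := by rw [mul_pow, Real.sq_sqrt hE0.le]
        _ < (K * δ) ^ 2 := by gcongr
    have hqle : (q : ℝ) ≤ 1 := by
      by_contra hc
      push Not at hc
      have : 1 < (q : ℝ) ^ 2 := one_lt_pow₀ hc two_ne_zero
      nlinarith
    have hV : ∫ z, vecSq ((q : ℝ) • f) z ∂Q = q ^ 2 * V := by
      rw [vecSq_smul]; simp only [Pi.smul_apply, smul_eq_mul, integral_const_mul, V]
    have hE : empMean s (vecSq ((q : ℝ) • f)) = q ^ 2 * E := by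
      rw [vecSq_smul, empMean_smul]
    have hV1 : (q : ℝ) ^ 2 * V ≤ δ ^ 2 := by
      have h1 : (q : ℝ) ^ 2 * (K ^ 2 * V) ≤ (q : ℝ) ^ 2 * E := by gcongr
      have h2 : K ^ 2 * ((q : ℝ) ^ 2 * V) ≤ K ^ 2 * δ ^ 2 := by nlinarith
      exact le_of_mul_le_mul_left h2 (by positivity)
    refine ⟨(q : ℝ) • f, h.smul_mem f hf q (by exact_mod_cast hq0.le) (by exact_mod_cast hqle),
      ?_, ?_, ?_⟩
    · rw [hV]; exact hV1
    · rw [hE]; exact hup.le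
    · rw [hE, hV]
      refine lt_of_lt_of_le ?_ (le_abs_self _)
      linarith
  · have h2 : √(2 * (K * δ) ^ 2) ≤ 2 * (K * δ) :=
      Real.sqrt_le_iff.2 ⟨by positivity, by nlinarith [sq_nonneg (K * δ)]⟩
    rw [div_le_iff₀ (by positivity)]
    calc 32 * d * 4 * √(2 * (K * δ) ^ 2) * δ ≤ 32 * d * 4 * (2 * (K * δ)) * δ := by gcongr
      _ = (1024 * d) * (K * δ ^ 2) / 4 := by ring
      _ ≤ (K * ζ) * (K * δ ^ 2) / 4 := by gcongr
      _ = _ := by ring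

/-- Uniform deviations over a population ball whose radius is a multiple of `δ`. -/
lemma exists_measure_deviation_le (Q : Measure S) [IsProbabilityMeasure Q] (d : ℕ)
    {c₀ ζ Ca Cr : ℝ} (hc₀ : 0 < c₀) (hζ : 0 < ζ) (hCa : 0 ≤ Ca) (hCr : 0 ≤ Cr) :
    ∃ T : ℝ, 1 ≤ T ∧ ∀ (n : ℕ) (δ : ℝ) (𝒱 : Set (S → Fin d → ℝ))
      (a : (S → Fin d → ℝ) → S → ℝ) (κ : ℝ), 0 < n → 0 < δ →
      c₀ ≤ n * δ ^ 2 → 1 ≤ κ → IsRademacherClass Q n δ 𝒱 → IsDominated Q n 𝒱 a Ca Cr →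
      sampleLaw Q n {s | ∃ f ∈ 𝒱, ∫ z, vecSq f z ∂Q ≤ (κ * δ) ^ 2 ∧
        T * κ * δ ^ 2 < |empMean s (a f) - ∫ z, a f z ∂Q|} ≤ ENNReal.ofReal ζ := by
  obtain ⟨K, hK1, hK⟩ := exists_measure_empMean_vecSq_gt_le Q d hc₀ (half_pos hζ)
  set R := √(2 * (K ^ 2 + 4)) with hR
  obtain ⟨T, hT1, hT2, hT3⟩ : ∃ T : ℝ, 1 ≤ T ∧ 16 * Ca ≤ T * c₀ ∧
      32 * d * Cr * R ≤ T * (ζ / 2) := by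
    refine ⟨1 + 16 * Ca / c₀ + 32 * d * Cr * R / (ζ / 2), ?_, ?_, ?_⟩
    · have : 0 ≤ 16 * Ca / c₀ + 32 * d * Cr * R / (ζ / 2) := by positivity
      linarith
    · have : (1 + 16 * Ca / c₀ + 32 * d * Cr * R / (ζ / 2)) * c₀ =
          16 * Ca + (1 + 32 * d * Cr * R / (ζ / 2)) * c₀ := by field_simp; ring
      rw [this]
      exact le_add_of_nonneg_right (by positivity)
    · have : (1 + 16 * Ca / c₀ + 32 * d * Cr * R / (ζ / 2)) * (ζ / 2) =
          32 * d * Cr * R + (1 + 16 * Ca / c₀) * (ζ / 2) := by field_simp; ring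
      rw [this]
      exact le_add_of_nonneg_right (by positivity)
  refine ⟨T, hT1, fun n δ 𝒱 a κ hn hδ hnδ hκ h ha => ?_⟩
  have hn' : (0 : ℝ) < n := by exact_mod_cast hn
  have hT0 : 0 < T := by linarith
  have hκ0 : 0 < κ := by linarith
  have hδκ : δ ^ 2 ≤ (κ * δ) ^ 2 := by
    rw [mul_pow]; nlinarith [sq_nonneg δ, one_le_pow₀ (n := 2) hκ]
  -- In `ρ`, the part `K ^ 2` is the empirical radius guaranteed by the norm comparison, and the
  -- extra 4 secures `4 * σ ^ 2 ≤ ρ`.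
  have hdev := h.measure_deviation_le hn hδ ha (σ := κ * δ)
    (ρ := (K ^ 2 + 4) * (κ * δ) ^ 2) (t := T * κ * δ ^ 2) (by positivity) (by positivity)
    (by nlinarith [mul_nonneg (sq_nonneg K) (sq_nonneg (κ * δ))])
    (by nlinarith [mul_nonneg (sq_nonneg K) (sq_nonneg (κ * δ))]) (by
      have h1 : 16 * Ca ≤ T ^ 2 * (n * δ ^ 2) := by
        have : T ≤ T ^ 2 := le_self_pow₀ hT1 two_ne_zero
        calc 16 * Ca ≤ T * c₀ := hT2
          _ ≤ T ^ 2 * (n * δ ^ 2) := by gcongr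
      have h2 := mul_le_mul_of_nonneg_right h1 (sq_nonneg (κ * δ))
      nlinarith)
  have hbad := hK n δ 𝒱 hn hδ hnδ h
  refine le_trans (measure_mono (t := {s | ∃ f ∈ 𝒱, K ^ 2 * max (∫ z, vecSq f z ∂Q) (δ ^ 2) <
      empMean s (vecSq f)} ∪ {s | ∃ f ∈ 𝒱, ∫ z, vecSq f z ∂Q ≤ (κ * δ) ^ 2 ∧
        empMean s (vecSq f) ≤ (K ^ 2 + 4) * (κ * δ) ^ 2 ∧
        T * κ * δ ^ 2 < |empMean s (a f) - ∫ z, a f z ∂Q|}) ?_)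
      ((measure_union_le _ _).trans ((add_le_add hbad hdev).trans ?_))
  · rintro s ⟨f, hf, h1, h2⟩
    by_cases hc : K ^ 2 * max (∫ z, vecSq f z ∂Q) (δ ^ 2) < empMean s (vecSq f)
    · exact Or.inl ⟨f, hf, hc⟩
    · refine Or.inr ⟨f, hf, h1, ?_, h2⟩
      push Not at hc
      refine hc.trans ((mul_le_mul_of_nonneg_left (max_le h1 hδκ) (sq_nonneg K)).trans ?_)
      nlinarith [sq_nonneg (κ * δ)]
  · rw [← ENNReal.ofReal_add (by positivity) (by
      have := ha.nonneg.2
      positivity)]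
    refine ENNReal.ofReal_le_ofReal ?_
    have hs : √(2 * ((K ^ 2 + 4) * (κ * δ) ^ 2)) = R * (κ * δ) := by
      rw [← mul_assoc, Real.sqrt_mul (by positivity), Real.sqrt_sq (by positivity)]
    have : 32 * d * Cr * √(2 * ((K ^ 2 + 4) * (κ * δ) ^ 2)) * δ / (T * κ * δ ^ 2) ≤ ζ / 2 := by
      rw [hs, div_le_iff₀ (by positivity)]
      calc 32 * d * Cr * (R * (κ * δ)) * δ = (32 * d * Cr * R) * (κ * δ ^ 2) := by ring
        _ ≤ (T * (ζ / 2)) * (κ * δ ^ 2) := by gcongr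
        _ = _ := by ring
    linarith

/-- The classes are stable under rational factors only, so a target radius `x` is met up to a factor
2. -/
lemma exists_rat_shrink {x y : ℝ} (hx : 0 < x) (hxy : x < y) :
    ∃ q : ℚ, 0 < (q : ℝ) ∧ (q : ℝ) ≤ 1 ∧ q * y ≤ x ∧ x ≤ 2 * (q * y) := by
  have hy : 0 < y := hx.trans hxy
  obtain ⟨q, hq1, hq2⟩ := exists_rat_btwn (show x / (2 * y) < x / y by
    rw [div_lt_div_iff₀ (by positivity) hy]; nlinarith)
  refine ⟨q, lt_trans (by positivity) hq1, hq2.le.trans ((div_le_one hy).2 hxy.le), ?_, ?_⟩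
  · rw [lt_div_iff₀ hy] at hq2; exact hq2.le
  · rw [div_lt_iff₀ (by positivity)] at hq1; linarith

lemma integral_vecSq_smul (Q : Measure S) (r : ℝ) (f : S → Fin d → ℝ) :
    ∫ z, vecSq (r • f) z ∂Q = r ^ 2 * ∫ z, vecSq f z ∂Q := by
  rw [vecSq_smul]; simp only [Pi.smul_apply, smul_eq_mul, integral_const_mul]

/-- Uniform deviations of weighted combinations. -/
lemma exists_measure_wComb_deviation_le (Q : Measure S) [IsProbabilityMeasure Q] (d : ℕ)
    {c₀ ζ b : ℝ} (hc₀ : 0 < c₀) (hζ : 0 < ζ) (hb : 0 ≤ b) :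
    ∃ K : ℝ, 1 ≤ K ∧ ∀ (n : ℕ) (δ : ℝ) (𝒱 : Set (S → Fin d → ℝ)) (w : S → Fin d → ℝ), 0 < n →
      0 < δ → c₀ ≤ n * δ ^ 2 → IsRademacherClass Q n δ 𝒱 → Measurable w →
      (∀ᵐ z ∂Q, ∀ k, |w z k| ≤ b) →
      sampleLaw Q n {s | ¬ ∀ f ∈ 𝒱, |empMean s (wComb w f) - ∫ z, wComb w f z ∂Q| ≤
        K * δ * max (√(∫ z, vecSq f z ∂Q)) δ} ≤ ENNReal.ofReal ζ := by
  obtain ⟨T, hT1, hT⟩ := exists_measure_deviation_le Q d (Ca := d * b ^ 2) (Cr := 2 * b) hc₀ hζ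
    (by positivity) (by positivity)
  refine ⟨2 * T, by linarith, fun n δ 𝒱 w hn hδ hnδ h hw hwb => ?_⟩
  refine le_trans (measure_mono ?_)
    (hT n δ 𝒱 (wComb w) 1 hn hδ hnδ le_rfl h (h.isDominated_wComb hw hb hwb))
  intro s hs
  simp only [Set.mem_ofPred_eq, not_forall, not_le] at hs
  obtain ⟨f, hf, hs⟩ := hs
  set V := √(∫ z, vecSq f z ∂Q) with hV
  have hV2 : ∫ z, vecSq f z ∂Q = V ^ 2 := (Real.sq_sqrt (integral_nonneg (vecSq_nonneg _))).symm
  have hV0 : 0 ≤ V := Real.sqrt_nonneg _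
  rcases le_or_gt V δ with hle | hlt
  · refine ⟨f, hf, ?_, lt_of_le_of_lt ?_ hs⟩
    · rw [hV2, one_mul]; gcongr
    · rw [max_eq_right hle]; nlinarith
  -- A function of norm above `δ` is shrunk to norm between `δ / 2` and `δ`. By linearity the
  -- deviation scales by the same `q` as the norm, so no peeling over scales is needed.
  · obtain ⟨q, hq0, hq1, hq2, hq3⟩ := exists_rat_shrink hδ hlt
    refine ⟨(q : ℝ) • f, h.smul_mem f hf q (by exact_mod_cast hq0.le) (by exact_mod_cast hq1),
      ?_, ?_⟩
    · rw [integral_vecSq_smul, hV2, one_mul, ← mul_pow]; gcongr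
    · rw [wComb_smul, empMean_smul]
      simp only [Pi.smul_apply, smul_eq_mul, integral_const_mul, ← mul_sub, abs_mul, abs_of_pos hq0]
      rw [max_eq_left hlt.le] at hs
      calc T * 1 * δ ^ 2 = T * δ * δ := by ring
        _ ≤ T * δ * (2 * (q * V)) := by gcongr
        _ = q * (2 * T * δ * V) := by ring
        _ < _ := by gcongr

/-- Uniform deviations of squared weighted combinations. -/
lemma exists_measure_wComb_sq_deviation_le (Q : Measure S) [IsProbabilityMeasure Q] (d : ℕ)
    {c₀ ζ b θ : ℝ} (hc₀ : 0 < c₀) (hζ : 0 < ζ) (hb : 0 ≤ b) (hθ : 0 < θ) :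
    ∃ K : ℝ, 1 ≤ K ∧ ∀ (n : ℕ) (δ : ℝ) (𝒱 : Set (S → Fin d → ℝ)) (w : S → Fin d → ℝ), 0 < n →
      0 < δ → c₀ ≤ n * δ ^ 2 → IsRademacherClass Q n δ 𝒱 → Measurable w →
      (∀ᵐ z ∂Q, ∀ k, |w z k| ≤ b) →
      sampleLaw Q n {s | ¬ ∀ f ∈ 𝒱, |empMean s (fun z => wComb w f z ^ 2) -
        ∫ z, wComb w f z ^ 2 ∂Q| ≤
        θ * max (∫ z, vecSq f z ∂Q) ((K * δ) ^ 2)} ≤ ENNReal.ofReal ζ := by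
  obtain ⟨T, hT1, hT⟩ := exists_measure_deviation_le Q d (Ca := (d * b) ^ 2 * (d * b ^ 2))
    (Cr := 2 * (2 * (d * b)) * (2 * b)) hc₀ hζ (by positivity) (by positivity)
  -- At radius `κ * δ` the deviation `T * κ * δ ^ 2` is linear in `κ` while the allowance `θ * (κ *
  -- δ) ^ 2` is quadratic, so a large `κ` accommodates any `θ > 0`. The 4 is the square of the
  -- factor lost in rational shrinking.
  obtain ⟨κ, hκ1, hκ2⟩ : ∃ κ : ℝ, 1 ≤ κ ∧ 4 * T ≤ θ * κ := by
    refine ⟨1 + 4 * T / θ, ?_, ?_⟩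
    · have : 0 ≤ 4 * T / θ := by positivity
      linarith
    · rw [mul_add, mul_div_cancel₀ _ hθ.ne']; linarith
  have hκ0 : 0 < κ := by linarith
  have hT0 : 0 < T := by linarith
  refine ⟨κ, hκ1, fun n δ 𝒱 w hn hδ hnδ h hw hwb => ?_⟩
  refine le_trans (measure_mono ?_) (hT n δ 𝒱 (fun f z => wComb w f z ^ 2) κ hn hδ hnδ hκ1 h
    (h.isDominated_wComb_sq hw hb hwb))
  intro s hs
  simp only [Set.mem_ofPred_eq, not_forall, not_le] at hs
  obtain ⟨f, hf, hs⟩ := hs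
  set V := √(∫ z, vecSq f z ∂Q) with hV
  have hV2 : ∫ z, vecSq f z ∂Q = V ^ 2 := (Real.sq_sqrt (integral_nonneg (vecSq_nonneg _))).symm
  have hV0 : 0 ≤ V := Real.sqrt_nonneg _
  have hκδ : 0 < κ * δ := by positivity
  rw [hV2] at hs
  rcases le_or_gt V (κ * δ) with hle | hlt
  · refine ⟨f, hf, ?_, lt_of_le_of_lt ?_ hs⟩
    · rw [hV2]; gcongr
    · rw [max_eq_right (by gcongr)]
      calc T * κ * δ ^ 2 ≤ (θ * κ) * κ * δ ^ 2 := by gcongr; linarith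
        _ = _ := by ring
  · obtain ⟨q, hq0, hq1, hq2, hq3⟩ := exists_rat_shrink hκδ hlt
    refine ⟨(q : ℝ) • f, h.smul_mem f hf q (by exact_mod_cast hq0.le) (by exact_mod_cast hq1),
      ?_, ?_⟩
    · rw [integral_vecSq_smul, hV2, ← mul_pow]; gcongr
    · have hsm : (fun z => wComb w ((q : ℝ) • f) z ^ 2) =
          (q : ℝ) ^ 2 • fun z => wComb w f z ^ 2 := by
        ext z; rw [wComb_smul]; simp [mul_pow]
      have hint : ∫ z, wComb w ((q : ℝ) • f) z ^ 2 ∂Q = q ^ 2 * ∫ z, wComb w f z ^ 2 ∂Q := by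
        rw [← integral_const_mul]
        exact integral_congr_ae (ae_of_all _ fun z => congrFun hsm z)
      rw [hint, hsm, empMean_smul, ← mul_sub, abs_mul, abs_of_pos (pow_pos hq0 2)]
      rw [max_eq_left (by gcongr)] at hs
      refine lt_of_le_of_lt ?_ (mul_lt_mul_of_pos_left hs (pow_pos hq0 2))
      have h1 : (κ * δ) ^ 2 ≤ (2 * (q * V)) ^ 2 := by gcongr
      have h2 : T * κ * δ ^ 2 * κ ≤ q ^ 2 * (θ * V ^ 2) * κ := by
        calc T * κ * δ ^ 2 * κ = T * (κ * δ) ^ 2 := by ring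
          _ ≤ T * (2 * (q * V)) ^ 2 := by gcongr
          _ = (4 * T) * (q * V) ^ 2 := by ring
          _ ≤ (θ * κ) * (q * V) ^ 2 := by gcongr
          _ = _ := by ring
      exact le_of_mul_le_mul_right h2 hκ0

end IsRademacherClass

end Deviation

/-! ### From countable classes to pointwise measurable classes. -/

section PointwiseLimits

variable {S : Type*} {d : ℕ}

lemma tendsto_vecSq {u : ℕ → S → Fin d → ℝ} {f : S → Fin d → ℝ} {z : S}
    (h : ∀ k, Tendsto (fun j => u j z k) atTop (𝓝 (f z k))) :
    Tendsto (fun j => vecSq (u j) z) atTop (𝓝 (vecSq f z)) :=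
  tendsto_finsetSum _ fun k _ => (h k).pow 2

lemma tendsto_wComb {w : S → Fin d → ℝ} {u : ℕ → S → Fin d → ℝ} {f : S → Fin d → ℝ} {z : S}
    (h : ∀ k, Tendsto (fun j => u j z k) atTop (𝓝 (f z k))) :
    Tendsto (fun j => wComb w (u j) z) atTop (𝓝 (wComb w f z)) :=
  tendsto_finsetSum _ fun k _ => (h k).const_mul _

lemma tendsto_empMean {n : ℕ} {s : Fin n → S} {u : ℕ → S → ℝ} {g : S → ℝ}
    (h : ∀ z, Tendsto (fun j => u j z) atTop (𝓝 (g z))) :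
    Tendsto (fun j => empMean s (u j)) atTop (𝓝 (empMean s g)) :=
  (tendsto_finsetSum _ fun i _ => h (s i)).const_mul _

variable [MeasurableSpace S]

lemma tendsto_integral_of_abs_le {Q : Measure S} [IsFiniteMeasure Q] {u : ℕ → S → ℝ} {g : S → ℝ}
    {C : ℝ} (hm : ∀ j, Measurable (u j)) (hb : ∀ j, ∀ᵐ z ∂Q, |u j z| ≤ C)
    (h : ∀ z, Tendsto (fun j => u j z) atTop (𝓝 (g z))) :
    Tendsto (fun j => ∫ z, u j z ∂Q) atTop (𝓝 (∫ z, g z ∂Q)) :=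
  tendsto_integral_of_dominated_convergence (fun _ => C) (fun j => (hm j).aestronglyMeasurable)
    (integrable_const C) hb (ae_of_all _ h)

/-- `f` is a pointwise limit of members of `𝒱`. -/
def IsPtLimit {S : Type*} (𝒱 : Set (S → Fin d → ℝ)) (f : S → Fin d → ℝ) : Prop :=
  ∃ u : ℕ → S → Fin d → ℝ, (∀ j, u j ∈ 𝒱) ∧
    ∀ z k, Tendsto (fun j => u j z k) atTop (𝓝 (f z k))

namespace IsRademacherClass

variable {Q : Measure S} {n : ℕ} {δ : ℝ} {𝒱 : Set (S → Fin d → ℝ)}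

/-- The countable class consists of rational multiples in `[0, 1]` of tuples from the dense
countable subclasses. Its coordinates stay in the star hulls, so the complexity bounds are
inherited; factor 1 already gives all pointwise limits. -/
lemma exists_of_pointwiseMeasurable {𝒢 : Fin d → Set (S → ℝ)} (hne : ∀ k, (𝒢 k).Nonempty)
    (hsep : ∀ k, PointwiseMeasurable (𝒢 k)) (hm : ∀ k, ∀ g ∈ 𝒢 k, Measurable g)
    (hb : ∀ k, ∀ g ∈ 𝒢 k, ∀ᵐ z ∂Q, |g z| ≤ 1)
    (hrad : ∀ k, localRademacher Q n δ (starHull (𝒢 k)) ≤ ENNReal.ofReal (δ ^ 2)) :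
    ∃ 𝒱 : Set (S → Fin d → ℝ), IsRademacherClass Q n δ 𝒱 ∧
      ∀ f : S → Fin d → ℝ, (∀ k, (fun s => f s k) ∈ 𝒢 k) → IsPtLimit 𝒱 f := by
  choose 𝒟 hsub hcount hdense using hsep
  have hneD : ∀ k, (𝒟 k).Nonempty := fun k => by
    obtain ⟨g, hg⟩ := hne k
    obtain ⟨u, hu, -⟩ := hdense k g hg
    exact ⟨_, hu 0⟩
  let 𝒱 : Set (S → Fin d → ℝ) := (fun (p : ℚ × (Fin d → S → ℝ)) (s : S) k => (p.1 : ℝ) * p.2 k s) ''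
    ({q : ℚ | 0 ≤ q ∧ q ≤ 1} ×ˢ Set.univ.pi 𝒟)
  have hcoord : ∀ k, coordSet 𝒱 k ⊆ starHull (𝒢 k) := by
    rintro k _ ⟨_, ⟨⟨q, g⟩, ⟨⟨h0, h1⟩, hg⟩, rfl⟩, rfl⟩
    exact ⟨g k, hsub k (hg k (Set.mem_univ k)), q, by exact_mod_cast h0, by exact_mod_cast h1, rfl⟩
  refine ⟨𝒱, ⟨?_, ?_, ?_, ?_, ?_, ?_⟩, ?_⟩
  · exact ((Set.to_countable _).prod (Set.countable_univ_pi hcount)).image _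
  · choose g hg using hneD
    exact ⟨(0, g), ⟨⟨le_rfl, zero_le_one⟩, fun k _ => hg k⟩, by ext; simp⟩
  · rintro _ ⟨⟨q, g⟩, ⟨-, hg⟩, rfl⟩
    exact measurable_pi_lambda _ fun k =>
      (hm k _ (hsub k (hg k (Set.mem_univ k)))).const_mul _
  · rintro _ ⟨⟨q', g⟩, ⟨⟨h0', h1'⟩, hg⟩, rfl⟩ q h0 h1
    refine ⟨(q * q', g), ⟨⟨mul_nonneg h0 h0', mul_le_one₀ h1 h0' h1'⟩, hg⟩, ?_⟩
    ext s k; simp [mul_assoc]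
  · rintro _ ⟨⟨q, g⟩, ⟨⟨h0, h1⟩, hg⟩, rfl⟩
    have : ∀ᵐ z ∂Q, ∀ k, |g k z| ≤ 1 :=
      ae_all_iff.2 fun k => hb k _ (hsub k (hg k (Set.mem_univ k)))
    filter_upwards [this] with z hz k
    have h0' : (0 : ℝ) ≤ q := by exact_mod_cast h0
    have h1' : (q : ℝ) ≤ 1 := by exact_mod_cast h1
    rw [abs_mul, abs_of_nonneg h0']
    exact mul_le_one₀ h1' (abs_nonneg _) (hz k)
  · exact fun k => (localRademacher_mono Q n δ (hcoord k)).trans (hrad k)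
  · intro f hf
    choose u hu hlim using fun k => hdense k _ (hf k)
    refine ⟨fun j s k => u k j s, fun j => ⟨(1, fun k => u k j),
      ⟨⟨zero_le_one, le_rfl⟩, fun k _ => hu k j⟩, by ext; simp⟩, fun z k => hlim k z⟩

variable [IsProbabilityMeasure Q]

lemma tendsto_integral_vecSq (h : IsRademacherClass Q n δ 𝒱) {u : ℕ → S → Fin d → ℝ}
    {f : S → Fin d → ℝ} (hu : ∀ j, u j ∈ 𝒱)
    (hf : ∀ z k, Tendsto (fun j => u j z k) atTop (𝓝 (f z k))) :
    Tendsto (fun j => ∫ z, vecSq (u j) z ∂Q) atTop (𝓝 (∫ z, vecSq f z ∂Q)) := by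
  refine tendsto_integral_of_abs_le (C := d) (fun j => measurable_vecSq (h.meas _ (hu j)))
    (fun j => ?_) fun z => tendsto_vecSq (hf z)
  filter_upwards [h.bound _ (hu j)] with z hz
  rw [abs_of_nonneg (vecSq_nonneg _ _)]
  exact vecSq_le hz

/-- For a fixed sample the inequality is closed under pointwise limits: empirical means are finite
sums, and the integrals converge by domination because the class is uniformly bounded. -/
lemma wComb_deviation_of_isPtLimit (h : IsRademacherClass Q n δ 𝒱) {w : S → Fin d → ℝ}
    (hw : Measurable w) {b K : ℝ} (hwb : ∀ᵐ z ∂Q, ∀ k, |w z k| ≤ b) {s : Fin n → S}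
    (hs : ∀ f ∈ 𝒱, |empMean s (wComb w f) - ∫ z, wComb w f z ∂Q| ≤
        K * δ * max (√(∫ z, vecSq f z ∂Q)) δ) {f : S → Fin d → ℝ} (hf : IsPtLimit 𝒱 f) :
    |empMean s (wComb w f) - ∫ z, wComb w f z ∂Q| ≤ K * δ * max (√(∫ z, vecSq f z ∂Q)) δ := by
  obtain ⟨u, hu, hlim⟩ := hf
  have h1 := h.tendsto_integral_vecSq hu hlim
  have h2 : Tendsto (fun j => ∫ z, wComb w (u j) z ∂Q) atTop (𝓝 (∫ z, wComb w f z ∂Q)) := by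
    refine tendsto_integral_of_abs_le (C := d * b)
      (fun j => measurable_wComb hw (h.meas _ (hu j))) (fun j => ?_) fun z => tendsto_wComb (hlim z)
    filter_upwards [h.bound _ (hu j), hwb] with z hz hz' using abs_wComb_le hz' hz
  have h3 := tendsto_empMean (s := s) fun z => tendsto_wComb (w := w) (hlim z)
  refine le_of_tendsto_of_tendsto' (h3.sub h2).abs
    (((Real.continuous_sqrt.tendsto _).comp h1).max tendsto_const_nhds |>.const_mul _)
    fun j => hs _ (hu j)

lemma wComb_sq_deviation_of_isPtLimit (h : IsRademacherClass Q n δ 𝒱) {w : S → Fin d → ℝ}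
    (hw : Measurable w) {b θ c : ℝ} (hwb : ∀ᵐ z ∂Q, ∀ k, |w z k| ≤ b) {s : Fin n → S}
    (hs : ∀ f ∈ 𝒱, |empMean s (fun z => wComb w f z ^ 2) - ∫ z, wComb w f z ^ 2 ∂Q| ≤
        θ * max (∫ z, vecSq f z ∂Q) c) {f : S → Fin d → ℝ} (hf : IsPtLimit 𝒱 f) :
    |empMean s (fun z => wComb w f z ^ 2) - ∫ z, wComb w f z ^ 2 ∂Q| ≤
        θ * max (∫ z, vecSq f z ∂Q) c := by
  obtain ⟨u, hu, hlim⟩ := hf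
  have h1 := h.tendsto_integral_vecSq hu hlim
  have h2 : Tendsto (fun j => ∫ z, wComb w (u j) z ^ 2 ∂Q) atTop
      (𝓝 (∫ z, wComb w f z ^ 2 ∂Q)) := by
    refine tendsto_integral_of_abs_le (C := (d * b) ^ 2)
      (fun j => (measurable_wComb hw (h.meas _ (hu j))).pow_const 2) (fun j => ?_)
      fun z => (tendsto_wComb (hlim z)).pow 2
    filter_upwards [h.bound _ (hu j), hwb] with z hz hz'
    rw [abs_pow]
    exact pow_le_pow_left₀ (abs_nonneg _) (abs_wComb_le hz' hz) 2
  have h3 := tendsto_empMean (s := s) fun z => (tendsto_wComb (w := w) (hlim z)).pow 2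
  exact le_of_tendsto_of_tendsto' (h3.sub h2).abs
    ((h1.max tendsto_const_nhds).const_mul _) fun j => hs _ (hu j)

/-- The adversary complexity is assumed under the law of the covariates, while the weighted
functionals live on full observations. The image under `φ` of an i.i.d. sample is an i.i.d. sample
of the image law, so Rademacher averages agree. -/
lemma comp {X : Type*} [MeasurableSpace X] {φ : S → X} (hφ : Measurable φ)
    {𝒲 : Set (X → Fin d → ℝ)} (h : IsRademacherClass (Q.map φ) n δ 𝒲) :
    IsRademacherClass Q n δ ((fun f => f ∘ φ) '' 𝒲) where
  countable := h.countable.image _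
  zero_mem := ⟨0, h.zero_mem, rfl⟩
  meas := by rintro _ ⟨f, hf, rfl⟩; exact (h.meas f hf).comp hφ
  smul_mem := by
    rintro _ ⟨f, hf, rfl⟩ q h0 h1
    exact ⟨_, h.smul_mem f hf q h0 h1, rfl⟩
  bound := by
    rintro _ ⟨f, hf, rfl⟩
    exact ae_of_ae_map hφ.aemeasurable (h.bound f hf)
  rad k := by
    have : IsProbabilityMeasure (Q.map φ) := Measure.isProbabilityMeasure_map hφ.aemeasurable
    refine le_trans (le_of_eq ?_) (h.rad k)
    rw [localRademacher_eq, localRademacher_eq]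
    have hlaw : sampleLaw (Q.map φ) n = (sampleLaw Q n).map fun s i => φ (s i) := by
      unfold sampleLaw
      exact (Measure.pi_map_pi (μ := fun _ : Fin n => Q) (f := fun _ => φ)
        fun _ => hφ.aemeasurable).symm
    rw [hlaw, lintegral_map (h.measurable_radAvg_coord k δ) (by fun_prop)]
    refine lintegral_congr fun s => ?_
    unfold radAvg
    congr 1
    refine Finset.sum_congr rfl fun e _ => le_antisymm ?_ ?_
    · refine iSup₂_le ?_
      rintro _ ⟨⟨_, ⟨f, hf, rfl⟩, rfl⟩, hg⟩
      exact le_iSup₂_of_le (fun x => f x k) ⟨⟨f, hf, rfl⟩, hg⟩ le_rfl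
    · refine iSup₂_le ?_
      rintro _ ⟨⟨f, hf, rfl⟩, hg⟩
      exact le_iSup₂_of_le (fun s => f (φ s) k) ⟨⟨f ∘ φ, ⟨f, hf, rfl⟩, rfl⟩, hg⟩ le_rfl

end IsRademacherClass

end PointwiseLimits

/-! ### Deviation bounds above the critical radius -/

section CriticalRadius

variable {S : Type*} [MeasurableSpace S] (Q : Measure S) [IsProbabilityMeasure Q]

/-- Uniform deviations over a pointwise measurable scalar class. -/
lemma exists_measure_scalar_deviation_le {c₀ ζ : ℝ} (hc₀ : 0 < c₀) (hζ : 0 < ζ) :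
    ∃ K : ℝ, 1 ≤ K ∧ ∀ (n : ℕ) (δ : ℝ) (𝒢 : Set (S → ℝ)), 0 < n → 0 < δ → c₀ ≤ n * δ ^ 2 →
      𝒢.Nonempty → PointwiseMeasurable 𝒢 → (∀ g ∈ 𝒢, Measurable g) →
      (∀ g ∈ 𝒢, ∀ᵐ z ∂Q, |g z| ≤ 3) →
      localRademacher Q n δ (starHull 𝒢) ≤ ENNReal.ofReal (δ ^ 2) →
      sampleLaw Q n {s | ¬ ∀ g ∈ 𝒢, |empMean s g - ∫ z, g z ∂Q| ≤
        K * δ * max (√(∫ z, g z ^ 2 ∂Q)) δ} ≤ ENNReal.ofReal ζ := by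
  obtain ⟨K, hK1, hK⟩ := IsRademacherClass.exists_measure_wComb_deviation_le Q 1 hc₀ hζ zero_le_one
  refine ⟨3 * K, by linarith, fun n δ 𝒢 hn hδ hnδ hne hsep hm hb hrad => ?_⟩
  -- Division by 3 makes the class bounded by one, and its star hull lies in that of `𝒢`, so the
  -- complexity bound is kept.
  let 𝒢' : Set (S → ℝ) := (fun g => (3⁻¹ : ℝ) • g) '' 𝒢
  have hstar : starHull 𝒢' ⊆ starHull 𝒢 := by
    rintro _ ⟨_, ⟨g, hg, rfl⟩, r, h0, h1, rfl⟩
    exact ⟨g, hg, r * 3⁻¹, by positivity, by nlinarith, smul_smul _ _ _⟩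
  have hsep' : PointwiseMeasurable 𝒢' := by
    obtain ⟨𝒟, hsub, hc, hd⟩ := hsep
    refine ⟨(fun g => (3⁻¹ : ℝ) • g) '' 𝒟, Set.image_mono hsub, hc.image _, ?_⟩
    rintro _ ⟨g, hg, rfl⟩
    obtain ⟨u, hu, hlim⟩ := hd g hg
    exact ⟨fun k => (3⁻¹ : ℝ) • u k, fun k => ⟨_, hu k, rfl⟩, fun s => (hlim s).const_mul _⟩
  obtain ⟨𝒱, hV, hlim⟩ := IsRademacherClass.exists_of_pointwiseMeasurable (Q := Q) (n := n)
    (δ := δ) (𝒢 := fun _ : Fin 1 => 𝒢') (fun _ => hne.image _) (fun _ => hsep')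
    (by rintro _ _ ⟨g, hg, rfl⟩; exact (hm g hg).const_smul _)
    (by
      rintro _ _ ⟨g, hg, rfl⟩
      filter_upwards [hb g hg] with z hz
      rw [Pi.smul_apply, smul_eq_mul, abs_mul, abs_of_pos (by norm_num)]
      linarith)
    (fun _ => (localRademacher_mono Q n δ hstar).trans hrad)
  have hw : ∀ᵐ z ∂Q, ∀ k, |(fun (_ : S) (_ : Fin 1) => (1 : ℝ)) z k| ≤ 1 :=
    ae_of_all _ fun z k => by simp
  refine le_trans (measure_mono fun s hs => ?_)
    (hK n δ 𝒱 (fun _ _ => 1) hn hδ hnδ hV measurable_const hw)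
  rw [Set.mem_ofPred_eq] at hs ⊢
  refine fun hs' => hs ?_
  intro g hg
  have := hV.wComb_deviation_of_isPtLimit measurable_const hw hs'
    (hlim (fun s _ => 3⁻¹ * g s) fun _ => ⟨g, hg, rfl⟩)
  have e1 : (wComb (fun (_ : S) (_ : Fin 1) => (1 : ℝ)) fun s _ => 3⁻¹ * g s) =
      (3⁻¹ : ℝ) • g := by ext; simp [wComb]
  have e2 : ∀ z, vecSq (fun s (_ : Fin 1) => 3⁻¹ * g s) z = (3⁻¹) ^ 2 * g z ^ 2 := by
    intro z; simp [vecSq, mul_pow]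
  rw [e1, empMean_smul] at this
  simp only [e2, Pi.smul_apply, smul_eq_mul, integral_const_mul, ← mul_sub] at this
  rw [abs_mul, abs_of_pos (by norm_num), Real.sqrt_mul (by norm_num),
    Real.sqrt_sq (by norm_num)] at this
  have hmax : max (3⁻¹ * √(∫ z, g z ^ 2 ∂Q)) δ ≤ max (√(∫ z, g z ^ 2 ∂Q)) δ :=
    max_le_max (by nlinarith [Real.sqrt_nonneg (∫ z, g z ^ 2 ∂Q)]) le_rfl
  have h2 : K * δ * max (3⁻¹ * √(∫ z, g z ^ 2 ∂Q)) δ ≤ K * δ * max (√(∫ z, g z ^ 2 ∂Q)) δ :=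
    mul_le_mul_of_nonneg_left hmax (by positivity)
  nlinarith

variable {X : Type*} [MeasurableSpace X] {d : ℕ}

/-- Uniform deviations of weighted combinations over pointwise measurable coordinate classes of
functions of `φ`. -/
lemma exists_measure_weighted_deviation_le (d : ℕ) {φ : S → X} (hφ : Measurable φ) {c₀ ζ b : ℝ}
    (hc₀ : 0 < c₀) (hζ : 0 < ζ) (hb0 : 0 ≤ b) :
    ∃ K : ℝ, 1 ≤ K ∧ ∀ (n : ℕ) (δ : ℝ) (𝒢 : Fin d → Set (X → ℝ)) (w : S → Fin d → ℝ), 0 < n →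
      0 < δ → c₀ ≤ n * δ ^ 2 → (∀ k, (𝒢 k).Nonempty) → (∀ k, PointwiseMeasurable (𝒢 k)) →
      (∀ k, ∀ g ∈ 𝒢 k, Measurable g) → (∀ k, ∀ g ∈ 𝒢 k, ∀ᵐ x ∂(Q.map φ), |g x| ≤ 1) →
      (∀ k, localRademacher (Q.map φ) n δ (starHull (𝒢 k)) ≤ ENNReal.ofReal (δ ^ 2)) →
      Measurable w → (∀ᵐ z ∂Q, ∀ k, |w z k| ≤ b) →
      sampleLaw Q n {s | ¬ ∀ f : X → Fin d → ℝ, (∀ k, (fun x => f x k) ∈ 𝒢 k) →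
        |empMean s (wComb w (f ∘ φ)) - ∫ z, wComb w (f ∘ φ) z ∂Q| ≤
        K * δ * max (√(∫ z, vecSq (f ∘ φ) z ∂Q)) δ} ≤ ENNReal.ofReal ζ := by
  obtain ⟨K, hK1, hK⟩ := IsRademacherClass.exists_measure_wComb_deviation_le Q d hc₀ hζ hb0
  refine ⟨K, hK1, fun n δ 𝒢 w hn hδ hnδ hne hsep hm hb hrad hw hwb => ?_⟩
  obtain ⟨𝒱, hV, hlim⟩ := IsRademacherClass.exists_of_pointwiseMeasurable hne hsep hm hb hrad
  have hV' := hV.comp hφ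
  refine le_trans (measure_mono fun s hs => ?_) (hK n δ _ w hn hδ hnδ hV' hw hwb)
  rw [Set.mem_ofPred_eq] at hs ⊢
  refine fun hs' => hs ?_
  intro f hf
  obtain ⟨u, hu, hul⟩ := hlim f hf
  exact hV'.wComb_deviation_of_isPtLimit hw hwb hs'
    ⟨fun j => u j ∘ φ, fun j => ⟨_, hu j, rfl⟩, fun z k => hul (φ z) k⟩

/-- Uniform deviations of squared weighted combinations over pointwise measurable coordinate
classes of functions of `φ`. -/
lemma exists_measure_weighted_sq_deviation_le (d : ℕ) {φ : S → X} (hφ : Measurable φ)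
    {c₀ ζ b θ : ℝ} (hc₀ : 0 < c₀) (hζ : 0 < ζ) (hb0 : 0 ≤ b) (hθ : 0 < θ) :
    ∃ K : ℝ, 1 ≤ K ∧ ∀ (n : ℕ) (δ : ℝ) (𝒢 : Fin d → Set (X → ℝ)) (w : S → Fin d → ℝ), 0 < n →
      0 < δ → c₀ ≤ n * δ ^ 2 → (∀ k, (𝒢 k).Nonempty) → (∀ k, PointwiseMeasurable (𝒢 k)) →
      (∀ k, ∀ g ∈ 𝒢 k, Measurable g) → (∀ k, ∀ g ∈ 𝒢 k, ∀ᵐ x ∂(Q.map φ), |g x| ≤ 1) →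
      (∀ k, localRademacher (Q.map φ) n δ (starHull (𝒢 k)) ≤ ENNReal.ofReal (δ ^ 2)) →
      Measurable w → (∀ᵐ z ∂Q, ∀ k, |w z k| ≤ b) →
      sampleLaw Q n {s | ¬ ∀ f : X → Fin d → ℝ, (∀ k, (fun x => f x k) ∈ 𝒢 k) →
        |empMean s (fun z => wComb w (f ∘ φ) z ^ 2) - ∫ z, wComb w (f ∘ φ) z ^ 2 ∂Q| ≤
        θ * max (∫ z, vecSq (f ∘ φ) z ∂Q) ((K * δ) ^ 2)} ≤ ENNReal.ofReal ζ := by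
  obtain ⟨K, hK1, hK⟩ :=
    IsRademacherClass.exists_measure_wComb_sq_deviation_le Q d hc₀ hζ hb0 hθ
  refine ⟨K, hK1, fun n δ 𝒢 w hn hδ hnδ hne hsep hm hb hrad hw hwb => ?_⟩
  obtain ⟨𝒱, hV, hlim⟩ := IsRademacherClass.exists_of_pointwiseMeasurable hne hsep hm hb hrad
  have hV' := hV.comp hφ
  refine le_trans (measure_mono fun s hs => ?_) (hK n δ _ w hn hδ hnδ hV' hw hwb)
  rw [Set.mem_ofPred_eq] at hs ⊢
  refine fun hs' => hs ?_
  intro f hf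
  obtain ⟨u, hu, hul⟩ := hlim f hf
  exact hV'.wComb_sq_deviation_of_isPtLimit hw hwb hs'
    ⟨fun j => u j ∘ φ, fun j => ⟨_, hu j, rfl⟩, fun z k => hul (φ z) k⟩

end CriticalRadius

/-! ### Interpolation of the residuals along rays -/

section Interpolation

variable {q : ℕ}

/-- The weights are the Lagrange basis polynomials evaluated at 1; interpolation at five nodes is
exact up to degree four. -/
lemma exists_interpolation_weights {t : Fin 5 → ℝ} (ht : Function.Injective t) :
    ∃ c : Fin 5 → ℝ, ∀ i : Fin 5, ∑ j, c j * t j ^ (i : ℕ) = 1 := by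
  refine ⟨fun j => (Lagrange.basis Finset.univ t j).eval 1, fun i => ?_⟩
  have h := Lagrange.eq_interpolate (s := Finset.univ) (v := t)
    (f := (Polynomial.X ^ (i : ℕ) : Polynomial ℝ)) ht.injOn (by
      rw [Polynomial.degree_X_pow]; simp)
  have h2 := congrArg (Polynomial.eval 1) h
  simp only [Polynomial.eval_pow, Polynomial.eval_X, one_pow, Lagrange.interpolate_apply,
    Polynomial.eval_finsetSum, Polynomial.eval_mul, Polynomial.eval_C] at h2
  exact (Finset.sum_congr rfl fun j _ => mul_comm _ _).trans h2.symm

/-- Along rays, the residuals are polynomials of degree at most four. -/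
lemma W_smul_eq_sum (α : Param q) (z : Obs q) (k : Fin 8) :
    ∃ a : Fin 5 → ℝ, ∀ t : ℝ, (t • α).W z k = ∑ i, a i * t ^ (i : ℕ) := by
  set y := obsY z
  set x := obsX z
  set g := obsG z
  set p := obsP z
  have hW : ∀ t : ℝ, (t • α).W z = ![g - t * α.h1 x,
    (p - t * α.h2 x g),
    g ^ 2 - t * α.h3 x,
    (p - t * α.h2 x g) * y - t * α.h4 x,
    p * (p - t * α.h2 x g) - t * α.h5 x,
    p ^ 2 * (p - t * α.h2 x g) - t * α.h6 x,
    (g - t * α.h1 x) * (p - t * α.h2 x g) * y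
      - ((g - t * α.h1 x) * (p - t * α.h2 x g) * p) * (t * α.β1 x)
      - ((g - t * α.h1 x) * (p - t * α.h2 x g) * p ^ 2) * (t * α.β2 x),
    (g * (g - t * α.h1 x) * (p - t * α.h2 x g) * y
        - (t * α.h3 x - (t * α.h1 x) ^ 2) * (t * α.h4 x))
      - (g * (g - t * α.h1 x) * (p - t * α.h2 x g) * p
        - (t * α.h3 x - (t * α.h1 x) ^ 2) * (t * α.h5 x)) * (t * α.β1 x)
      - (g * (g - t * α.h1 x) * (p - t * α.h2 x g) * p ^ 2
        - (t * α.h3 x - (t * α.h1 x) ^ 2) * (t * α.h6 x)) * (t * α.β2 x)] := fun t => rfl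
  simp only [hW]
  generalize α.h1 x = h1
  generalize α.h2 x g = h2
  generalize α.h3 x = h3
  generalize α.h4 x = h4
  generalize α.h5 x = h5
  generalize α.h6 x = h6
  generalize α.β1 x = b1
  generalize α.β2 x = b2
  simp only [Fin.sum_univ_five]
  fin_cases k
  · exact ⟨![g, -h1, 0, 0, 0], fun t => by simp; ring⟩
  · exact ⟨![p, -h2, 0, 0, 0], fun t => by simp; ring⟩
  · exact ⟨![g ^ 2, -h3, 0, 0, 0], fun t => by simp; ring⟩
  · exact ⟨![p * y, -h2 * y - h4, 0, 0, 0], fun t => by simp; ring⟩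
  · exact ⟨![p ^ 2, -p * h2 - h5, 0, 0, 0], fun t => by simp; ring⟩
  · exact ⟨![p ^ 3, -p ^ 2 * h2 - h6, 0, 0, 0], fun t => by simp; ring⟩
  · exact ⟨![g * p * y, -(g * h2 + h1 * p) * y - g * p * (p * b1 + p ^ 2 * b2),
      h1 * h2 * y + (g * h2 + h1 * p) * (p * b1 + p ^ 2 * b2),
      -h1 * h2 * (p * b1 + p ^ 2 * b2), 0], fun t => by simp; ring⟩
  -- Degree four occurs only here, through `h1 ^ 2` inside `v` times `h5 * b1` and `h6 * b2`.
  · exact ⟨![g * (g * p * y), g * (-(g * h2 + h1 * p) * y - g * p * (p * b1 + p ^ 2 * b2)),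
      g * (h1 * h2 * y + (g * h2 + h1 * p) * (p * b1 + p ^ 2 * b2)) - h3 * h4,
      g * (-h1 * h2 * (p * b1 + p ^ 2 * b2)) + h1 ^ 2 * h4 + h3 * (h5 * b1 + h6 * b2),
      -h1 ^ 2 * (h5 * b1 + h6 * b2)], fun t => by simp; ring⟩

/-- Nodes and weights depend on `R` only, not on `α`, so constants stay uniform over the ball. The
last clause makes the distances of the nodes to `α₀` comparable, so that one adversary can meet the
constraint of the product class at every node simultaneously. -/
lemma exists_interpolation (H : NormedFunctionSpace (Param q)) (α₀ : H.carrier) {A : ℝ}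
    (hA : 0 < A) {R : ℝ} (hR : 0 ≤ R) :
    ∃ t c : Fin 5 → ℝ, (∀ j, 0 ≤ t j ∧ t j ≤ 1) ∧ ∀ α : H.carrier, H.norm α ≤ R →
      (∀ j, H.norm (t j • α) ^ 2 ≤ A) ∧
      (∀ z k, (α : Param q).W z k = ∑ j, c j * ((t j • α : H.carrier) : Param q).W z k) ∧
      ∀ j k, H.norm (t k • α - α₀) ≤ 5 * H.norm (t j • α - α₀) := by
  -- The first bound on `t₀ * R` puts the nodes into the ball `H_A`; the second keeps them within
  -- half of `‖α₀‖` of the origin.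
  obtain ⟨t₀, ht0, ht1, htA, hta⟩ : ∃ t₀ : ℝ, 0 < t₀ ∧ t₀ ≤ 1 ∧ t₀ * R ≤ √A ∧
      (0 < H.norm α₀ → t₀ * R ≤ H.norm α₀ / 2) := by
    have hsA : 0 < √A := Real.sqrt_pos.2 hA
    have key : ∀ x : ℝ, 0 < x → x / (R + x) * R ≤ x := fun x hx => by
      rw [div_mul_eq_mul_div, div_le_iff₀ (by positivity)]; nlinarith
    have key1 : ∀ x : ℝ, 0 < x → x / (R + x) ≤ 1 := fun x hx => by
      rw [div_le_one (by positivity)]; linarith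
    by_cases ha : 0 < H.norm α₀
    · refine ⟨min (√A / (R + √A)) ((H.norm α₀ / 2) / (R + H.norm α₀ / 2)),
        lt_min (by positivity) (by positivity), (min_le_left _ _).trans (key1 _ hsA), ?_,
        fun _ => ?_⟩
      · exact (mul_le_mul_of_nonneg_right (min_le_left _ _) hR).trans (key _ hsA)
      · exact (mul_le_mul_of_nonneg_right (min_le_right _ _) hR).trans (key _ (half_pos ha))
    · exact ⟨√A / (R + √A), by positivity, key1 _ hsA, key _ hsA, fun h => absurd h ha⟩
  let t : Fin 5 → ℝ := fun j => t₀ * ((j : ℕ) + 1) / 5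
  have htpos : ∀ j, 0 < t j := fun j => by positivity
  have htle : ∀ j, t j ≤ t₀ := fun j => by
    have hj : ((j : ℕ) : ℝ) ≤ 4 := by exact_mod_cast Nat.lt_succ_iff.1 j.2
    simp only [t]; nlinarith
  have htge : ∀ j, t₀ ≤ 5 * t j := fun j => by
    have hj : (0 : ℝ) ≤ ((j : ℕ) : ℝ) := by positivity
    simp only [t]; nlinarith
  have hinj : Function.Injective t := by
    intro i j hij
    simp only [t] at hij
    have h1 : ((i : ℕ) : ℝ) = (j : ℕ) := by
      have h2 : t₀ * ((i : ℕ) + 1) = t₀ * ((j : ℕ) + 1) := by linarith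
      have := mul_left_cancel₀ ht0.ne' h2
      linarith
    exact Fin.ext (by exact_mod_cast h1)
  obtain ⟨c, hc⟩ := exists_interpolation_weights hinj
  refine ⟨t, c, fun j => ⟨(htpos j).le, (htle j).trans ht1⟩, fun α hα => ⟨?_, ?_, ?_⟩⟩
  · intro j
    rw [map_smul_eq_mul, Real.norm_of_nonneg (htpos j).le]
    have : t j * H.norm α ≤ √A :=
      (mul_le_mul (htle j) hα (apply_nonneg _ _) ht0.le).trans htA
    calc (t j * H.norm α) ^ 2 ≤ √A ^ 2 :=
          pow_le_pow_left₀ (mul_nonneg (htpos j).le (apply_nonneg _ _)) this 2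
      _ = A := Real.sq_sqrt hA.le
  · intro z k
    obtain ⟨a, ha⟩ := W_smul_eq_sum (α : Param q) z k
    have h1 := ha 1
    rw [one_smul] at h1
    simp only [Submodule.coe_smul, ha, h1, Finset.mul_sum]
    rw [Finset.sum_comm]
    refine Finset.sum_congr rfl fun i _ => ?_
    rw [one_pow, mul_one]
    calc a i = a i * ∑ j, c j * t j ^ (i : ℕ) := by rw [hc i, mul_one]
      _ = _ := by rw [Finset.mul_sum]; exact Finset.sum_congr rfl fun j _ => by ring
  · intro j k
    have hn : ∀ j, H.norm (t j • α) = t j * H.norm α := fun j => by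
      rw [map_smul_eq_mul, Real.norm_of_nonneg (htpos j).le]
    have h1 : H.norm (t k • α - α₀) ≤ t k * H.norm α + H.norm α₀ := by
      rw [← hn]; exact map_sub_le_add _ _ _
    have h2 : t j * H.norm α ≤ H.norm (t j • α - α₀) + H.norm α₀ := by
      rw [← hn]
      have := map_add_le_add H.norm (t j • α - α₀) α₀
      rwa [sub_add_cancel] at this
    have h3 : H.norm α₀ ≤ H.norm (t j • α - α₀) + t j * H.norm α := by
      rw [← hn, map_sub_rev]
      have := map_add_le_add H.norm (α₀ - t j • α) (t j • α)
      rwa [sub_add_cancel] at this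
    have hα0 : 0 ≤ H.norm α := apply_nonneg _ _
    have h4 : ∀ j, t j * H.norm α ≤ t₀ * R := fun j => mul_le_mul (htle j) hα hα0 ht0.le
    -- If `‖α₀‖ > 0`, all distances lie between `‖α₀‖ / 2` and `3 ‖α₀‖ / 2`. If `‖α₀‖ = 0`, the
    -- distances are `t j * ‖α‖`, and the ratio of two nodes is at most 5.
    by_cases ha : 0 < H.norm α₀
    · have := hta ha
      have := h4 j
      have := h4 k
      linarith
    · have h0 : H.norm α₀ = 0 := le_antisymm (not_lt.1 ha) (apply_nonneg _ _)
      have : t k * H.norm α ≤ 5 * (t j * H.norm α) := by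
        rw [← mul_assoc]
        exact mul_le_mul_of_nonneg_right ((htle k).trans (htge j)) hα0
      linarith

end Interpolation

/-! ### Measurability and boundedness of the residuals -/

section Residuals

variable {q : ℕ}

lemma measurable_obsX : Measurable (obsX : Obs q → Fin q → ℝ) := by unfold obsX; fun_prop

lemma measurable_obsG : Measurable (obsG : Obs q → ℝ) := by unfold obsG; fun_prop

lemma measurable_obsY : Measurable (obsY : Obs q → ℝ) := by unfold obsY; fun_prop

lemma measurable_obsP : Measurable (obsP : Obs q → ℝ) := by unfold obsP; fun_prop

lemma measurable_W {α : Param q} (hα : α.IsMeas) : Measurable α.W := by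
  have hk : ∀ k, Measurable fun z : Obs q => α.1 k (obsX z) := fun k =>
    (hα.1 k).comp measurable_obsX
  have h2 : Measurable fun z : Obs q => α.2 (obsX z) (obsG z) :=
    hα.2.comp (measurable_obsX.prodMk measurable_obsG)
  have hY := measurable_obsY (q := q)
  have hG := measurable_obsG (q := q)
  have hP := measurable_obsP (q := q)
  have h0 := hk 0
  have h1 := hk 1
  have h2' := hk 2
  have h3 := hk 3
  have h4 := hk 4
  have h5 := hk 5
  have h6 := hk 6
  refine measurable_pi_lambda _ fun k => ?_
  simp only [Param.W, Param.β1, Param.β2, Param.h1, Param.h2, Param.h3, Param.h4, Param.h5,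
    Param.h6]
  fin_cases k <;> simp <;> fun_prop

lemma measurable_sqAt {α : Param q} (hα : α.IsMeas) :
    Measurable fun z : Obs q => α.sqAt (obsX z) (obsG z) := by
  have hk : ∀ k, Measurable fun z : Obs q => α.1 k (obsX z) := fun k =>
    (hα.1 k).comp measurable_obsX
  have h2 : Measurable fun z : Obs q => α.2 (obsX z) (obsG z) :=
    hα.2.comp (measurable_obsX.prodMk measurable_obsG)
  unfold Param.sqAt
  fun_prop

lemma sqAt_nonneg (α : Param q) (x : Fin q → ℝ) (g : ℝ) : 0 ≤ α.sqAt x g :=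
  add_nonneg (Finset.sum_nonneg fun _ _ => sq_nonneg _) (sq_nonneg _)

lemma sqAt_smul (t : ℝ) (α : Param q) (x : Fin q → ℝ) (g : ℝ) :
    (t • α).sqAt x g = t ^ 2 * α.sqAt x g := by
  simp [Param.sqAt, mul_pow, mul_add, Finset.mul_sum]

/-- Balls of `H` consist of uniformly bounded parameters with uniformly bounded residuals. -/
lemma exists_bound_on_ball {Q : Measure (Obs q)} {H : NormedFunctionSpace (Param q)}
    {F : ℕ → Fin 8 → NormedFunctionSpace ((Fin q → ℝ) → ℝ)} {A B : ℝ} (hA : 0 < A)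
    (hnorm : Normalized Q H F A B) {R : ℝ} (hR : 0 ≤ R) :
    ∃ C : ℝ, 1 ≤ C ∧ ∀ᵐ z ∂Q, ∀ α : H.carrier, H.norm α ≤ R →
      (α : Param q).sqAt (obsX z) (obsG z) ≤ C ∧ ∀ k, |(α : Param q).W z k| ≤ C := by
  -- Only the interpolation formula is used, so the anchor is taken to be 0. The pointwise size
  -- `sqAt` is homogeneous and needs just one rescaling into `H_A`.
  obtain ⟨t, c, ht, hint⟩ := exists_interpolation H 0 hA hR
  have hsA : 0 < √A := Real.sqrt_pos.2 hA
  have hRA : 0 < R + √A := by positivity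
  refine ⟨1 + ∑ j, |c j| + (√A / (R + √A))⁻¹ ^ 2, ?_, ?_⟩
  · have : 0 ≤ ∑ j, |c j| + (√A / (R + √A))⁻¹ ^ 2 := by positivity
    linarith
  filter_upwards [hnorm.H_bound] with z hz α hα
  obtain ⟨h1, h2, -⟩ := hint α hα
  have hs0 : 0 ≤ ∑ j, |c j| := by positivity
  have hs1 : 0 ≤ (√A / (R + √A))⁻¹ ^ 2 := by positivity
  constructor
  · have hsm : H.norm ((√A / (R + √A)) • α) ^ 2 ≤ A := by
      rw [map_smul_eq_mul, Real.norm_of_nonneg (by positivity)]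
      have : √A / (R + √A) * H.norm α ≤ √A := by
        rw [div_mul_eq_mul_div, div_le_iff₀ hRA]
        gcongr
        linarith
      calc _ ≤ √A ^ 2 := pow_le_pow_left₀ (mul_nonneg (by positivity) (apply_nonneg _ _)) this 2
        _ = A := Real.sq_sqrt hA.le
    have := (hz _ hsm).1
    rw [Submodule.coe_smul, sqAt_smul] at this
    have h3 : (α : Param q).sqAt (obsX z) (obsG z) ≤ (√A / (R + √A))⁻¹ ^ 2 := by
      rw [inv_pow, ← one_div, le_div_iff₀' (by positivity)]
      exact this
    linarith
  · intro k
    rw [h2 z k]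
    refine (Finset.abs_sum_le_sum_abs _ _).trans ?_
    have : ∑ j, |c j * ((t j • α : H.carrier) : Param q).W z k| ≤ ∑ j, |c j| := by
      refine Finset.sum_le_sum fun j _ => ?_
      rw [abs_mul]
      exact mul_le_of_le_one_right (abs_nonneg _) ((hz _ (h1 j)).2 k)
    linarith

end Residuals

/-! ### Conditional moments of the residuals -/

section Population

variable {q : ℕ}

lemma integral_comp_obsX {Q : Measure (Obs q)} {f : (Fin q → ℝ) → ℝ} (hf : Measurable f) :
    ∫ z, f (obsX z) ∂Q = ∫ x, f x ∂(lawX Q) :=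
  (integral_map measurable_obsX.aemeasurable hf.aestronglyMeasurable).symm

variable (Q : Measure (Obs q)) [IsProbabilityMeasure Q]

instance : IsProbabilityMeasure (lawX Q) :=
  Measure.isProbabilityMeasure_map measurable_obsX.aemeasurable

lemma lawX_compProd_condDistrib :
    lawX Q ⊗ₘ condDistrib id obsX Q = Q.map fun z => (obsX z, z) :=
  compProd_map_condDistrib aemeasurable_id

variable {Q}

/-- `Q` is the second marginal of the composition of the covariate law with the conditional law, and
null sets of that composition have null sections. -/
lemma ae_ae_condDistrib {p : Obs q → Prop} (h : ∀ᵐ z ∂Q, p z) :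
    ∀ᵐ x ∂(lawX Q), ∀ᵐ z ∂(condDistrib id obsX Q x), p z := by
  have hm : Measurable fun z : Obs q => (obsX z, z) := measurable_obsX.prodMk measurable_id
  have h1 : MeasurePreserving (Prod.snd : (Fin q → ℝ) × Obs q → Obs q)
      (lawX Q ⊗ₘ condDistrib id obsX Q) Q := by
    refine ⟨measurable_snd, ?_⟩
    rw [lawX_compProd_condDistrib, Measure.map_map measurable_snd hm]
    exact Measure.map_id
  exact Measure.ae_ae_of_ae_compProd (h1.quasiMeasurePreserving.ae h)

lemma abs_integral_condDistrib_le {g : Obs q → ℝ} {C : ℝ} (h : ∀ᵐ z ∂Q, |g z| ≤ C) :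
    ∀ᵐ x ∂(lawX Q), |∫ z, g z ∂(condDistrib id obsX Q x)| ≤ C := by
  filter_upwards [ae_ae_condDistrib h] with x hx
  have := norm_integral_le_of_norm_le_const (f := g) (μ := condDistrib id obsX Q x) hx
  simpa using this

lemma measurable_integral_condDistrib' {g : Obs q → ℝ} (hg : Measurable g) :
    Measurable fun x => ∫ z, g z ∂(condDistrib id obsX Q x) :=
  (hg.comp measurable_snd).stronglyMeasurable.integral_condDistrib.measurable

lemma integral_mul_comp_obsX {g : Obs q → ℝ} {f : (Fin q → ℝ) → ℝ} (hg : Measurable g)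
    (hf : Measurable f) {C C' : ℝ} (hgC : ∀ᵐ z ∂Q, |g z| ≤ C)
    (hfC : ∀ᵐ x ∂(lawX Q), |f x| ≤ C') :
    ∫ z, g z * f (obsX z) ∂Q = ∫ x, (∫ z, g z ∂(condDistrib id obsX Q x)) * f x ∂(lawX Q) := by
  have hm : Measurable fun z : Obs q => (obsX z, z) := measurable_obsX.prodMk measurable_id
  have hF : Measurable fun w : (Fin q → ℝ) × Obs q => g w.2 * f w.1 := by fun_prop
  have hint : Integrable (fun z => g z * f (obsX z)) Q := by
    refine Integrable.of_bound (by
      have := measurable_obsX (q := q)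
      exact Measurable.aestronglyMeasurable (by fun_prop)) (C * C') ?_
    filter_upwards [hgC, ae_of_ae_map measurable_obsX.aemeasurable hfC] with z h1 h2
    rw [Real.norm_eq_abs, abs_mul]
    exact mul_le_mul h1 h2 (abs_nonneg _) ((abs_nonneg _).trans h1)
  have hint' : Integrable (fun w : (Fin q → ℝ) × Obs q => g w.2 * f w.1)
      (lawX Q ⊗ₘ condDistrib id obsX Q) := by
    rw [lawX_compProd_condDistrib]
    exact (integrable_map_measure hF.aestronglyMeasurable hm.aemeasurable).2 hint
  have h1 := Measure.integral_compProd hint'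
  rw [lawX_compProd_condDistrib, integral_map hm.aemeasurable hF.aestronglyMeasurable] at h1
  rw [h1]
  exact integral_congr_ae (ae_of_all _ fun x => integral_mul_const (f x) g)

variable {α : Param q}

lemma measurable_m (hα : α.IsMeas) : Measurable (m Q α) :=
  measurable_pi_lambda _ fun k =>
    measurable_integral_condDistrib' ((measurable_pi_apply k).comp (measurable_W hα))

lemma abs_m_le {C : ℝ} (hC : ∀ᵐ z ∂Q, ∀ k, |α.W z k| ≤ C) :
    ∀ᵐ x ∂(lawX Q), ∀ k, |m Q α x k| ≤ C :=
  ae_all_iff.2 fun k => abs_integral_condDistrib_le (hC.mono fun _ hz => hz k)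

lemma integrable_of_abs_le {Ω : Type*} [MeasurableSpace Ω] {μ : Measure Ω} [IsFiniteMeasure μ]
    {f : Ω → ℝ} {C : ℝ} (hf : Measurable f) (h : ∀ᵐ x ∂μ, |f x| ≤ C) : Integrable f μ :=
  Integrable.of_bound hf.aestronglyMeasurable C h

lemma integral_wComb_W (hα : α.IsMeas) {C C' : ℝ} (hC : ∀ᵐ z ∂Q, ∀ k, |α.W z k| ≤ C)
    {f : (Fin q → ℝ) → Fin 8 → ℝ} (hf : Measurable f)
    (hfC : ∀ᵐ x ∂(lawX Q), ∀ k, |f x k| ≤ C') :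
    ∫ z, wComb α.W (f ∘ obsX) z ∂Q = ∫ x, ∑ k, m Q α x k * f x k ∂(lawX Q) := by
  have hW := measurable_W hα
  have hX := measurable_obsX (q := q)
  have hm := measurable_m (Q := Q) hα
  have hfX := ae_of_ae_map measurable_obsX.aemeasurable hfC
  unfold wComb
  rw [integral_finsetSum, integral_finsetSum]
  · refine Finset.sum_congr rfl fun k _ => ?_
    exact integral_mul_comp_obsX (g := fun z => α.W z k) (f := fun x => f x k) (by fun_prop)
      (by fun_prop) (hC.mono fun _ h => h k) (hfC.mono fun _ h => h k)
  · intro k _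
    refine integrable_of_abs_le (C := C * C') (by fun_prop) ?_
    filter_upwards [abs_m_le hC, hfC] with x h1 h2
    rw [abs_mul]
    exact mul_le_mul (h1 k) (h2 k) (abs_nonneg _) ((abs_nonneg _).trans (h1 k))
  · intro k _
    refine integrable_of_abs_le (C := C * C') (by fun_prop) ?_
    filter_upwards [hC, hfX] with x h1 h2
    rw [abs_mul]
    exact mul_le_mul (h1 k) (h2 k) (abs_nonneg _) ((abs_nonneg _).trans (h1 k))

lemma integral_wComb_W_sq (hα : α.IsMeas) {C C' : ℝ} (hC : ∀ᵐ z ∂Q, ∀ k, |α.W z k| ≤ C)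
    {f : (Fin q → ℝ) → Fin 8 → ℝ} (hf : Measurable f)
    (hfC : ∀ᵐ x ∂(lawX Q), ∀ k, |f x k| ≤ C') :
    Integrable (fun x => f x ⬝ᵥ (Sig Q α x).mulVec (f x)) (lawX Q) ∧
    ∫ z, wComb α.W (f ∘ obsX) z ^ 2 ∂Q =
      ∫ x, f x ⬝ᵥ (Sig Q α x).mulVec (f x) ∂(lawX Q) := by
  have hW := measurable_W hα
  have hX := measurable_obsX (q := q)
  have hfX := ae_of_ae_map measurable_obsX.aemeasurable hfC
  have hS : ∀ j k, Measurable fun x => Sig Q α x j k := fun j k =>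
    measurable_integral_condDistrib' (g := fun z => α.W z j * α.W z k) (by fun_prop)
  have hWW : ∀ j k, ∀ᵐ z ∂Q, |α.W z j * α.W z k| ≤ C * C := fun j k => by
    filter_upwards [hC] with z h1
    rw [abs_mul]
    exact mul_le_mul (h1 j) (h1 k) (abs_nonneg _) ((abs_nonneg _).trans (h1 k))
  have hff : ∀ j k, ∀ᵐ x ∂(lawX Q), |f x j * f x k| ≤ C' * C' := fun j k => by
    filter_upwards [hfC] with z h1
    rw [abs_mul]
    exact mul_le_mul (h1 j) (h1 k) (abs_nonneg _) ((abs_nonneg _).trans (h1 k))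
  have hSb : ∀ j k, ∀ᵐ x ∂(lawX Q), |Sig Q α x j k| ≤ C * C := fun j k =>
    abs_integral_condDistrib_le (hWW j k)
  have hexp : ∀ x, f x ⬝ᵥ (Sig Q α x).mulVec (f x) =
      ∑ j, ∑ k, Sig Q α x j k * (f x j * f x k) := fun x => by
    simp only [dotProduct, Matrix.mulVec, Finset.mul_sum]
    exact Finset.sum_congr rfl fun j _ => Finset.sum_congr rfl fun k _ => by ring
  have hexp' : ∀ z, wComb α.W (f ∘ obsX) z ^ 2 =
      ∑ j, ∑ k, (α.W z j * α.W z k) * (f (obsX z) j * f (obsX z) k) := fun z => by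
    simp only [wComb, sq, Finset.sum_mul_sum, Function.comp]
    exact Finset.sum_congr rfl fun j _ => Finset.sum_congr rfl fun k _ => by ring
  have hi1 : ∀ j k, Integrable (fun x => Sig Q α x j k * (f x j * f x k)) (lawX Q) :=
    fun j k => by
      have := hS j k
      refine integrable_of_abs_le (C := (C * C) * (C' * C')) (by fun_prop) ?_
      filter_upwards [hSb j k, hff j k] with x h1 h2
      rw [abs_mul]
      exact mul_le_mul h1 h2 (abs_nonneg _) ((abs_nonneg _).trans h1)
  have hi2 : ∀ j k, Integrable
      (fun z => (α.W z j * α.W z k) * (f (obsX z) j * f (obsX z) k)) Q :=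
    fun j k => by
      refine integrable_of_abs_le (C := (C * C) * (C' * C')) (by fun_prop) ?_
      filter_upwards [hWW j k, ae_of_ae_map measurable_obsX.aemeasurable (hff j k)] with x h1 h2
      rw [abs_mul]
      exact mul_le_mul h1 h2 (abs_nonneg _) ((abs_nonneg _).trans h1)
  simp only [hexp, hexp']
  refine ⟨integrable_finsetSum _ fun j _ => integrable_finsetSum _ fun k _ => hi1 j k, ?_⟩
  rw [integral_finsetSum _ fun j _ => integrable_finsetSum _ fun k _ => hi2 j k,
    integral_finsetSum _ fun j _ => integrable_finsetSum _ fun k _ => hi1 j k]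
  refine Finset.sum_congr rfl fun j _ => ?_
  rw [integral_finsetSum _ fun k _ => hi2 j k, integral_finsetSum _ fun k _ => hi1 j k]
  refine Finset.sum_congr rfl fun k _ => ?_
  exact integral_mul_comp_obsX (g := fun z => α.W z j * α.W z k) (f := fun x => f x j * f x k)
    (by fun_prop) (by fun_prop) (hWW j k) (hff j k)

lemma integrable_vecSq_of_abs_le {Ω : Type*} [MeasurableSpace Ω] {μ : Measure Ω}
    [IsFiniteMeasure μ] {d : ℕ} {f : Ω → Fin d → ℝ} {C : ℝ} (hf : Measurable f)
    (h : ∀ᵐ x ∂μ, ∀ k, |f x k| ≤ C) : Integrable (vecSq f) μ := by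
  unfold vecSq
  refine integrable_finsetSum _ fun k _ => ?_
  refine integrable_of_abs_le (C := C ^ 2) (by fun_prop) ?_
  filter_upwards [h] with x hx
  rw [abs_pow]
  exact pow_le_pow_left₀ (abs_nonneg _) (hx k) 2

/-- Strong nondegeneracy of `Σ_α` bounds the weighted norm from below. -/
lemma integral_wComb_W_sq_ge (hα : α.IsMeas) {C C' cS : ℝ} (hC : ∀ᵐ z ∂Q, ∀ k, |α.W z k| ≤ C)
    (hS : ∀ᵐ x ∂(lawX Q), ∀ v : Fin 8 → ℝ, cS * (v ⬝ᵥ v) ≤ v ⬝ᵥ (Sig Q α x).mulVec v)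
    {f : (Fin q → ℝ) → Fin 8 → ℝ} (hf : Measurable f)
    (hfC : ∀ᵐ x ∂(lawX Q), ∀ k, |f x k| ≤ C') :
    cS * ∫ x, vecSq f x ∂(lawX Q) ≤ ∫ z, wComb α.W (f ∘ obsX) z ^ 2 ∂Q := by
  obtain ⟨h1, h2⟩ := integral_wComb_W_sq hα hC hf hfC
  rw [h2, ← integral_const_mul]
  refine integral_mono_ae ((integrable_vecSq_of_abs_le hf hfC).const_mul _) h1 ?_
  filter_upwards [hS] with x hx
  have := hx (f x)
  simpa [vecSq, dotProduct, sq] using this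

/-- Coercivity gives invertibility. For `u = M⁻¹ w` it reads `c |u|² ≤ w · u`, and Cauchy–Schwarz
does the rest; symmetry of `M` plays no role. -/
lemma dotProduct_inv_mulVec_le {n : Type*} [Fintype n] [DecidableEq n] {M : Matrix n n ℝ} {c : ℝ}
    (hc : 0 < c) (hM : ∀ v : n → ℝ, c * (v ⬝ᵥ v) ≤ v ⬝ᵥ M.mulVec v) (w : n → ℝ) :
    0 ≤ w ⬝ᵥ M⁻¹.mulVec w ∧ w ⬝ᵥ M⁻¹.mulVec w ≤ c⁻¹ * (w ⬝ᵥ w) := by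
  have hinj : Function.Injective M.mulVec := by
    intro u v huv
    have h1 : M.mulVec (u - v) = 0 := by rw [Matrix.mulVec_sub, huv, sub_self]
    have h2 := hM (u - v)
    rw [h1, dotProduct_zero] at h2
    have h3 : (u - v) ⬝ᵥ (u - v) = 0 := by
      refine le_antisymm (by nlinarith) ?_
      exact Finset.sum_nonneg fun i _ => mul_self_nonneg _
    exact sub_eq_zero.1 (dotProduct_self_eq_zero.1 h3)
  have hdet : IsUnit M.det := (Matrix.isUnit_iff_isUnit_det M).1 (Matrix.mulVec_injective_iff_isUnit.1 hinj)
  set u := M⁻¹.mulVec w with hu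
  have hMu : M.mulVec u = w := by
    rw [hu, Matrix.mulVec_mulVec, Matrix.mul_nonsing_inv _ hdet, Matrix.one_mulVec]
  have h1 := hM u
  rw [hMu, dotProduct_comm u w] at h1
  have huu : 0 ≤ u ⬝ᵥ u := Finset.sum_nonneg fun i _ => mul_self_nonneg _
  have hww : 0 ≤ w ⬝ᵥ w := Finset.sum_nonneg fun i _ => mul_self_nonneg _
  have h0 : 0 ≤ w ⬝ᵥ u := le_trans (by positivity) h1
  refine ⟨h0, ?_⟩
  have hcs : (w ⬝ᵥ u) ^ 2 ≤ (w ⬝ᵥ w) * (u ⬝ᵥ u) := by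
    have := Finset.sum_mul_sq_le_sq_mul_sq Finset.univ w u
    simpa [dotProduct, sq] using this
  rw [← div_eq_inv_mul, le_div_iff₀ hc]
  rcases h0.eq_or_lt with h | h
  · rw [← h]; simpa using hww
  · have : (w ⬝ᵥ u) * ((w ⬝ᵥ u) * c) ≤ (w ⬝ᵥ u) * (w ⬝ᵥ w) := by
      calc (w ⬝ᵥ u) * ((w ⬝ᵥ u) * c) = (w ⬝ᵥ u) ^ 2 * c := by ring
        _ ≤ (w ⬝ᵥ w) * (u ⬝ᵥ u) * c := by gcongr
        _ = (w ⬝ᵥ w) * (c * (u ⬝ᵥ u)) := by ring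
        _ ≤ (w ⬝ᵥ w) * (w ⬝ᵥ u) := by gcongr
        _ = _ := by ring
    exact le_of_mul_le_mul_left this h

lemma Phi_le {α₀ : Param q} (hα : α.IsMeas) {C cS : ℝ} (hcS : 0 < cS)
    (hC : ∀ᵐ z ∂Q, ∀ k, |α.W z k| ≤ C)
    (hS : ∀ᵐ x ∂(lawX Q), ∀ v : Fin 8 → ℝ, cS * (v ⬝ᵥ v) ≤ v ⬝ᵥ (Sig Q α₀ x).mulVec v) :
    Phi Q α₀ α ≤ cS⁻¹ * ∫ x, vecSq (m Q α) x ∂(lawX Q) := by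
  unfold Phi
  rw [← integral_const_mul]
  refine integral_mono_of_nonneg ?_
    ((integrable_vecSq_of_abs_le (measurable_m hα) (abs_m_le hC)).const_mul _) ?_
  · filter_upwards [hS] with x hx using (dotProduct_inv_mulVec_le hcS hx _).1
  · filter_upwards [hS] with x hx
    have := (dotProduct_inv_mulVec_le hcS hx (m Q α x)).2
    simpa [vecSq, dotProduct, sq] using this

/-- The conditional moments inherit linear relations between residuals. -/
lemma m_eq_sum {ι : Type*} [Fintype ι] {c : ι → ℝ} {β : ι → Param q} {C : ℝ}
    (hβ : ∀ j, (β j).IsMeas) (hC : ∀ j, ∀ᵐ z ∂Q, ∀ k, |(β j).W z k| ≤ C)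
    (h : ∀ z k, α.W z k = ∑ j, c j * (β j).W z k) :
    ∀ᵐ x ∂(lawX Q), ∀ k, m Q α x k = ∑ j, c j * m Q (β j) x k := by
  have h1 : ∀ᵐ x ∂(lawX Q), ∀ j, ∀ᵐ z ∂(condDistrib id obsX Q x), ∀ k, |(β j).W z k| ≤ C :=
    ae_all_iff.2 fun j => ae_ae_condDistrib (hC j)
  filter_upwards [h1] with x hx k
  simp only [m, h]
  rw [integral_finsetSum]
  · simp only [integral_const_mul]
  · intro j _
    refine Integrable.const_mul ?_ _
    exact integrable_of_abs_le ((measurable_pi_apply k).comp (measurable_W (hβ j)))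
      ((hx j).mono fun _ hz => hz k)

end Population

/-! ### Regret of plug-in policies -/

section Regret

/-- Projecting the vertex onto `[p₁, p₂]` maximizes a concave parabola. -/
lemma quadratic_le_clip {b₁ b₂ p₁ p₂ p : ℝ} (hb : b₂ < 0) (hp : p ∈ Set.Icc p₁ p₂) :
    b₁ * p + b₂ * p ^ 2 ≤ b₁ * min (max p₁ (-b₁ / (2 * b₂))) p₂ +
      b₂ * min (max p₁ (-b₁ / (2 * b₂))) p₂ ^ 2 := by
  obtain ⟨v, hv⟩ : ∃ v, v = -b₁ / (2 * b₂) := ⟨_, rfl⟩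
  have hb1 : b₁ = -2 * b₂ * v := by
    have := hb.ne
    rw [hv]; field_simp
  rw [← hv, hb1]
  obtain ⟨h1, h2⟩ := hp
  -- By completing the square, maximizing the parabola means minimizing the distance to its vertex,
  -- which projection onto the interval does.
  have key : ∀ c, (c - v) ^ 2 ≤ (p - v) ^ 2 →
      -2 * b₂ * v * p + b₂ * p ^ 2 ≤ -2 * b₂ * v * c + b₂ * c ^ 2 := fun c hc => by nlinarith
  apply key
  rcases le_total p₁ v with h3 | h3
  · rw [max_eq_right h3]
    rcases le_total v p₂ with h4 | h4
    · rw [min_eq_left h4, sub_self]; nlinarith [sq_nonneg (p - v)]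
    · rw [min_eq_right h4]; nlinarith
  · rw [max_eq_left h3, min_eq_left (h1.trans h2)]; nlinarith

lemma clip_mem_Icc {p₁ p₂ v : ℝ} (h : p₁ ≤ p₂) : min (max p₁ v) p₂ ∈ Set.Icc p₁ p₂ :=
  ⟨le_min (le_max_left _ _) h, min_le_right _ _⟩

/-- Pointwise regret of the plug-in price. -/
lemma quadratic_sub_clip_le {b₁ b₂ d₁ d₂ p₁ p₂ p c C : ℝ} (h0 : 0 ≤ p₁) (hp : p ∈ Set.Icc p₁ p₂)
    (hc : 0 < c) (hb : c ≤ -b₂) (hC₁ : |b₁| ≤ C) (hC₂ : |b₂| ≤ C) :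
    (b₁ * p + b₂ * p ^ 2) - (b₁ * min (max p₁ (-d₁ / (2 * d₂))) p₂ +
      b₂ * min (max p₁ (-d₁ / (2 * d₂))) p₂ ^ 2) ≤
      (2 + 4 * C / c) * (p₂ + p₂ ^ 2) * (|d₁ - b₁| + |d₂ - b₂|) := by
  have hp12 : p₁ ≤ p₂ := hp.1.trans hp.2
  have hp2 : 0 ≤ p₂ := h0.trans hp12
  set r := min (max p₁ (-d₁ / (2 * d₂))) p₂
  have hr : r ∈ Set.Icc p₁ p₂ := clip_mem_Icc hp12
  have hC : 0 ≤ C := (abs_nonneg _).trans hC₁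
  have bd : ∀ x ∈ Set.Icc p₁ p₂, ∀ a₁ a₂ : ℝ, |a₁ * x + a₂ * x ^ 2| ≤
      (p₂ + p₂ ^ 2) * (|a₁| + |a₂|) := by
    intro x hx a₁ a₂
    have hx0 : 0 ≤ x := h0.trans hx.1
    refine (abs_add_le _ _).trans ?_
    rw [abs_mul, abs_mul, abs_of_nonneg hx0, abs_of_nonneg (sq_nonneg x)]
    have h1 : |a₁| * x ≤ |a₁| * p₂ := mul_le_mul_of_nonneg_left hx.2 (abs_nonneg _)
    have h2 : |a₂| * x ^ 2 ≤ |a₂| * p₂ ^ 2 :=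
      mul_le_mul_of_nonneg_left (pow_le_pow_left₀ hx0 hx.2 2) (abs_nonneg _)
    nlinarith [mul_nonneg (abs_nonneg a₁) (sq_nonneg p₂), mul_nonneg (abs_nonneg a₂) hp2]
  set Δ := |d₁ - b₁| + |d₂ - b₂| with hΔ
  have hΔ0 : 0 ≤ Δ := by positivity
  have hP : 0 ≤ p₂ + p₂ ^ 2 := by positivity
  have hCc : 0 ≤ 4 * C / c := by positivity
  -- If the estimated parabola is concave, the plug-in price is its maximizer, and the regret is two
  -- evaluation errors. Otherwise `|d₂ - b₂| ≥ c`, and the trivial regret bound `4 * C * (p₂ + p₂ ^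
  -- 2)` is absorbed; the value of the quotient, including its default at `d₂ = 0`, is then
  -- irrelevant.
  rcases lt_or_ge d₂ 0 with hd | hd
  · have h1 := quadratic_le_clip (b₁ := d₁) hd hp
    have h2 := bd p hp (d₁ - b₁) (d₂ - b₂)
    have h3 := bd r hr (d₁ - b₁) (d₂ - b₂)
    have h4 := neg_le_of_abs_le h2
    have h5 := le_of_abs_le h3
    have h6 : 0 ≤ 4 * C / c * (p₂ + p₂ ^ 2) * Δ := by positivity
    simp only [← hΔ] at h4 h5
    change d₁ * p + d₂ * p ^ 2 ≤ d₁ * r + d₂ * r ^ 2 at h1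
    nlinarith
  · have h1 := le_of_abs_le (bd p hp b₁ b₂)
    have h2 := neg_le_of_abs_le (bd r hr b₁ b₂)
    have h3 : c ≤ Δ := by
      have : c ≤ |d₂ - b₂| := by rw [abs_of_nonneg (by linarith)]; linarith
      have := abs_nonneg (d₁ - b₁)
      linarith
    have h4 : (p₂ + p₂ ^ 2) * (|b₁| + |b₂|) ≤ (p₂ + p₂ ^ 2) * (2 * C) :=
      mul_le_mul_of_nonneg_left (by linarith) hP
    have h5 : 4 * C ≤ 4 * C / c * Δ := by
      rw [div_mul_eq_mul_div, le_div_iff₀ hc]; gcongr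
    have h6 := mul_le_mul_of_nonneg_left h5 hP
    have h7 : 0 ≤ (p₂ + p₂ ^ 2) * Δ := by positivity
    nlinarith

variable {Ω : Type*} [MeasurableSpace Ω] {μ : Measure Ω} [IsProbabilityMeasure μ] {q r : ℕ}
  {M : PricingModel Ω q r}

/-- A bounded function of `X` can be pulled out of the conditional expectation, so in the value of a
policy the individual coefficient may be replaced by its mean given `X`. -/
lemma integral_mul_comp_eq_of_condExp {X : Ω → Fin q → ℝ} (hX : Measurable X) {b : Ω → ℝ}
    (hb : Integrable b μ) {β π : (Fin q → ℝ) → ℝ} (hπ : Measurable π) {C : ℝ}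
    (hC : ∀ x, |π x| ≤ C)
    (h : (fun ω => β (X ω)) =ᵐ[μ] μ[b | MeasurableSpace.comap X inferInstance]) :
    Integrable (fun ω => β (X ω) * π (X ω)) μ ∧
      ∫ ω, b ω * π (X ω) ∂μ = ∫ ω, β (X ω) * π (X ω) ∂μ := by
  have hle : MeasurableSpace.comap X inferInstance ≤ (inferInstance : MeasurableSpace Ω) :=
    hX.comap_le
  have hsm : StronglyMeasurable[MeasurableSpace.comap X inferInstance] fun ω => π (X ω) :=
    (hπ.comp (comap_measurable X)).stronglyMeasurable
  have hbπ : Integrable (fun ω => b ω * π (X ω)) μ :=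
    hb.mul_bdd (hπ.comp hX).aestronglyMeasurable (ae_of_all _ fun ω => hC (X ω))
  have h1 : μ[(b * fun ω => π (X ω)) | MeasurableSpace.comap X inferInstance] =ᵐ[μ]
      fun ω => β (X ω) * π (X ω) := by
    refine (condExp_mul_of_stronglyMeasurable_right hsm hbπ hb).trans ?_
    filter_upwards [h] with ω hω
    rw [Pi.mul_apply, ← hω]
  refine ⟨integrable_condExp.congr h1, ?_⟩
  rw [← integral_congr_ae h1, integral_condExp hle]
  rfl

/-- The value of a policy, up to a constant, through the averaged coefficients. -/
lemma value_eq (hM : M.IsMeasurableModel) (hmodel : M.SatisfiesModels μ) {α₀ : Param q}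
    (hα₀ : α₀.IsTrue M μ) {π : (Fin q → ℝ) → ℝ} (hπ : M.IsPolicy π) :
    Integrable (fun ω => α₀.β1 (M.X ω) * π (M.X ω) + α₀.β2 (M.X ω) * π (M.X ω) ^ 2) μ ∧
    M.value μ π = ∫ ω, (α₀.β1 (M.X ω) * π (M.X ω) + α₀.β2 (M.X ω) * π (M.X ω) ^ 2) ∂μ +
      ∫ ω, (M.βg (M.U ω) (M.X ω) (M.G ω) + M.βux (M.U ω) (M.X ω)) ∂μ := by
  obtain ⟨hp0, hp12, -⟩ := hmodel.price_range
  have hp2 : 0 ≤ M.p2 := hp0.trans hp12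
  have hb1 : ∀ x, |π x| ≤ M.p2 := fun x => by
    rw [abs_of_nonneg (hp0.trans (hπ.2 x).1)]; exact (hπ.2 x).2
  have hb2 : ∀ x, |π x ^ 2| ≤ M.p2 ^ 2 := fun x => by
    rw [abs_pow]; exact pow_le_pow_left₀ (abs_nonneg _) (hb1 x) 2
  obtain ⟨i1, e1⟩ := integral_mul_comp_eq_of_condExp hM.X hmodel.integrable_βp1 hπ.1 hb1 hα₀.β1
  obtain ⟨i2, e2⟩ := integral_mul_comp_eq_of_condExp hM.X hmodel.integrable_βp2
    (hπ.1.pow_const 2) hb2 hα₀.β2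
  have j1 : Integrable (fun ω => M.βp1 (M.U ω) (M.X ω) * π (M.X ω)) μ :=
    hmodel.integrable_βp1.mul_bdd (hπ.1.comp hM.X).aestronglyMeasurable
      (ae_of_all _ fun ω => hb1 (M.X ω))
  have j2 : Integrable (fun ω => M.βp2 (M.U ω) (M.X ω) * π (M.X ω) ^ 2) μ :=
    hmodel.integrable_βp2.mul_bdd ((hπ.1.pow_const 2).comp hM.X).aestronglyMeasurable
      (ae_of_all _ fun ω => hb2 (M.X ω))
  refine ⟨i1.add i2, ?_⟩
  obtain ⟨hint, hcond⟩ := hmodel.intervention π hπ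
  have hle : MeasurableSpace.comap (fun ω => (M.G ω, M.X ω, M.U ω)) inferInstance ≤
      (inferInstance : MeasurableSpace Ω) :=
    (hM.G.prodMk (hM.X.prodMk hM.U)).comap_le
  unfold PricingModel.value
  -- Averaging the structural model over `(G, X, U)`. The terms in `βg` and `βux` do not involve the
  -- policy and cancel in the regret.
  rw [← integral_condExp hle, integral_congr_ae hcond]
  unfold PricingModel.meanRevenue
  simp only [add_assoc]
  have j3 : Integrable (fun ω => M.βg (M.U ω) (M.X ω) (M.G ω) + M.βux (M.U ω) (M.X ω)) μ :=
    hmodel.integrable_βg.add hmodel.integrable_βux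
  have j4 : Integrable (fun ω => M.βp2 (M.U ω) (M.X ω) * π (M.X ω) ^ 2 +
      (M.βg (M.U ω) (M.X ω) (M.G ω) + M.βux (M.U ω) (M.X ω))) μ := j2.add j3
  rw [integral_add j1 j4, integral_add j2 j3, integral_add i1 i2, e1, e2, add_assoc]

lemma sq_integral_le {S : Type*} [MeasurableSpace S] {Q : Measure S} [IsProbabilityMeasure Q]
    {g : S → ℝ} (hg : MemLp g 2 Q) : (∫ z, g z ∂Q) ^ 2 ≤ ∫ z, g z ^ 2 ∂Q := by
  have h1 := variance_eq_sub hg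
  have h2 := variance_nonneg g Q
  have h3 : Q[g ^ 2] = ∫ z, g z ^ 2 ∂Q := rfl
  rw [h3] at h1
  linarith

lemma isPolicy_policy {ν : Measure Ω} (hmodel : M.SatisfiesModels ν) {α : Param q} (hα : α.IsMeas) :
    M.IsPolicy (α.policy M.p1 M.p2) := by
  obtain ⟨-, hp12, -⟩ := hmodel.price_range
  refine ⟨?_, fun x => clip_mem_Icc hp12⟩
  have h0 := hα.1 0
  have h1 := hα.1 1
  unfold Param.policy Param.β1 Param.β2
  fun_prop

/-- The regret of a plug-in policy is at most a multiple of the error of its parameter. -/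
lemma regret_le (hM : M.IsMeasurableModel) (hmodel : M.SatisfiesModels μ) {Q : Measure (Obs q)}
    [IsProbabilityMeasure Q] (hQ : Q = μ.map M.Z) {α₀ α : Param q} (hα₀ : α₀.IsTrue M μ)
    (hm₀ : α₀.IsMeas) (hm : α.IsMeas) {C c : ℝ} (hc : 0 < c) (hC : 1 ≤ C)
    (hb₀ : ∀ᵐ z ∂Q, α₀.sqAt (obsX z) (obsG z) ≤ C) {C' : ℝ}
    (hb : ∀ᵐ z ∂Q, (α - α₀).sqAt (obsX z) (obsG z) ≤ C')
    (hconc : ∀ᵐ x ∂(lawX Q), c ≤ -α₀.β2 x) {π : (Fin q → ℝ) → ℝ} (hπ : M.IsPolicy π) :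
    M.value μ π - M.value μ (α.policy M.p1 M.p2) ≤
      2 * ((2 + 4 * C / c) * (M.p2 + M.p2 ^ 2)) * normL2 Q (α - α₀) := by
  obtain ⟨hp0, hp12, -⟩ := hmodel.price_range
  have hp2 : 0 ≤ M.p2 := hp0.trans hp12
  have hY : Measurable M.Y := hM.Ypot.comp (hM.P.prodMk measurable_id)
  have hZ : Measurable M.Z := hY.prodMk (hM.X.prodMk (hM.G.prodMk hM.P))
  have hπ' := isPolicy_policy hmodel hm
  obtain ⟨i1, e1⟩ := value_eq hM hmodel hα₀ hπ
  obtain ⟨i2, e2⟩ := value_eq hM hmodel hα₀ hπ'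
  set K := (2 + 4 * C / c) * (M.p2 + M.p2 ^ 2) with hK
  have hK0 : 0 ≤ K := by positivity
  let g : Obs q → ℝ := fun z => |α.β1 (obsX z) - α₀.β1 (obsX z)| + |α.β2 (obsX z) - α₀.β2 (obsX z)|
  have hg : Measurable g := by
    have h0 := hm.1 0
    have h1 := hm.1 1
    have h0' := hm₀.1 0
    have h1' := hm₀.1 1
    have hX := measurable_obsX (q := q)
    simp only [g, Param.β1, Param.β2]
    fun_prop
  have hgsq : ∀ z, g z ^ 2 ≤ 4 * (α - α₀).sqAt (obsX z) (obsG z) := by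
    intro z
    have h1 : (α.β1 (obsX z) - α₀.β1 (obsX z)) ^ 2 + (α.β2 (obsX z) - α₀.β2 (obsX z)) ^ 2 ≤
        (α - α₀).sqAt (obsX z) (obsG z) := by
      simp only [Param.sqAt, Param.β1, Param.β2, Prod.fst_sub, Pi.sub_apply]
      rw [Fin.sum_univ_succ, Fin.sum_univ_succ]
      have : 0 ≤ ∑ i : Fin 5, (α.1 i.succ.succ (obsX z) - α₀.1 i.succ.succ (obsX z)) ^ 2 :=
        Finset.sum_nonneg fun _ _ => sq_nonneg _
      have h2 := sq_nonneg ((α - α₀).2 (obsX z) (obsG z))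
      simp only [Fin.succ_zero_eq_one]
      linarith
    have h2 := sq_abs (α.β1 (obsX z) - α₀.β1 (obsX z))
    have h3 := sq_abs (α.β2 (obsX z) - α₀.β2 (obsX z))
    simp only [g]
    nlinarith [sq_nonneg (|α.β1 (obsX z) - α₀.β1 (obsX z)| - |α.β2 (obsX z) - α₀.β2 (obsX z)|)]
  have hdm : (α - α₀).IsMeas := ⟨fun k => (hm.1 k).sub (hm₀.1 k), hm.2.sub hm₀.2⟩
  have hsqi : Integrable (fun z => (α - α₀).sqAt (obsX z) (obsG z)) Q :=
    integrable_of_abs_le (C := C') (measurable_sqAt hdm) (by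
      filter_upwards [hb] with z hz
      rwa [abs_of_nonneg (sqAt_nonneg _ _ _)])
  have hgL : MemLp g 2 Q := by
    refine (memLp_two_iff_integrable_sq hg.aestronglyMeasurable).2 ?_
    exact (hsqi.const_mul 4).mono' (hg.pow_const 2).aestronglyMeasurable
      (ae_of_all _ fun z => by rw [Real.norm_of_nonneg (sq_nonneg _)]; exact hgsq z)
  have hgi : ∫ z, g z ∂Q ≤ 2 * normL2 Q (α - α₀) := by
    have h1 := sq_integral_le hgL
    have h2 : ∫ z, g z ^ 2 ∂Q ≤ 4 * ∫ z, (α - α₀).sqAt (obsX z) (obsG z) ∂Q := by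
      rw [← integral_const_mul]
      exact integral_mono hgL.integrable_sq (hsqi.const_mul 4) hgsq
    have h3 : (2 * normL2 Q (α - α₀)) ^ 2 = 4 * ∫ z, (α - α₀).sqAt (obsX z) (obsG z) ∂Q := by
      unfold normL2
      rw [mul_pow, Real.sq_sqrt (integral_nonneg fun z => sqAt_nonneg _ _ _)]
      norm_num
    refine le_of_sq_le_sq ?_ (mul_nonneg zero_le_two (Real.sqrt_nonneg _))
    linarith
  have hgμ : Integrable (fun ω => g (M.Z ω)) μ := by
    have := hgL.integrable one_le_two
    rw [hQ] at this
    exact this.comp_measurable hZ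
  have hgμi : ∫ ω, g (M.Z ω) ∂μ = ∫ z, g z ∂Q := by
    rw [hQ, integral_map hZ.aemeasurable hg.aestronglyMeasurable]
  have hae : ∀ᵐ z ∂Q, α₀.sqAt (obsX z) (obsG z) ≤ C ∧ c ≤ -α₀.β2 (obsX z) :=
    hb₀.and (ae_of_ae_map measurable_obsX.aemeasurable hconc)
  rw [hQ] at hae
  have hae' := ae_of_ae_map hZ.aemeasurable hae
  rw [e1, e2, add_sub_add_right_eq_sub, ← integral_sub i1 i2]
  calc _ ≤ ∫ ω, K * g (M.Z ω) ∂μ := by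
        refine integral_mono_ae (i1.sub i2) (hgμ.const_mul K) ?_
        filter_upwards [hae'] with ω hω
        have hsq : ∀ k, |α₀.1 k (M.X ω)| ≤ C := fun k => by
          have h1 : α₀.1 k (M.X ω) ^ 2 ≤ C := by
            refine le_trans ?_ hω.1
            refine le_trans ?_ (le_add_of_nonneg_right (sq_nonneg _))
            exact Finset.single_le_sum (f := fun k => α₀.1 k (M.X ω) ^ 2)
              (fun _ _ => sq_nonneg _) (Finset.mem_univ k)
          refine abs_le_of_sq_le_sq ?_ (by linarith)
          nlinarith
        exact quadratic_sub_clip_le hp0 (hπ.2 _) hc hω.2 (hsq 0) (hsq 1)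
    _ = K * ∫ z, g z ∂Q := by rw [integral_const_mul, hgμi]
    _ ≤ K * (2 * normL2 Q (α - α₀)) := by gcongr
    _ = _ := by ring

end Regret

/-! ### Homogeneity of the modulus of continuity -/

section Modulus

variable {q : ℕ} {Q : Measure (Obs q)} [IsProbabilityMeasure Q]

lemma pathDeriv_self (α₀ : Param q) (x : Fin q → ℝ) : pathDeriv Q α₀ α₀ x = 0 := by
  ext k
  have : ∀ t : ℝ, (1 - t) • α₀ + t • α₀ = α₀ := fun t => by rw [← add_smul]; simp
  simp [pathDeriv, this]

/-- The path towards a point of the line through `α₀` and `α` is the path towards `α` run at speed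
`s`. The scaling rule for `deriv` needs no differentiability. -/
lemma pathDeriv_segment (α₀ α : Param q) (s : ℝ) (x : Fin q → ℝ) :
    pathDeriv Q α₀ (α₀ + s • (α - α₀)) x = s • pathDeriv Q α₀ α x := by
  ext k
  have h : ∀ t : ℝ, (1 - t) • α₀ + t • (α₀ + s • (α - α₀)) = (1 - s * t) • α₀ + (s * t) • α :=
    fun t => by module
  simp only [pathDeriv, h, Pi.smul_apply, smul_eq_mul]
  have := deriv_comp_mul_left s (fun t => m Q ((1 - t) • α₀ + t • α) x k) 0
  simpa using this

lemma psDist_segment (α₀ α : Param q) {s : ℝ} (hs : 0 ≤ s) :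
    psDist Q α₀ α₀ (α₀ + s • (α - α₀)) α₀ = s * psDist Q α₀ α₀ α α₀ := by
  unfold psDist
  simp only [pathDeriv_self, sub_zero, pathDeriv_segment, Matrix.mulVec_smul, dotProduct_smul,
    smul_dotProduct, smul_eq_mul, integral_const_mul]
  rw [← mul_assoc, Real.sqrt_mul (by positivity), Real.sqrt_mul_self hs]

lemma normL2_smul {q : ℕ} {Q : Measure (Obs q)} {s : ℝ} (hs : 0 ≤ s) (α : Param q) :
    normL2 Q (s • α) = s * normL2 Q α := by
  unfold normL2
  simp only [sqAt_smul, integral_const_mul]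
  rw [Real.sqrt_mul (sq_nonneg s), Real.sqrt_sq hs]

lemma sqAt_add_smul_le {s : ℝ} (hs : 0 ≤ s) (α β : Param q) (x : Fin q → ℝ) (g : ℝ) :
    (α + s • β).sqAt x g ≤ (1 + s) * α.sqAt x g + (s + s ^ 2) * β.sqAt x g := by
  have key : ∀ a b : ℝ, (a + s * b) ^ 2 ≤ (1 + s) * a ^ 2 + (s + s ^ 2) * b ^ 2 := fun a b => by
    nlinarith [mul_nonneg hs (sq_nonneg (a - b))]
  simp only [Param.sqAt, mul_add, Finset.mul_sum]
  have h1 : ∑ k, (α + s • β).1 k x ^ 2 ≤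
      ∑ k, (1 + s) * α.1 k x ^ 2 + ∑ k, (s + s ^ 2) * β.1 k x ^ 2 := by
    rw [← Finset.sum_add_distrib]
    exact Finset.sum_le_sum fun k _ => key _ _
  have h2 := key (α.2 x g) (β.2 x g)
  have h3 : (α + s • β).2 x g = α.2 x g + s * β.2 x g := rfl
  rw [h3]
  linarith

lemma normL2_le_of_sqAt_le {α : Param q} {C : ℝ}
    (h : ∀ᵐ z ∂Q, α.sqAt (obsX z) (obsG z) ≤ C) : normL2 Q α ≤ √C := by
  unfold normL2
  refine Real.sqrt_le_sqrt ?_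
  have := integral_mono_of_nonneg (ae_of_all _ fun z : Obs q => sqAt_nonneg α (obsX z) (obsG z))
    (integrable_const C) h
  simpa using this

variable {H : NormedFunctionSpace (Param q)} {α₀ : H.carrier}

/-- A parameter in a large ball of `H` within a multiple of `δ` of `α₀` in the pseudometric is
within a multiple of the local modulus of continuity at `δ`. -/
lemma exists_normL2_le_modulus {F : ℕ → Fin 8 → NormedFunctionSpace ((Fin q → ℝ) → ℝ)}
    {A B : ℝ} (hA : 0 < A) (hmeas : ∀ α : H.carrier, (α : Param q).IsMeas)
    (hnorm : Normalized Q H F A B) {M₀ ε : ℝ} (hε : 0 < ε) (hM₀ : H.norm α₀ ^ 2 < M₀)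
    (hM₀' : normL2 Q (α₀ : Param q) < M₀) {R K : ℝ} (hR : 0 ≤ R) :
    ∃ C : ℝ, 0 < C ∧ ∀ δ : ℝ, 0 ≤ δ → ∀ α : H.carrier, H.norm α ≤ R →
      psDist Q (α₀ : Param q) α₀ α α₀ ≤ K * δ →
      normL2 Q (α - α₀ : H.carrier) ≤ C * modulus Q H α₀ δ (localSpace Q H α₀ M₀ ε) := by
  have ha0 : 0 ≤ H.norm α₀ := apply_nonneg _ _
  have hM0 : 0 < M₀ := lt_of_le_of_lt (sq_nonneg _) hM₀
  obtain ⟨E, hE1, hE⟩ := exists_bound_on_ball hA hnorm (add_nonneg hR ha0)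
  have hn0 : 0 ≤ normL2 Q (α₀ : Param q) := Real.sqrt_nonneg _
  have hαsM : H.norm α₀ < √M₀ := Real.lt_sqrt_of_sq_lt hM₀
  -- All five conditions are strict at `t = 0`, hence hold for small positive `t` by continuity.
  -- This is where `α₀` must lie strictly inside the norm bounds; `t` does not depend on `δ`.
  obtain ⟨t, ⟨ht1, ht2, ht3, ht4, ht5⟩, ht0⟩ : ∃ t : ℝ, (t < 1 ∧ t * K < 1 ∧ t * √E < ε ∧
      (1 + t) * normL2 Q (α₀ : Param q) ^ 2 + (t + t ^ 2) * E < M₀ ^ 2 ∧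
      H.norm α₀ + t * (R + H.norm α₀) < √M₀) ∧ 0 < t := by
    have hev : ∀ {f : ℝ → ℝ} {y : ℝ}, Continuous f → f 0 < y → ∀ᶠ t in 𝓝[>] (0 : ℝ), f t < y :=
      fun hf h => ((hf.tendsto 0).mono_left nhdsWithin_le_nhds).eventually_lt_const h
    have e1 := hev (f := fun t => t) (y := 1) (by fun_prop) (by simp)
    have e2 := hev (f := fun t => t * K) (y := 1) (by fun_prop) (by simp)
    have e3 := hev (f := fun t => t * √E) (y := ε) (by fun_prop) (by simpa using hε)
    have e4 := hev (f := fun t => (1 + t) * normL2 Q (α₀ : Param q) ^ 2 + (t + t ^ 2) * E)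
      (y := M₀ ^ 2) (by fun_prop) (by simpa using pow_lt_pow_left₀ hM₀' hn0 two_ne_zero)
    have e5 := hev (f := fun t => H.norm α₀ + t * (R + H.norm α₀)) (y := √M₀) (by fun_prop)
      (by simpa using hαsM)
    exact ((e1.and (e2.and (e3.and (e4.and e5)))).and self_mem_nhdsWithin).exists
  refine ⟨t⁻¹, inv_pos.2 ht0, fun δ hδ α hα hps => ?_⟩
  have hsub : H.norm (α - α₀) ≤ R + H.norm α₀ :=
    (map_sub_le_add _ _ _).trans (by gcongr)
  have hbd : ∀ᵐ z ∂Q, ((α - α₀ : H.carrier) : Param q).sqAt (obsX z) (obsG z) ≤ E := by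
    filter_upwards [hE] with z hz using (hz _ hsub).1
  have hL := normL2_le_of_sqAt_le hbd
  set γ : H.carrier := α₀ + t • (α - α₀) with hγ
  have hγc : (γ : Param q) = (α₀ : Param q) + t • ((α : Param q) - α₀) := rfl
  have hγs : ((γ - α₀ : H.carrier) : Param q) = t • ((α - α₀ : H.carrier) : Param q) := by
    rw [hγ, add_sub_cancel_left]; rfl
  have hγn : normL2 Q (γ - α₀ : H.carrier) = t * normL2 Q (α - α₀ : H.carrier) := by
    rw [hγs, normL2_smul ht0.le]
  have hi : ∀ β : H.carrier, H.norm β ≤ R + H.norm α₀ →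
      Integrable (fun z => (β : Param q).sqAt (obsX z) (obsG z)) Q := fun β hβ =>
    integrable_of_abs_le (C := E) (measurable_sqAt (hmeas β)) (by
      filter_upwards [hE] with z hz
      rw [abs_of_nonneg (sqAt_nonneg _ _ _)]
      exact (hz β hβ).1)
  have hmem : γ ∈ localSpace Q H α₀ M₀ ε := by
    refine ⟨?_, ?_, ?_⟩
    · rw [hγn]
      exact (mul_le_mul_of_nonneg_left hL ht0.le).trans ht3.le
    · unfold normL2
      refine Real.sqrt_le_iff.2 ⟨hM0.le, le_trans ?_ ht4.le⟩
      have h1 : ∫ z, (γ : Param q).sqAt (obsX z) (obsG z) ∂Q ≤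
          ∫ z, ((1 + t) * (α₀ : Param q).sqAt (obsX z) (obsG z) + (t + t ^ 2) * E) ∂Q := by
        refine integral_mono_of_nonneg (ae_of_all _ fun z => sqAt_nonneg _ _ _)
          (((hi α₀ (by linarith)).const_mul _).add (integrable_const _)) ?_
        filter_upwards [hbd] with z hz
        rw [hγc]
        refine (sqAt_add_smul_le ht0.le _ _ _ _).trans ?_
        have : (t + t ^ 2) * ((α : Param q) - α₀).sqAt (obsX z) (obsG z) ≤ (t + t ^ 2) * E :=
          mul_le_mul_of_nonneg_left hz (by positivity)
        linarith
      rw [integral_add ((hi α₀ (by linarith)).const_mul _) (integrable_const _),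
        integral_const_mul] at h1
      unfold normL2
      rw [Real.sq_sqrt (integral_nonneg fun z => sqAt_nonneg _ _ _)]
      simpa using h1
    · have : H.norm γ ≤ √M₀ := by
        refine (map_add_le_add _ _ _).trans (le_trans ?_ ht5.le)
        rw [map_smul_eq_mul, Real.norm_of_nonneg ht0.le]
        gcongr
      calc H.norm γ ^ 2 ≤ √M₀ ^ 2 := pow_le_pow_left₀ (apply_nonneg _ _) this 2
        _ = M₀ := Real.sq_sqrt hM0.le
  have hγps : psDist Q (α₀ : Param q) α₀ γ α₀ ≤ δ := by
    rw [hγc, psDist_segment _ _ ht0.le]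
    calc t * psDist Q (α₀ : Param q) α₀ α α₀ ≤ t * (K * δ) := by gcongr
      _ = (t * K) * δ := by ring
      _ ≤ 1 * δ := by gcongr
      _ = δ := one_mul δ
  have hle : normL2 Q (γ - α₀ : H.carrier) ≤
      modulus Q H α₀ δ (localSpace Q H α₀ M₀ ε) := by
    -- The `L²` radius of the local space bounds the set, so its real supremum is a genuine one.
    refine le_csSup ⟨ε, ?_⟩ ⟨γ, ⟨hmem, hγps⟩, rfl⟩
    rintro _ ⟨β, ⟨hβ, -⟩, rfl⟩
    exact hβ.1
  rw [hγn] at hle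
  rw [inv_mul_eq_div, le_div_iff₀' ht0]
  exact hle

end Modulus

/-! ### Adversary functions -/

section Adversary

variable {q : ℕ} {F : Fin 8 → NormedFunctionSpace ((Fin q → ℝ) → ℝ)}

lemma normF_nonneg (f : Adv F) : 0 ≤ normF f := Real.sqrt_nonneg _

lemma normF_sq (f : Adv F) : normF f ^ 2 = ∑ k, (F k).norm (f k) ^ 2 :=
  Real.sq_sqrt (Finset.sum_nonneg fun _ _ => sq_nonneg _)

lemma normF_smul {s : ℝ} (hs : 0 ≤ s) (f : Adv F) : normF (s • f) = s * normF f := by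
  unfold normF
  rw [← Real.sqrt_sq hs, ← Real.sqrt_mul (sq_nonneg s), Real.sqrt_sq hs, Finset.mul_sum]
  congr 1
  refine Finset.sum_congr rfl fun k _ => ?_
  rw [Pi.smul_apply, map_smul_eq_mul, Real.norm_of_nonneg hs, mul_pow]

lemma normF_zero : normF (0 : Adv F) = 0 := by
  have := normF_smul (le_refl (0 : ℝ)) (0 : Adv F)
  simpa using this

lemma normF_sum_sq_le {ι : Type*} [Fintype ι] (c : ι → ℝ) (f : ι → Adv F) :
    normF (∑ j, c j • f j) ^ 2 ≤ (∑ j, c j ^ 2) * ∑ j, normF (f j) ^ 2 := by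
  simp only [normF_sq]
  rw [Finset.sum_comm, Finset.mul_sum]
  refine Finset.sum_le_sum fun k _ => ?_
  have h1 : (F k).norm ((∑ j, c j • f j) k) ≤ ∑ j, |c j| * (F k).norm (f j k) := by
    rw [Finset.sum_apply]
    refine (Finset.le_sum_of_subadditive (F k).norm (map_zero (F k).norm).le
      (map_add_le_add (F k).norm) _ _).trans
      (le_of_eq ?_)
    exact Finset.sum_congr rfl fun j _ => by rw [Pi.smul_apply, map_smul_eq_mul, Real.norm_eq_abs]
  calc _ ≤ (∑ j, |c j| * (F k).norm (f j k)) ^ 2 := pow_le_pow_left₀ (apply_nonneg _ _) h1 2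
    _ ≤ (∑ j, |c j| ^ 2) * ∑ j, (F k).norm (f j k) ^ 2 := Finset.sum_mul_sq_le_sq_mul_sq _ _ _
    _ = _ := by simp only [sq_abs]

lemma advAt_smul (s : ℝ) (f : Adv F) : advAt (s • f) = s • advAt f := rfl

lemma advAt_sum {ι : Type*} [Fintype ι] (c : ι → ℝ) (f : ι → Adv F) (x : Fin q → ℝ) (k : Fin 8) :
    advAt (∑ j, c j • f j) x k = ∑ j, c j * advAt (f j) x k := by
  simp [advAt, Finset.sum_apply]

lemma measurable_advAt (hF : ∀ k, ∀ f : (F k).carrier, Measurable (f : (Fin q → ℝ) → ℝ))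
    (f : Adv F) : Measurable (advAt f) :=
  measurable_pi_lambda _ fun k => hF k (f k)

/-- Every adversary function is a multiple of a member of the ball. -/
lemma exists_eq_smul_of_ball {B : ℝ} (hB : 0 < B) (f : Adv F) :
    ∃ (s : ℝ) (g : Adv F), 1 ≤ s ∧ f = s • g ∧ normF g ^ 2 ≤ B ∧
      normF f ^ 2 = B * (s - 1) ^ 2 := by
  have hsB : 0 < √B := Real.sqrt_pos.2 hB
  have hN := normF_nonneg f
  -- This choice avoids dividing by a possibly zero norm, always has `s ≥ 1`, and makes the penalty
  -- exactly `B * (s - 1) ^ 2`.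
  set s := 1 + normF f / √B with hs
  have hs1 : 1 ≤ s := by
    have : 0 ≤ normF f / √B := by positivity
    linarith
  have hs0 : 0 < s := by linarith
  refine ⟨s, s⁻¹ • f, hs1, by rw [smul_smul, mul_inv_cancel₀ hs0.ne', one_smul], ?_, ?_⟩
  · rw [normF_smul (by positivity)]
    have : s⁻¹ * normF f ≤ √B := by
      rw [inv_mul_le_iff₀ hs0, hs, add_mul, one_mul, div_mul_cancel₀ _ hsB.ne']
      linarith
    calc _ ≤ √B ^ 2 := pow_le_pow_left₀ (by positivity) this 2
      _ = B := Real.sq_sqrt hB.le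
  · rw [hs, add_sub_cancel_left, div_pow, Real.sq_sqrt hB.le]
    field_simp

variable {n : ℕ} (D : Fin n → Obs q)

lemma PsiN_eq (α : Param q) (f : Adv F) :
    PsiN D α f = empMean D (wComb α.W (advAt f ∘ obsX)) := rfl

lemma empWeightSq_eq (α : Param q) (f : Adv F) :
    empWeightSq D α f = empMean D fun z => wComb α.W (advAt f ∘ obsX) z ^ 2 := by
  unfold empWeightSq empMean wComb
  simp only [dotProduct, Function.comp, mul_comm]

lemma PsiN_smul (α : Param q) (s : ℝ) (f : Adv F) : PsiN D α (s • f) = s * PsiN D α f := by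
  rw [PsiN_eq, PsiN_eq, advAt_smul]
  exact (congrArg (empMean D) (wComb_smul _ _ _)).trans (empMean_smul _ _ _)

lemma empWeightSq_smul (α : Param q) (s : ℝ) (f : Adv F) :
    empWeightSq D α (s • f) = s ^ 2 * empWeightSq D α f := by
  rw [empWeightSq_eq, empWeightSq_eq, ← empMean_smul, advAt_smul]
  congr 1
  ext z
  have : wComb α.W ((s • advAt f) ∘ obsX) = s • wComb α.W (advAt f ∘ obsX) := wComb_smul _ _ _
  rw [this]
  simp [mul_pow]

lemma empWeightSq_nonneg (α : Param q) (f : Adv F) : 0 ≤ empWeightSq D α f :=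
  mul_nonneg (by positivity) (Finset.sum_nonneg fun _ _ => sq_nonneg _)

lemma abs_advAt_le {f : Adv F} {x : Fin q → ℝ} (h : ∑ k, advAt f x k ^ 2 ≤ 1) (k : Fin 8) :
    |advAt f x k| ≤ 1 := by
  refine abs_le_one_iff_mul_self_le_one.2 (le_trans ?_ h)
  rw [← sq]
  exact Finset.single_le_sum (f := fun k => advAt f x k ^ 2) (fun _ _ => sq_nonneg _)
    (Finset.mem_univ k)

/-- The criterion is finite when the adversary ball is bounded at the sample points. -/
lemma bddAbove_criterion {B lam : ℝ} (hB : 0 < B) (hlam : 0 < lam)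
    (hD : ∀ i, ∀ f : Adv F, normF f ^ 2 ≤ B → ∑ k, advAt f (obsX (D i)) k ^ 2 ≤ 1)
    (α αinit : Param q) : BddAbove (Set.range fun f : Adv F =>
      PsiN D α f - empWeightSq D αinit f - lam * normF f ^ 2) := by
  set M := (1 / (n : ℝ)) * ∑ i, ∑ k, |α.W (D i) k| with hM
  have hlB : 0 < lam * B := by positivity
  refine ⟨M + M ^ 2 / (4 * (lam * B)), ?_⟩
  rintro _ ⟨f, rfl⟩
  obtain ⟨s, g, hs1, rfl, hg, hN⟩ := exists_eq_smul_of_ball hB f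
  have h1 : PsiN D α g ≤ M := by
    rw [PsiN_eq, hM]
    unfold empMean
    gcongr with i
    unfold wComb
    gcongr with k
    refine (le_abs_self _).trans ?_
    rw [abs_mul]
    exact mul_le_of_le_one_right (abs_nonneg _) (abs_advAt_le (hD i g hg) k)
  have h2 := empWeightSq_nonneg D αinit (s • g)
  simp only
  rw [hN, PsiN_smul]
  have h3 : s * PsiN D α g ≤ s * M := mul_le_mul_of_nonneg_left h1 (by linarith)
  -- The linear gain in the scale `s` is beaten by the quadratic penalty.
  have h4 : M * (s - 1) ≤ lam * B * (s - 1) ^ 2 + M ^ 2 / (4 * (lam * B)) := by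
    have : M * (s - 1) - lam * B * (s - 1) ^ 2 ≤ M ^ 2 / (4 * (lam * B)) := by
      rw [le_div_iff₀ (by positivity)]
      nlinarith [sq_nonneg (M - 2 * (lam * B) * (s - 1))]
    linarith
  nlinarith

end Adversary

/-! ### The estimator on a good sample -/

section GoodSample

/-- An adversary is `s` times a member of the ball of norm `v`. Its noise `s * K * δ * v` is
absorbed by the curvature `s ^ 2 * v ^ 2` of the empirical square, and the terms without `v`, which
grow with `s`, by the penalty; what remains is of order `δ ^ 2`. -/
lemma penalized_le {s P v E lam B θ K δ cl : ℝ} (hθ : 0 < θ) (hK : 1 ≤ K) (hcl : 0 < cl)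
    (hB : 0 < B) (hδ : 0 < δ) (hs : 1 ≤ s) (hv : 0 ≤ v) (hP : P ≤ K * δ * max v δ)
    (hE : 2 * θ * v ^ 2 - θ * max (v ^ 2) ((K * δ) ^ 2) ≤ E) (hE0 : 0 ≤ E)
    (hlam : cl * δ ^ 2 ≤ lam) :
    s * P - s ^ 2 * E - lam * (B * (s - 1) ^ 2) ≤
      (K ^ 2 / (4 * (min 1 (cl * B / (4 * θ * K ^ 2)) * θ)) + K ^ 2 / (cl * B) + cl * B)
        * δ ^ 2 := by
  -- Only a fraction `τ` of the curvature is kept, so that the error `θ * (K * δ) ^ 2` coming with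
  -- it costs at most a quarter of the penalty coefficient.
  set τ := min 1 (cl * B / (4 * θ * K ^ 2)) with hτ
  have hK0 : 0 < K := by linarith
  have hτ0 : 0 < τ := lt_min one_pos (by positivity)
  have hτ1 : τ ≤ 1 := min_le_left _ _
  have hτ2 : τ * (4 * θ * K ^ 2) ≤ cl * B := by
    rw [← le_div_iff₀ (by positivity)]; exact min_le_right _ _
  have hE1 : θ * v ^ 2 - θ * (K * δ) ^ 2 ≤ E := by
    have : max (v ^ 2) ((K * δ) ^ 2) ≤ v ^ 2 + (K * δ) ^ 2 :=
      max_le (by nlinarith [sq_nonneg (K * δ)]) (by nlinarith [sq_nonneg v])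
    nlinarith
  have hE2 : τ * θ * v ^ 2 - cl * B / 4 * δ ^ 2 ≤ E := by
    have h1 : τ * (θ * v ^ 2 - θ * (K * δ) ^ 2) ≤ τ * E := mul_le_mul_of_nonneg_left hE1 hτ0.le
    have h2 : τ * E ≤ E := mul_le_of_le_one_left hE0 hτ1
    have h3 : τ * (4 * θ * K ^ 2) * δ ^ 2 ≤ cl * B * δ ^ 2 :=
      mul_le_mul_of_nonneg_right hτ2 (sq_nonneg _)
    nlinarith
  have hP1 : s * P ≤ s * (K * δ * v + K * δ ^ 2) := by
    refine mul_le_mul_of_nonneg_left (hP.trans ?_) (by linarith)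
    have : max v δ ≤ v + δ := max_le (by linarith) (by linarith)
    nlinarith [mul_pos hK0 hδ]
  have hE3 : s ^ 2 * (τ * θ * v ^ 2 - cl * B / 4 * δ ^ 2) ≤ s ^ 2 * E :=
    mul_le_mul_of_nonneg_left hE2 (sq_nonneg _)
  have hL1 : cl * δ ^ 2 * (B * (s - 1) ^ 2) ≤ lam * (B * (s - 1) ^ 2) :=
    mul_le_mul_of_nonneg_right hlam (by positivity)
  have hL2 : cl * δ ^ 2 * B * (s ^ 2 / 2 - 1) ≤ cl * δ ^ 2 * B * (s - 1) ^ 2 :=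
    mul_le_mul_of_nonneg_left (by nlinarith [sq_nonneg (s - 2)]) (by positivity)
  have hY1 : s * (K * δ * v) ≤ s ^ 2 * (τ * θ * v ^ 2) + K ^ 2 / (4 * (τ * θ)) * δ ^ 2 := by
    have hτθ : 0 < τ * θ := by positivity
    have : s * (K * δ * v) - s ^ 2 * (τ * θ * v ^ 2) ≤ K ^ 2 * δ ^ 2 / (4 * (τ * θ)) := by
      rw [le_div_iff₀ (by positivity)]
      nlinarith [sq_nonneg (K * δ - 2 * (τ * θ) * (s * v))]
    rw [div_mul_eq_mul_div]
    linarith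
  have hY2 : s * (K * δ ^ 2) ≤ cl * B / 4 * δ ^ 2 * s ^ 2 + K ^ 2 / (cl * B) * δ ^ 2 := by
    have hclB : 0 < cl * B := by positivity
    have : s * K ≤ cl * B / 4 * s ^ 2 + K ^ 2 / (cl * B) := by
      have : s * K - cl * B / 4 * s ^ 2 ≤ K ^ 2 / (cl * B) := by
        rw [le_div_iff₀ hclB]
        nlinarith [sq_nonneg (K - cl * B * s / 2)]
      linarith
    nlinarith [mul_le_mul_of_nonneg_right this (sq_nonneg δ)]
  nlinarith

/-- For a test function scaled by a small fixed `u`, the gain is linear in `u` and the quadratic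
cost is of order `u ^ 2`. With `u` as chosen, noise and quadratic cost each use up at most an eighth
of `s₀ * (X + G)`, and a quarter of `u * s₀ * X` survives. -/
lemma exists_moment_bound {s₀ N a b e C G₀ : ℝ} (hs₀ : 0 < s₀) (hN : 0 < N)
    (hb : 0 ≤ b) (he : 0 ≤ e) (hC : 0 < C) (hG₀ : 0 ≤ G₀) :
    ∃ u C' : ℝ, 0 < u ∧ u ≤ 1 ∧ 0 < C' ∧ ∀ δ V X G : ℝ, 0 ≤ V → 0 ≤ X → 0 ≤ G →
      V ≤ 2 * s₀ ^ 2 * (X + G) → G ≤ G₀ * δ ^ 2 →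
      u * (s₀ * (X - G) / 2 - (a * δ * √V + b * δ ^ 2)) - u ^ 2 * (N * V + e * δ ^ 2)
        ≤ C * δ ^ 2 → X ≤ C' * δ ^ 2 := by
  set u := min 1 (1 / (16 * s₀ * N)) with hu
  have hu0 : 0 < u := lt_min one_pos (by positivity)
  have hu1 : u ≤ 1 := min_le_left _ _
  have huN : u * (16 * s₀ * N) ≤ 1 := by
    rw [← le_div_iff₀ (by positivity)]; exact min_le_right _ _
  refine ⟨u, 4 * (C + s₀ * G₀ + 4 * s₀ * a ^ 2 + b + e) / (u * s₀), hu0, hu1, by positivity, ?_⟩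
  intro δ V X G hV hX hG hVX hGδ h
  have h1 : a * δ * √V ≤ s₀ * (X + G) / 8 + 4 * s₀ * a ^ 2 * δ ^ 2 := by
    have h2 : √V ^ 2 ≤ 2 * s₀ ^ 2 * (X + G) := by rw [Real.sq_sqrt hV]; exact hVX
    have h3 := sq_nonneg (√V - 8 * s₀ * (a * δ))
    have h4 : 16 * s₀ * (a * δ * √V) ≤ 16 * s₀ * (s₀ * (X + G) / 8 + 4 * s₀ * a ^ 2 * δ ^ 2) := by
      nlinarith
    exact le_of_mul_le_mul_left h4 (by positivity)
  have h2 : u ^ 2 * (N * V) ≤ u * (s₀ * (X + G) / 8) := by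
    have h3 : u * N * V ≤ u * N * (2 * s₀ ^ 2 * (X + G)) :=
      mul_le_mul_of_nonneg_left hVX (by positivity)
    have h4 : u * (16 * s₀ * N) * (s₀ * (X + G) / 8) ≤ 1 * (s₀ * (X + G) / 8) :=
      mul_le_mul_of_nonneg_right huN (by positivity)
    have h5 : u * N * V ≤ s₀ * (X + G) / 8 := by nlinarith
    nlinarith [mul_le_mul_of_nonneg_left h5 hu0.le]
  have h3 : u ^ 2 * (e * δ ^ 2) ≤ e * δ ^ 2 :=
    mul_le_of_le_one_left (by positivity) (pow_le_one₀ hu0.le hu1)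
  have h4 : u * (s₀ * G + 4 * s₀ * a ^ 2 * δ ^ 2 + b * δ ^ 2) ≤
      s₀ * (G₀ * δ ^ 2) + 4 * s₀ * a ^ 2 * δ ^ 2 + b * δ ^ 2 := by
    refine (mul_le_of_le_one_left (by positivity) hu1).trans ?_
    have := mul_le_mul_of_nonneg_left hGδ hs₀.le
    linarith
  have h5 : u * (a * δ * √V) ≤ u * (s₀ * (X + G) / 8 + 4 * s₀ * a ^ 2 * δ ^ 2) :=
    mul_le_mul_of_nonneg_left h1 hu0.le
  have h6 : 0 ≤ u * s₀ * G := by positivity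
  rw [div_mul_eq_mul_div, le_div_iff₀ (by positivity)]
  nlinarith

variable {q : ℕ}

/-- The second bound is polarization, `2 g · f = |g|² + |f|² - |f - g|²`, with `|f|²` dropped: a
function close to `g` is aligned with `g`. -/
lemma integral_vecSq_le_and_integral_mul_ge {ν : Measure (Fin q → ℝ)} [IsProbabilityMeasure ν]
    {f g : (Fin q → ℝ) → Fin 8 → ℝ} {C C' : ℝ} (hf : Measurable f) (hg : Measurable g)
    (hfC : ∀ᵐ x ∂ν, ∀ k, |f x k| ≤ C) (hgC : ∀ᵐ x ∂ν, ∀ k, |g x k| ≤ C') :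
    ∫ x, vecSq f x ∂ν ≤ 2 * (∫ x, vecSq g x ∂ν + ∫ x, vecSq (f - g) x ∂ν) ∧
    (∫ x, vecSq g x ∂ν - ∫ x, vecSq (f - g) x ∂ν) / 2 ≤ ∫ x, ∑ k, g x k * f x k ∂ν := by
  have h1 := integrable_vecSq_of_abs_le hf hfC
  have h2 := integrable_vecSq_of_abs_le hg hgC
  have h3 : Integrable (vecSq (f - g)) ν := by
    refine integrable_vecSq_of_abs_le (C := C + C') (hf.sub hg) ?_
    filter_upwards [hfC, hgC] with x hx hx' k
    exact (abs_sub _ _).trans (add_le_add (hx k) (hx' k))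
  have h4 : Integrable (fun x => ∑ k, g x k * f x k) ν := by
    refine integrable_finsetSum _ fun k _ => ?_
    refine integrable_of_abs_le (C := C' * C) (by fun_prop) ?_
    filter_upwards [hfC, hgC] with x hx hx'
    rw [abs_mul]
    exact mul_le_mul (hx' k) (hx k) (abs_nonneg _) ((abs_nonneg _).trans (hx' k))
  constructor
  · rw [← integral_add h2 h3, ← integral_const_mul]
    refine integral_mono h1 ((h2.add h3).const_mul _) fun x => ?_
    simp only [vecSq, Pi.sub_apply, ← Finset.sum_add_distrib, Finset.mul_sum]
    exact Finset.sum_le_sum fun k _ => by nlinarith [sq_nonneg (2 * g x k - f x k)]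
  · rw [← integral_sub h2 h3, ← integral_div]
    refine integral_mono ((h2.sub h3).div_const _) h4 fun x => ?_
    simp only [vecSq, Pi.sub_apply, ← Finset.sum_sub_distrib, Finset.sum_div]
    exact Finset.sum_le_sum fun k _ => by nlinarith [sq_nonneg (f x k)]

variable (Q : Measure (Obs q)) (H : NormedFunctionSpace (Param q))
  (F : Fin 8 → NormedFunctionSpace ((Fin q → ℝ) → ℝ)) (α₀ αinit : H.carrier)

/-- Samples on which the adversary ball is bounded and the empirical criterion is close to its
mean. -/
structure GoodSample (A B L θ K δ : ℝ) {n : ℕ} (D : Fin n → Obs q) : Prop where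
  bound : ∀ i, ∀ f : Adv F, normF f ^ 2 ≤ B → ∑ k, advAt f (obsX (D i)) k ^ 2 ≤ 1
  product : ∀ g ∈ productClass F H α₀ A B L,
    |empMean D g - ∫ z, g z ∂Q| ≤ K * δ * max (√(∫ z, g z ^ 2 ∂Q)) δ
  linear : ∀ f : Adv F, normF f ^ 2 ≤ B →
    |PsiN D α₀ f - ∫ z, wComb (α₀ : Param q).W (advAt f ∘ obsX) z ∂Q| ≤
      K * δ * max (√(∫ x, vecSq (advAt f) x ∂(lawX Q))) δ
  quadratic : ∀ f : Adv F, normF f ^ 2 ≤ B →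
    |empWeightSq D αinit f - ∫ z, wComb (αinit : Param q).W (advAt f ∘ obsX) z ^ 2 ∂Q| ≤
      θ * max (∫ x, vecSq (advAt f) x ∂(lawX Q)) ((K * δ) ^ 2)

end GoodSample

/-! ### Deterministic bounds for the estimator on a good sample. -/

section Estimator

variable {q : ℕ} {Q : Measure (Obs q)} {H : NormedFunctionSpace (Param q)}
  {F : ℕ → Fin 8 → NormedFunctionSpace ((Fin q → ℝ) → ℝ)} {α₀ αinit : H.carrier}
  {A B L ηS cS : ℝ} {ηL : ℕ → ℝ}

lemma exists_abs_advAt_le (hB : 0 < B) (hnorm : Normalized Q H F A B) {n : ℕ} (f : Adv (F n)) :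
    ∃ C : ℝ, ∀ᵐ x ∂(lawX Q), ∀ k, |advAt f x k| ≤ C := by
  obtain ⟨s, g, hs, rfl, hg, -⟩ := exists_eq_smul_of_ball hB f
  refine ⟨s, ?_⟩
  filter_upwards [hnorm.F_bound n] with x hx k
  rw [advAt_smul, Pi.smul_apply, Pi.smul_apply, smul_eq_mul, abs_mul, abs_of_nonneg (by linarith)]
  exact mul_le_of_le_one_right (by linarith) (abs_advAt_le (hx g hg) k)

lemma exists_abs_W_le (hA : 0 < A) (hnorm : Normalized Q H F A B) (α : H.carrier) :
    ∃ C : ℝ, 1 ≤ C ∧ ∀ᵐ z ∂Q, ∀ k, |(α : Param q).W z k| ≤ C := by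
  obtain ⟨C, hC1, hC⟩ := exists_bound_on_ball hA hnorm (apply_nonneg H.norm α)
  exact ⟨C, hC1, hC.mono fun z hz => (hz α le_rfl).2⟩

variable [IsProbabilityMeasure Q]

lemma wComb_eq_sum {S ι : Type*} [Fintype ι] {d : ℕ} {c : ι → ℝ} {w : S → Fin d → ℝ}
    {v : ι → S → Fin d → ℝ} (h : ∀ z k, w z k = ∑ j, c j * v j z k) (f : S → Fin d → ℝ) (z : S) :
    wComb w f z = ∑ j, c j * wComb (v j) f z := by
  simp only [wComb, h, Finset.sum_mul, Finset.mul_sum]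
  rw [Finset.sum_comm]
  exact Finset.sum_congr rfl fun j _ => Finset.sum_congr rfl fun k _ => by ring

/-- Deviation bounds extend to linear combinations of residuals. -/
lemma abs_PsiN_sub_le_of_eq_sum {ι : Type*} [Fintype ι] {c : ι → ℝ} {α : Param q}
    {β : ι → Param q} {E : Fin 8 → NormedFunctionSpace ((Fin q → ℝ) → ℝ)} {f : Adv E} {b : ℝ}
    (hβ : ∀ j, (β j).IsMeas) (hβb : ∀ j, ∀ᵐ z ∂Q, ∀ k, |(β j).W z k| ≤ 1)
    (hW : ∀ z k, α.W z k = ∑ j, c j * (β j).W z k) (hf : Measurable (advAt f))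
    (hfb : ∀ᵐ x ∂(lawX Q), ∀ k, |advAt f x k| ≤ 1) {n : ℕ} {D : Fin n → Obs q}
    (h : ∀ j, |PsiN D (β j) f - ∫ z, wComb (β j).W (advAt f ∘ obsX) z ∂Q| ≤ b) :
    |PsiN D α f - ∫ z, wComb α.W (advAt f ∘ obsX) z ∂Q| ≤ (∑ j, |c j|) * b := by
  have hX := measurable_obsX (q := q)
  have hfX := ae_of_ae_map measurable_obsX.aemeasurable hfb
  have h1 : PsiN D α f = ∑ j, c j * PsiN D (β j) f := by
    simp only [PsiN_eq, empMean, wComb_eq_sum hW]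
    rw [Finset.sum_comm, Finset.mul_sum]
    refine Finset.sum_congr rfl fun j _ => ?_
    rw [← Finset.mul_sum]
    ring
  have h2 : ∫ z, wComb α.W (advAt f ∘ obsX) z ∂Q =
      ∑ j, c j * ∫ z, wComb (β j).W (advAt f ∘ obsX) z ∂Q := by
    simp only [wComb_eq_sum hW]
    rw [integral_finsetSum]
    · simp only [integral_const_mul]
    · intro j _
      refine Integrable.const_mul ?_ _
      unfold wComb
      refine integrable_finsetSum _ fun k _ => ?_
      have := measurable_W (hβ j)
      refine integrable_of_abs_le (C := 1 * 1) (by fun_prop) ?_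
      filter_upwards [hβb j, hfX] with z h3 h4
      rw [abs_mul]
      exact mul_le_mul (h3 k) (h4 k) (abs_nonneg _) zero_le_one
  rw [h1, h2, ← Finset.sum_sub_distrib, Finset.sum_mul]
  refine (Finset.abs_sum_le_sum_abs _ _).trans (Finset.sum_le_sum fun j _ => ?_)
  rw [← mul_sub, abs_mul]
  exact mul_le_mul_of_nonneg_left (h j) (abs_nonneg _)

/-- Approximations of the conditional moments extend to linear combinations. -/
lemma integral_vecSq_sub_m_le_of_eq_sum {ι : Type*} [Fintype ι] {c : ι → ℝ} {α : Param q}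
    {β : ι → Param q} (hB : 0 < B) (hF : ∀ n k, ∀ f : (F n k).carrier, Measurable f.1)
    (hnorm : Normalized Q H F A B) (hβ : ∀ j, (β j).IsMeas)
    (hβb : ∀ j, ∀ᵐ z ∂Q, ∀ k, |(β j).W z k| ≤ 1)
    (hW : ∀ z k, α.W z k = ∑ j, c j * (β j).W z k) {n : ℕ} (f : ι → Adv (F n)) {b : ℝ}
    (hb : 0 ≤ b) (h : ∀ j, normL2X Q (fun x => advAt (f j) x - m Q (β j) x) ≤ b) :
    ∫ x, vecSq (advAt (∑ j, c j • f j) - m Q α) x ∂(lawX Q) ≤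
      (∑ j, c j ^ 2) * (Fintype.card ι * b ^ 2) := by
  have hj : ∀ j, Integrable (vecSq (advAt (f j) - m Q (β j))) (lawX Q) := by
    intro j
    obtain ⟨Cj, hCj⟩ := exists_abs_advAt_le hB hnorm (f j)
    refine integrable_vecSq_of_abs_le (C := Cj + 1) ((measurable_advAt (hF n) _).sub
      (measurable_m (hβ j))) ?_
    filter_upwards [hCj, abs_m_le (hβb j)] with x h1 h2 k
    exact (abs_sub _ _).trans (add_le_add (h1 k) (h2 k))
  have hj' : ∀ j, ∫ x, vecSq (advAt (f j) - m Q (β j)) x ∂(lawX Q) ≤ b ^ 2 := fun j =>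
    (Real.sqrt_le_left hb).1 (h j)
  have hpt : ∀ᵐ x ∂(lawX Q), vecSq (advAt (∑ j, c j • f j) - m Q α) x ≤
      (∑ j, c j ^ 2) * ∑ j, vecSq (advAt (f j) - m Q (β j)) x := by
    filter_upwards [m_eq_sum hβ hβb hW] with x hx
    simp only [vecSq, Pi.sub_apply]
    rw [Finset.sum_comm, Finset.mul_sum]
    refine Finset.sum_le_sum fun k _ => ?_
    rw [hx k, advAt_sum, ← Finset.sum_sub_distrib]
    simp only [← mul_sub]
    exact Finset.sum_mul_sq_le_sq_mul_sq _ _ _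
  calc _ ≤ ∫ x, (∑ j, c j ^ 2) * ∑ j, vecSq (advAt (f j) - m Q (β j)) x ∂(lawX Q) :=
        integral_mono_of_nonneg (ae_of_all _ fun x => vecSq_nonneg _ _)
          ((integrable_finsetSum _ fun j _ => hj j).const_mul _) hpt
    _ = (∑ j, c j ^ 2) * ∑ j, ∫ x, vecSq (advAt (f j) - m Q (β j)) x ∂(lawX Q) := by
        rw [integral_const_mul, integral_finsetSum _ fun j _ => hj j]
    _ ≤ _ := by
        refine mul_le_mul_of_nonneg_left ?_ (Finset.sum_nonneg fun _ _ => sq_nonneg _)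
        refine (Finset.sum_le_sum fun j _ => hj' j).trans (le_of_eq ?_)
        simp

lemma integral_wComb_sq_le {α : Param q} {b : ℝ} (hb : ∀ᵐ z ∂Q, ∀ k, |α.W z k| ≤ b)
    {f : (Fin q → ℝ) → Fin 8 → ℝ} {C : ℝ} (hf : Measurable f)
    (hfC : ∀ᵐ x ∂(lawX Q), ∀ k, |f x k| ≤ C) :
    ∫ z, wComb α.W (f ∘ obsX) z ^ 2 ∂Q ≤ 8 * b ^ 2 * ∫ x, vecSq f x ∂(lawX Q) := by
  have h1 : ∫ z, vecSq f (obsX z) ∂Q = ∫ x, vecSq f x ∂(lawX Q) :=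
    integral_comp_obsX (by unfold vecSq; fun_prop)
  have h2 : Integrable (fun z => vecSq f (obsX z)) Q :=
    (integrable_vecSq_of_abs_le hf hfC).comp_measurable measurable_obsX
  rw [← h1, ← integral_const_mul]
  refine integral_mono_of_nonneg (ae_of_all _ fun z => sq_nonneg _) (h2.const_mul _) ?_
  filter_upwards [hb] with z hz
  exact_mod_cast wComb_sq_le (f := f ∘ obsX) hz

/-- At the true parameter the penalized criterion is of order `δ²`. -/
lemma exists_criterion_true_le (hA : 0 < A) (hB : 0 < B) (hmeas : MeasurableSpaces H F α₀ A B L)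
    (hnorm : Normalized Q H F A B)
    (hspaces : IdentifiabilityAndSpaces Q H F α₀ αinit A L ηL ηS cS) {cl K : ℝ} (hcl : 0 < cl)
    (hK : 1 ≤ K) :
    ∃ C : ℝ, 0 < C ∧ ∀ (n : ℕ) (D : Fin n → Obs q) (δ lam : ℝ), 0 < δ → cl * δ ^ 2 ≤ lam →
      GoodSample Q H (F n) α₀ αinit A B L (cS / 2) K δ D → ∀ f : Adv (F n),
      PsiN D α₀ f - empWeightSq D αinit f - lam * normF f ^ 2 ≤ C * δ ^ 2 := by
  have hcS := hspaces.cS_pos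
  refine ⟨K ^ 2 / (4 * (min 1 (cl * B / (4 * (cS / 2) * K ^ 2)) * (cS / 2))) + K ^ 2 / (cl * B)
    + cl * B, by positivity, fun n D δ lam hδ hlam hD f => ?_⟩
  obtain ⟨s, g, hs1, rfl, hg, hN⟩ := exists_eq_smul_of_ball hB f
  rw [hN, PsiN_smul, empWeightSq_smul]
  obtain ⟨C, -, hC⟩ := exists_abs_W_le hA hnorm α₀
  obtain ⟨C', -, hC'⟩ := exists_abs_W_le hA hnorm αinit
  have hgm := measurable_advAt (hmeas.F_meas n) g
  have hgb : ∀ᵐ x ∂(lawX Q), ∀ k, |advAt g x k| ≤ 1 := by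
    filter_upwards [hnorm.F_bound n] with x hx k using abs_advAt_le (hx g hg) k
  have h1 := hD.linear g hg
  have h2 := hD.quadratic g hg
  -- At `α₀` the linear term is pure noise, because the conditional moments vanish.
  have h3 : ∫ z, wComb (α₀ : Param q).W (advAt g ∘ obsX) z ∂Q = 0 := by
    rw [integral_wComb_W (hmeas.H_meas α₀) hC hgm hgb]
    refine integral_eq_zero_of_ae ?_
    filter_upwards [hspaces.moment] with x hx
    simp [hx]
  -- The initial parameter lies in the nondegeneracy neighbourhood of `α₀`, so the weighted square
  -- dominates `cS` times the `L²` norm; the deviation level `cS / 2` gives back only half of this.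
  have h4 := integral_wComb_W_sq_ge (hmeas.H_meas αinit) hC'
    (hspaces.nondegenerate αinit hspaces.init.1 hspaces.init.2) hgm hgb
  have hV0 : 0 ≤ ∫ x, vecSq (advAt g) x ∂(lawX Q) := integral_nonneg fun x => vecSq_nonneg _ _
  rw [h3, sub_zero] at h1
  refine penalized_le (θ := cS / 2) (v := √(∫ x, vecSq (advAt g) x ∂(lawX Q))) (by positivity) hK
    hcl hB hδ hs1 (Real.sqrt_nonneg _) ((le_abs_self _).trans h1) ?_
    (empWeightSq_nonneg _ _ _) hlam
  rw [Real.sq_sqrt hV0]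
  have := (abs_le.1 h2).1
  linarith

/-- The estimator stays in a ball of `H`, and its penalized criterion is of order `δ²`. -/
lemma exists_estimator_bound (hA : 0 < A) (hB : 0 < B) (hmeas : MeasurableSpaces H F α₀ A B L)
    (hnorm : Normalized Q H F A B)
    (hspaces : IdentifiabilityAndSpaces Q H F α₀ αinit A L ηL ηS cS) {cl cm Cm K K' : ℝ}
    (hcl : 0 < cl) (hcm : 0 < cm) (hCm : 0 ≤ Cm) (hK : 1 ≤ K) (hK' : 0 ≤ K') :
    ∃ R C : ℝ, 0 ≤ R ∧ 0 < C ∧ ∀ (n : ℕ) (D : Fin n → Obs q) (δ lam mu : ℝ) (α : H.carrier),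
      0 < δ → cl * δ ^ 2 ≤ lam → cm * δ ^ 2 ≤ mu → mu ≤ Cm * δ ^ 2 →
      GoodSample Q H (F n) α₀ αinit A B L (cS / 2) K δ D →
      |PhiHat (F n) D H αinit lam mu α - ⨅ β : H.carrier, PhiHat (F n) D H αinit lam mu β| ≤
        K' * δ ^ 2 →
      H.norm α ≤ R ∧ ∀ f : Adv (F n),
        PsiN D α f - empWeightSq D αinit f - lam * normF f ^ 2 ≤ C * δ ^ 2 := by
  obtain ⟨C₁, hC₁, hcrit⟩ := exists_criterion_true_le hA hB hmeas hnorm hspaces hcl hK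
  set C₂ := C₁ + Cm * H.norm α₀ ^ 2 + K' with hC₂
  have hC₂0 : 0 < C₂ := by positivity
  refine ⟨√(C₂ / cm), C₂, Real.sqrt_nonneg _, hC₂0, ?_⟩
  intro n D δ lam mu α hδ hlam hmu hmu' hD hα
  have hδ2 : 0 < δ ^ 2 := by positivity
  have hlam0 : 0 < lam := lt_of_lt_of_le (by positivity) hlam
  have hmu0 : 0 < mu := lt_of_lt_of_le (by positivity) hmu
  have hsup0 : ∀ β : H.carrier, 0 ≤ ⨆ f : Adv (F n),
      (PsiN D (β : Param q) f - empWeightSq D αinit f - lam * normF f ^ 2) := by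
    intro β
    refine Real.iSup_nonneg' ⟨0, ?_⟩
    have h1 := PsiN_smul D (β : Param q) 0 (0 : Adv (F n))
    have h2 := empWeightSq_smul D (αinit : Param q) 0 (0 : Adv (F n))
    rw [zero_smul] at h1 h2
    rw [h1, h2, normF_zero]
    norm_num
  have hbdd : BddBelow (Set.range fun β : H.carrier => PhiHat (F n) D H αinit lam mu β) := by
    refine ⟨0, ?_⟩
    rintro _ ⟨β, rfl⟩
    exact add_nonneg (hsup0 β) (by positivity)
  have h0 : PhiHat (F n) D H αinit lam mu α₀ ≤ C₁ * δ ^ 2 + mu * H.norm α₀ ^ 2 :=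
    add_le_add_left (ciSup_le (hcrit n D δ lam hδ hlam hD)) _
  have h1 := ciInf_le hbdd α₀
  have h2 := (le_abs_self _).trans hα
  have h3 : mu * H.norm α₀ ^ 2 ≤ Cm * δ ^ 2 * H.norm α₀ ^ 2 :=
    mul_le_mul_of_nonneg_right hmu' (sq_nonneg _)
  have h4 : PhiHat (F n) D H αinit lam mu α ≤ C₂ * δ ^ 2 := by rw [hC₂]; linarith
  have h5 : 0 ≤ mu * H.norm α ^ 2 := by positivity
  unfold PhiHat at h4
  constructor
  · refine Real.le_sqrt_of_sq_le ?_
    have h6 : cm * δ ^ 2 * H.norm α ^ 2 ≤ mu * H.norm α ^ 2 :=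
      mul_le_mul_of_nonneg_right hmu (sq_nonneg _)
    have h7 := hsup0 α
    rw [le_div_iff₀ hcm]
    refine le_of_mul_le_mul_right ?_ hδ2
    nlinarith
  · intro f
    -- Boundedness matters here: an unbounded family would have real supremum 0 and give no control
    -- over individual adversaries.
    have := le_ciSup (bddAbove_criterion D hB hlam0 hD.bound (α : Param q) αinit) f
    linarith

/-- A test function in the adversary ball that nearly aligns with the conditional moments. -/
lemma exists_test_function (hA : 0 < A) (hB : 0 < B) (hL : 0 < L)
    (hmeas : MeasurableSpaces H F α₀ A B L) (hnorm : Normalized Q H F A B)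
    (hspaces : IdentifiabilityAndSpaces Q H F α₀ αinit A L ηL ηS cS) {K R CL : ℝ}
    (hK : 1 ≤ K) (hR : 0 ≤ R) (hCL : 0 ≤ CL) :
    ∃ s₀ G₀ Cc : ℝ, 0 < s₀ ∧ 0 ≤ G₀ ∧ 0 ≤ Cc ∧ ∀ (n : ℕ) (D : Fin n → Obs q) (δ : ℝ)
      (α : H.carrier), 0 < δ → δ ≤ 1 → ηL n ≤ CL * δ ^ 2 →
      GoodSample Q H (F n) α₀ αinit A B L (cS / 2) K δ D → H.norm α ≤ R →
      ∃ (f : Adv (F n)) (G : ℝ), normF f ^ 2 ≤ B ∧ 0 ≤ G ∧ G ≤ G₀ * δ ^ 2 ∧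
        ∫ x, vecSq (advAt f) x ∂(lawX Q) ≤
          2 * s₀ ^ 2 * (∫ x, vecSq (m Q α) x ∂(lawX Q) + G) ∧
        s₀ * (∫ x, vecSq (m Q α) x ∂(lawX Q) - G) / 2 - (Cc * K * √8 * δ *
          √(∫ x, vecSq (advAt f) x ∂(lawX Q)) + Cc * K * δ ^ 2) ≤ PsiN D α f := by
  obtain ⟨t, c, ht, hint⟩ := exists_interpolation H α₀ hA hR
  set cc := ∑ j, c j ^ 2 with hcc
  have hcc0 : 0 ≤ cc := Finset.sum_nonneg fun _ _ => sq_nonneg _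
  set ρ := R + H.norm α₀ with hρ
  have hρ0 : 0 ≤ ρ := add_nonneg hR (apply_nonneg _ _)
  -- Here 125 is five approximants times the square of the distance ratio 5. The first bound puts
  -- the test function into the product class at every node, the second into the ball of radius
  -- `√B`.
  obtain ⟨s₀, hs₀, hs₁, hs₂⟩ : ∃ s₀ : ℝ, 0 < s₀ ∧ s₀ ^ 2 * (125 * cc) ≤ 1 ∧
      s₀ ^ 2 * (125 * cc) * (L * ρ) ^ 2 ≤ B := by
    set T := 1 + 125 * cc + 125 * cc * (L * ρ) ^ 2 / B with hT
    have hx : 0 ≤ 125 * cc * (L * ρ) ^ 2 / B := by positivity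
    have hT1 : 1 ≤ T := by linarith
    have hT0 : 0 < T := by linarith
    have hT2 : T ≤ T ^ 2 := by nlinarith
    refine ⟨T⁻¹, by positivity, ?_, ?_⟩
    · rw [inv_pow, inv_mul_le_iff₀ (by positivity)]
      linarith
    · rw [inv_pow, mul_assoc, inv_mul_le_iff₀ (by positivity), ← div_le_iff₀ hB]
      linarith
  set Cc := ∑ j, |c j| with hCc
  have hCc0 : 0 ≤ Cc := Finset.sum_nonneg fun _ _ => abs_nonneg _
  refine ⟨s₀, 5 * cc * CL ^ 2, Cc, hs₀, by positivity, hCc0, ?_⟩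
  intro n D δ α hδ hδ1 hηL hD hα
  obtain ⟨hballA, hW, hdist⟩ := hint α hα
  -- The approximation assumption reaches only `H_A`, so the moments at the nodes are approximated
  -- and recombined with the interpolation weights.
  choose f hfL hfη using fun j => hspaces.approx n (t j • α) (hballA j)
  set fs : Adv (F n) := ∑ j, c j • f j with hfs
  set f₁ : Adv (F n) := s₀ • fs with hf₁
  have hWβ : ∀ j, ∀ᵐ z ∂Q, ∀ k, |((t j • α : H.carrier) : Param q).W z k| ≤ 1 := fun j =>
    hnorm.H_bound.mono fun z hz => (hz _ (hballA j)).2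
  obtain ⟨CW, -, hCW⟩ := exists_abs_W_le hA hnorm α
  have hmb := abs_m_le hCW
  have hmm := measurable_m (Q := Q) (hmeas.H_meas α)
  have hfsm := measurable_advAt (hmeas.F_meas n) fs
  obtain ⟨Cf, hfsb⟩ := exists_abs_advAt_le (Q := Q) (H := H) (A := A) hB hnorm fs
  -- the norm of the adversary
  have hnormfs : ∀ i, normF fs ^ 2 ≤ 125 * cc * (L * H.norm (t i • α - α₀)) ^ 2 := by
    intro i
    refine (normF_sum_sq_le c f).trans ?_
    have h1 : ∀ j, normF (f j) ^ 2 ≤ 25 * (L * H.norm (t i • α - α₀)) ^ 2 := by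
      intro j
      have h2 : normF (f j) ≤ 5 * (L * H.norm (t i • α - α₀)) := by
        refine (hfL j).trans ?_
        have := mul_le_mul_of_nonneg_left (hdist i j) hL.le
        linarith
      have := pow_le_pow_left₀ (normF_nonneg _) h2 2
      linarith
    have h3 : ∑ j, normF (f j) ^ 2 ≤ 125 * (L * H.norm (t i • α - α₀)) ^ 2 := by
      refine (Finset.sum_le_sum fun j _ => h1 j).trans ?_
      simp
      linarith
    have := mul_le_mul_of_nonneg_left h3 hcc0
    linarith
  have hnormf₁ : ∀ i, normF f₁ ≤ L * H.norm (t i • α - α₀) := by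
    intro i
    have hn : 0 ≤ L * H.norm (t i • α - α₀) := mul_nonneg hL.le (apply_nonneg _ _)
    refine le_of_sq_le_sq ?_ hn
    rw [hf₁, normF_smul hs₀.le, mul_pow]
    calc _ ≤ s₀ ^ 2 * (125 * cc * (L * H.norm (t i • α - α₀)) ^ 2) :=
          mul_le_mul_of_nonneg_left (hnormfs i) (sq_nonneg _)
      _ = s₀ ^ 2 * (125 * cc) * (L * H.norm (t i • α - α₀)) ^ 2 := by ring
      _ ≤ _ := mul_le_of_le_one_left (sq_nonneg _) hs₁
  have hballf₁ : normF f₁ ^ 2 ≤ B := by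
    have h1 : H.norm (t 0 • α - α₀) ≤ ρ := by
      refine (map_sub_le_add _ _ _).trans (add_le_add_left ?_ _)
      rw [map_smul_eq_mul, Real.norm_of_nonneg (ht 0).1]
      exact (mul_le_of_le_one_left (apply_nonneg _ _) (ht 0).2).trans hα
    have h2 : (L * H.norm (t 0 • α - α₀)) ^ 2 ≤ (L * ρ) ^ 2 :=
      pow_le_pow_left₀ (mul_nonneg hL.le (apply_nonneg _ _)) (mul_le_mul_of_nonneg_left h1 hL.le) 2
    rw [hf₁, normF_smul hs₀.le, mul_pow]
    calc _ ≤ s₀ ^ 2 * (125 * cc * (L * H.norm (t 0 • α - α₀)) ^ 2) :=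
          mul_le_mul_of_nonneg_left (hnormfs 0) (sq_nonneg _)
      _ ≤ s₀ ^ 2 * (125 * cc * (L * ρ) ^ 2) := by gcongr
      _ = s₀ ^ 2 * (125 * cc) * (L * ρ) ^ 2 := by ring
      _ ≤ B := hs₂
  -- approximation of the conditional moments
  set X := ∫ x, vecSq (m Q α) x ∂(lawX Q) with hX
  set G := ∫ x, vecSq (advAt fs - m Q α) x ∂(lawX Q) with hG
  set V := ∫ x, vecSq (advAt f₁) x ∂(lawX Q) with hV
  have hX0 : 0 ≤ X := integral_nonneg fun x => vecSq_nonneg _ _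
  have hG0 : 0 ≤ G := integral_nonneg fun x => vecSq_nonneg _ _
  have hV0 : 0 ≤ V := integral_nonneg fun x => vecSq_nonneg _ _
  have hGle : G ≤ 5 * cc * CL ^ 2 * δ ^ 2 := by
    have hδ2 : δ ^ 2 ≤ δ := by nlinarith
    have := integral_vecSq_sub_m_le_of_eq_sum hB hmeas.F_meas hnorm
      (fun j => hmeas.H_meas (t j • α)) hWβ hW f (by positivity : 0 ≤ CL * δ)
      fun j => (hfη j).trans (hηL.trans (mul_le_mul_of_nonneg_left hδ2 hCL))
    rw [Fintype.card_fin] at this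
    push_cast at this
    calc G ≤ cc * (5 * (CL * δ) ^ 2) := this
      _ = _ := by ring
  obtain ⟨hVfs, hinner⟩ := integral_vecSq_le_and_integral_mul_ge hfsm hmm hfsb hmb
  have hVeq : V = s₀ ^ 2 * ∫ x, vecSq (advAt fs) x ∂(lawX Q) := by
    rw [hV, hf₁, advAt_smul, vecSq_smul, ← integral_const_mul]
    rfl
  have hVle : V ≤ 2 * s₀ ^ 2 * (X + G) := by
    have := mul_le_mul_of_nonneg_left hVfs (sq_nonneg s₀)
    rw [hVeq]
    linarith
  -- empirical lower bound of the criterion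
  have hf₁m := measurable_advAt (hmeas.F_meas n) f₁
  have hf₁b : ∀ᵐ x ∂(lawX Q), ∀ k, |advAt f₁ x k| ≤ 1 := by
    filter_upwards [hnorm.F_bound n] with x hx k using abs_advAt_le (hx f₁ hballf₁) k
  have hPsi : s₀ * (X - G) / 2 - (Cc * K * √8 * δ * √V + Cc * K * δ ^ 2) ≤ PsiN D α f₁ := by
    have h1 : ∀ j, |PsiN D (t j • α : H.carrier) f₁ -
        ∫ z, wComb ((t j • α : H.carrier) : Param q).W (advAt f₁ ∘ obsX) z ∂Q| ≤
        K * (√8 * δ * √V + δ ^ 2) := by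
      intro j
      refine (hD.product _ ⟨t j • α, f₁, hballA j, hballf₁, hnormf₁ j, rfl⟩).trans ?_
      have h2 : √(∫ z, (((t j • α : H.carrier) : Param q).W z ⬝ᵥ advAt f₁ (obsX z)) ^ 2 ∂Q) ≤
          √8 * √V := by
        rw [← Real.sqrt_mul (by norm_num)]
        refine Real.sqrt_le_sqrt ((integral_wComb_sq_le (hWβ j) hf₁m hf₁b).trans (le_of_eq (by ring)))
      have h3 : 0 ≤ √8 * √V := by positivity
      have h4 : max (√(∫ z, (((t j • α : H.carrier) : Param q).W z ⬝ᵥ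
          advAt f₁ (obsX z)) ^ 2 ∂Q)) δ ≤ √8 * √V + δ :=
        max_le (by linarith) (by linarith)
      have := mul_le_mul_of_nonneg_left h4 (by positivity : 0 ≤ K * δ)
      linarith
    have h4 : s₀ * (X - G) / 2 ≤ ∫ z, wComb (α : Param q).W (advAt f₁ ∘ obsX) z ∂Q := by
      rw [integral_wComb_W (hmeas.H_meas α) hCW hf₁m hf₁b]
      have : ∫ x, ∑ k, m Q α x k * advAt f₁ x k ∂(lawX Q) =
          s₀ * ∫ x, ∑ k, m Q α x k * advAt fs x k ∂(lawX Q) := by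
        rw [← integral_const_mul]
        congr 1
        ext x
        rw [Finset.mul_sum]
        exact Finset.sum_congr rfl fun k _ => by
          simp only [hf₁, advAt_smul, Pi.smul_apply, smul_eq_mul]; ring
      rw [this]
      have := mul_le_mul_of_nonneg_left hinner hs₀.le
      linarith
    have h5 := abs_PsiN_sub_le_of_eq_sum (fun j => hmeas.H_meas (t j • α)) hWβ hW hf₁m hf₁b h1
    have := (abs_le.1 h5).1
    linarith
  exact ⟨f₁, G, hballf₁, hG0, hGle, hVle, hPsi⟩

/-- A small penalized criterion forces small conditional moments. -/
lemma exists_integral_vecSq_m_le (hA : 0 < A) (hB : 0 < B) (hL : 0 < L)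
    (hmeas : MeasurableSpaces H F α₀ A B L) (hnorm : Normalized Q H F A B)
    (hspaces : IdentifiabilityAndSpaces Q H F α₀ αinit A L ηL ηS cS) {K R C Λ CL : ℝ}
    (hK : 1 ≤ K) (hR : 0 ≤ R) (hC : 0 < C) (hΛ : 0 ≤ Λ) (hCL : 0 ≤ CL) :
    ∃ C' : ℝ, 0 < C' ∧ ∀ (n : ℕ) (D : Fin n → Obs q) (δ lam : ℝ) (α : H.carrier),
      0 < δ → δ ≤ 1 → 0 ≤ lam → lam ≤ Λ * δ ^ 2 → ηL n ≤ CL * δ ^ 2 →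
      GoodSample Q H (F n) α₀ αinit A B L (cS / 2) K δ D → H.norm α ≤ R →
      (∀ f : Adv (F n), PsiN D α f - empWeightSq D αinit f - lam * normF f ^ 2 ≤ C * δ ^ 2) →
      ∫ x, vecSq (m Q α) x ∂(lawX Q) ≤ C' * δ ^ 2 := by
  have hcS := hspaces.cS_pos
  obtain ⟨Ci, hCi1, hCi⟩ := exists_abs_W_le hA hnorm αinit
  obtain ⟨s₀, G₀, Cc, hs₀, hG₀, hCc0, htest⟩ :=
    exists_test_function hA hB hL hmeas hnorm hspaces hK hR hCL
  obtain ⟨u, C', hu0, hu1, hC'0, hfin⟩ := exists_moment_bound (s₀ := s₀) (N := 8 * Ci ^ 2 + cS / 2)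
    (a := Cc * K * √8) (b := Cc * K) (e := cS / 2 * K ^ 2 + Λ * B) (C := C)
    (G₀ := G₀) hs₀ (by positivity) (by positivity) (by positivity) hC hG₀
  refine ⟨C', hC'0, ?_⟩
  intro n D δ lam α hδ hδ1 hlam0 hlam hηL hD hα hcrit
  obtain ⟨f₁, G, hballf₁, hG0, hGle, hVle, hPsi⟩ := htest n D δ α hδ hδ1 hηL hD hα
  have hX0 : 0 ≤ ∫ x, vecSq (m Q α) x ∂(lawX Q) := integral_nonneg fun x => vecSq_nonneg _ _
  set V := ∫ x, vecSq (advAt f₁) x ∂(lawX Q) with hV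
  have hV0 : 0 ≤ V := integral_nonneg fun x => vecSq_nonneg _ _
  have hf₁b : ∀ᵐ x ∂(lawX Q), ∀ k, |advAt f₁ x k| ≤ 1 := by
    filter_upwards [hnorm.F_bound n] with x hx k using abs_advAt_le (hx f₁ hballf₁) k
  have hE : empWeightSq D αinit f₁ + lam * normF f₁ ^ 2 ≤
      (8 * Ci ^ 2 + cS / 2) * V + (cS / 2 * K ^ 2 + Λ * B) * δ ^ 2 := by
    have h1 := (abs_le.1 (hD.quadratic f₁ hballf₁)).2
    have h2 := integral_wComb_sq_le hCi (measurable_advAt (hmeas.F_meas n) f₁) hf₁b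
    have h3 : max V ((K * δ) ^ 2) ≤ V + (K * δ) ^ 2 :=
      max_le (by nlinarith [sq_nonneg (K * δ)]) (by linarith)
    have h4 := mul_le_mul_of_nonneg_left h3 (by positivity : 0 ≤ cS / 2)
    have h5 : lam * normF f₁ ^ 2 ≤ Λ * δ ^ 2 * B :=
      mul_le_mul hlam hballf₁ (sq_nonneg _) (by positivity)
    linarith
  refine hfin δ V _ G hV0 hX0 hG0 hVle hGle ?_
  -- The criterion is tested at a small multiple of the aligned adversary rather than at the
  -- adversary itself.
  have h1 := hcrit (u • f₁)
  rw [PsiN_smul, empWeightSq_smul, normF_smul hu0.le, mul_pow] at h1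
  have h2 := mul_le_mul_of_nonneg_left hPsi hu0.le
  have h3 := mul_le_mul_of_nonneg_left hE (sq_nonneg u)
  linarith

end Estimator

/-! ### Convergence of the estimator -/

section Convergence

variable {q : ℕ} {Q : Measure (Obs q)} {H : NormedFunctionSpace (Param q)}
  {F : ℕ → Fin 8 → NormedFunctionSpace ((Fin q → ℝ) → ℝ)} {α₀ αinit : H.carrier}
  {A B L ηS cS : ℝ} {ηL η lam mu δbar δ : ℕ → ℝ}

/-- The logarithmic summand keeps `δ n` strictly above the critical radii and `n * δ n ^ 2` bounded
away from zero; the latter is what the Chebyshev steps need. -/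
lemma Parameters.exists_lower_bound (hparam : Parameters Q H F α₀ A B L ηL η lam mu δbar δ) :
    ∃ c₀ : ℝ, 0 < c₀ ∧ ∀ n : ℕ, 0 < n → 0 < δ n ∧ δbar n < δ n ∧ c₀ ≤ n * δ n ^ 2 := by
  obtain ⟨C, ζ, hC, hζ0, hζ1, hδ⟩ := hparam.delta
  have hlog : 0 < Real.log (1 / ζ) := Real.log_pos (by rw [lt_div_iff₀ hζ0]; linarith)
  refine ⟨C ^ 2 * Real.log (1 / ζ), by positivity, fun n hn => ?_⟩
  have hn' : (0 : ℝ) < n := Nat.cast_pos.2 hn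
  have hbar : 0 ≤ δbar n := (criticalRadius_nonneg _ _ _).trans (hparam.radius_F n)
  have hr : 0 < C * √(Real.log (1 / ζ) / n) := by positivity
  have h1 : C * √(Real.log (1 / ζ) / n) ≤ δ n := by rw [hδ n]; linarith
  refine ⟨hr.trans_le h1, by rw [hδ n]; linarith, ?_⟩
  have h2 := pow_le_pow_left₀ hr.le h1 2
  rw [mul_pow, Real.sq_sqrt (by positivity), ← mul_div_assoc, div_le_iff₀ hn'] at h2
  linarith


lemma Parameters.exists_rates (hηL : ∀ n, 0 < ηL n)
    (hparam : Parameters Q H F α₀ A B L ηL η lam mu δbar δ) :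
    ∃ cl Λ cm Cm Ce CL : ℝ, 0 < cl ∧ 0 < Λ ∧ 0 < cm ∧ 0 < Cm ∧ 0 < Ce ∧ 0 < CL ∧
      ∀ᶠ n in atTop, 0 < n ∧ δ n ≤ 1 ∧ cl * δ n ^ 2 ≤ lam n ∧ lam n ≤ Λ * δ n ^ 2 ∧
        cm * δ n ^ 2 ≤ mu n ∧ mu n ≤ Cm * δ n ^ 2 ∧ η n ≤ Ce * δ n ^ 2 ∧
        ηL n ≤ CL * δ n ^ 2 := by
  have hmu := hparam.mu_delta
  have hlam := hparam.lam_mu.trans hmu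
  have hη := hparam.η_lam.trans hlam
  have hL := hparam.ηL_le.trans_isTheta hη
  obtain ⟨c₁, hc₁, h₁⟩ := hlam.2.exists_pos
  obtain ⟨c₂, hc₂, h₂⟩ := hlam.1.exists_pos
  obtain ⟨c₃, hc₃, h₃⟩ := hmu.2.exists_pos
  obtain ⟨c₄, hc₄, h₄⟩ := hmu.1.exists_pos
  obtain ⟨c₅, hc₅, h₅⟩ := hη.1.exists_pos
  obtain ⟨c₆, hc₆, h₆⟩ := hL.exists_pos
  have hδ0 : Tendsto (fun n => δ n ^ 2) atTop (𝓝 0) := hη.2.trans_tendsto hparam.η_tendsto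
  refine ⟨c₁⁻¹, c₂, c₃⁻¹, c₄, c₅, c₆, by positivity, hc₂, by positivity, hc₄, hc₅, hc₆, ?_⟩
  filter_upwards [eventually_gt_atTop 0, hδ0.eventually_le_const one_pos, h₁.bound, h₂.bound,
    h₃.bound, h₄.bound, h₅.bound, h₆.bound] with n hn hδ1 k₁ k₂ k₃ k₄ k₅ k₆
  have hn2 : ‖δ n ^ 2‖ = δ n ^ 2 := Real.norm_of_nonneg (sq_nonneg _)
  rw [hn2] at k₁ k₂ k₃ k₄ k₅ k₆
  rw [Real.norm_of_nonneg (hparam.lam_pos n).le] at k₁ k₂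
  rw [Real.norm_of_nonneg (hparam.mu_pos n).le] at k₃ k₄
  rw [Real.norm_of_nonneg (hparam.η_pos n).le] at k₅
  rw [Real.norm_of_nonneg (hηL n).le] at k₆
  refine ⟨hn, ?_, ?_, k₂, ?_, k₄, k₅, k₆⟩
  · exact (le_abs_self _).trans ((sq_le_one_iff_abs_le_one _).1 hδ1)
  · rwa [inv_mul_le_iff₀ hc₁]
  · rwa [inv_mul_le_iff₀ hc₃]

variable [IsProbabilityMeasure Q]

/-- Samples are good with probability close to one. -/
lemma exists_measure_not_goodSample_le (hA : 0 < A) (hB : 0 < B) (hL : 0 < L)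
    (hmeas : MeasurableSpaces H F α₀ A B L) (hnorm : Normalized Q H F A B)
    (hparam : Parameters Q H F α₀ A B L ηL η lam mu δbar δ) {θ ζ : ℝ} (hθ : 0 < θ) (hζ : 0 < ζ) :
    ∃ K : ℝ, 1 ≤ K ∧ ∀ n : ℕ, 0 < n →
      sampleLaw Q n {D | ¬ GoodSample Q H (F n) α₀ αinit A B L θ K (δ n) D} ≤
        ENNReal.ofReal ζ := by
  obtain ⟨c₀, hc₀, hlow⟩ := hparam.exists_lower_bound
  obtain ⟨C, hC1, hC⟩ := exists_abs_W_le hA hnorm α₀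
  obtain ⟨C', hC'1, hC'⟩ := exists_abs_W_le hA hnorm αinit
  have hζ3 : 0 < ζ / 3 := by positivity
  obtain ⟨K₁, hK₁, h₁⟩ := exists_measure_scalar_deviation_le Q hc₀ hζ3
  obtain ⟨K₂, hK₂, h₂⟩ := exists_measure_weighted_deviation_le Q 8 measurable_obsX hc₀ hζ3
    (zero_le_one.trans hC1)
  obtain ⟨K₃, hK₃, h₃⟩ := exists_measure_weighted_sq_deviation_le Q 8 measurable_obsX hc₀ hζ3
    (zero_le_one.trans hC'1) hθ
  set K := max K₁ (max K₂ K₃) with hK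
  have hKK₁ : K₁ ≤ K := le_max_left _ _
  have hKK₂ : K₂ ≤ K := (le_max_left _ _).trans (le_max_right _ _)
  have hKK₃ : K₃ ≤ K := (le_max_right _ _).trans (le_max_right _ _)
  refine ⟨K, hK₁.trans hKK₁, fun n hn => ?_⟩
  obtain ⟨hδ, hδbar, hnδ⟩ := hlow n hn
  have hFm := hmeas.F_meas n
  have hne : ∀ k, (advBall (F n) B k).Nonempty := fun k =>
    ⟨_, 0, by rw [normF_zero]; simpa using hB.le, rfl⟩
  have hballm : ∀ k, ∀ g ∈ advBall (F n) B k, Measurable g := by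
    rintro k _ ⟨f, -, rfl⟩
    exact hFm k (f k)
  have hballb : ∀ k, ∀ g ∈ advBall (F n) B k, ∀ᵐ x ∂(lawX Q), |g x| ≤ 1 := by
    rintro k _ ⟨f, hf, rfl⟩
    filter_upwards [hnorm.F_bound n] with x hx using abs_advAt_le (hx f hf) k
  have hrad := localRademacher_le_sq (lawX Q) n (advBall (F n) B)
    ((hparam.radius_F n).trans_lt hδbar)
  have e₁ := h₁ n (δ n) (productClass (F n) H α₀ A B L) hn hδ hnδ
    ⟨_, 0, 0, by simpa using hA.le, by rw [normF_zero]; simpa using hB.le,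
      by rw [normF_zero]; exact mul_nonneg hL.le (apply_nonneg _ _), rfl⟩
    (hmeas.class_sep n)
    (by
      rintro _ ⟨α, f, -, -, -, rfl⟩
      have h4 := measurable_W (hmeas.H_meas α)
      have h5 := measurable_advAt hFm f
      have h6 := measurable_obsX (q := q)
      unfold dotProduct
      fun_prop)
    (by
      rintro _ ⟨α, f, hα, hf, -, rfl⟩
      filter_upwards [hnorm.H_bound, ae_of_ae_map measurable_obsX.aemeasurable
        (hnorm.F_bound n)] with z h4 h5
      have h6 : (wComb (α : Param q).W (advAt f ∘ obsX) z) ^ 2 ≤ _ :=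
        wComb_sq_le (f := advAt f ∘ obsX) (h4 α hα).2
      have h7 : vecSq (advAt f ∘ obsX) z ≤ 1 := h5 f hf
      -- Eight residuals bounded by one and an adversary of length at most one give a square of at
      -- most 8, hence the bound 3.
      refine abs_le_of_sq_le_sq (h6.trans ?_) (by norm_num)
      push_cast
      linarith)
    (localRademacher_le_sq Q n (fun _ : Fin 1 => productClass (F n) H α₀ A B L)
      ((hparam.radius_class n).trans_lt hδbar) 0)
  have e₂ := h₂ n (δ n) (advBall (F n) B) (α₀ : Param q).W hn hδ hnδ hne (hmeas.F_sep n) hballm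
    hballb hrad (measurable_W (hmeas.H_meas α₀)) hC
  have e₃ := h₃ n (δ n) (advBall (F n) B) (αinit : Param q).W hn hδ hnδ hne (hmeas.F_sep n) hballm
    hballb hrad (measurable_W (hmeas.H_meas αinit)) hC'
  have e₀ : sampleLaw Q n {D | ¬ ∀ i, ∀ f : Adv (F n), normF f ^ 2 ≤ B →
      ∑ k, advAt f (obsX (D i)) k ^ 2 ≤ 1} = 0 :=
    ae_iff.1 (ae_sampleLaw (ae_of_ae_map measurable_obsX.aemeasurable (hnorm.F_bound n)))
  have hint : ∀ f : Adv (F n), ∫ z, vecSq (advAt f ∘ obsX) z ∂Q =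
      ∫ x, vecSq (advAt f) x ∂(lawX Q) := fun f =>
    integral_comp_obsX (f := vecSq (advAt f)) (by
      have := measurable_advAt hFm f
      unfold vecSq
      fun_prop)
  refine (measure_mono (t := _ ∪ (_ ∪ (_ ∪ _))) fun D hD => ?_).trans
    ((measure_union_le _ _).trans (add_le_add e₀.le ((measure_union_le _ _).trans
      (add_le_add e₁ ((measure_union_le _ _).trans (add_le_add e₂ e₃)))))) |>.trans ?_
  · by_contra hcon
    simp only [Set.mem_union, Set.mem_ofPred_eq, not_or, not_not] at hcon
    obtain ⟨g₀, g₁, g₂, g₃⟩ := hcon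
    refine hD ⟨g₀, fun g hg => (g₁ g hg).trans ?_, fun f hf => ?_, fun f hf => ?_⟩
    · have : 0 ≤ max (√(∫ z, g z ^ 2 ∂Q)) (δ n) := le_max_of_le_right hδ.le
      gcongr
    · refine (g₂ (advAt f) fun k => ⟨f, hf, rfl⟩).trans ?_
      rw [hint]
      have : 0 ≤ max (√(∫ x, vecSq (advAt f) x ∂(lawX Q))) (δ n) := le_max_of_le_right hδ.le
      gcongr
    · rw [empWeightSq_eq]
      refine (g₃ (advAt f) fun k => ⟨f, hf, rfl⟩).trans ?_
      rw [hint]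
      have : 0 ≤ K₃ := by linarith
      gcongr
  · rw [zero_add, ← ENNReal.ofReal_add hζ3.le hζ3.le, ← ENNReal.ofReal_add hζ3.le (by positivity)]
    refine ENNReal.ofReal_le_ofReal (le_of_eq (by ring))

/-- With probability close to one, the estimator lies in a fixed ball, and its error is at most a
multiple of the local modulus of continuity. -/
lemma exists_measure_estimator_error_le {αhat : ∀ n, (Fin n → Obs q) → H.carrier}
    (hA : 0 < A) (hB : 0 < B) (hL : 0 < L)
    (hmeas : MeasurableSpaces H F α₀ A B L) (hnorm : Normalized Q H F A B)
    (hspaces : IdentifiabilityAndSpaces Q H F α₀ αinit A L ηL ηS cS)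
    (hcrit : SampleCriterion Q H F αinit lam mu η αhat)
    (hparam : Parameters Q H F α₀ A B L ηL η lam mu δbar δ)
    (hcurv : ∀ M₀ ε : ℝ, 0 < M₀ → 0 < ε → LocalCurvature Q H α₀ M₀ ε)
    {M₀ ε : ℝ} (hε : 0 < ε) (hM₀ : H.norm α₀ ^ 2 < M₀) (hM₀' : normL2 Q (α₀ : Param q) < M₀)
    {ζ : ℝ} (hζ : 0 < ζ) :
    ∃ R C : ℝ, 0 ≤ R ∧ 0 < C ∧ ∀ᶠ n in atTop, sampleLaw Q n {D | ¬ (H.norm (αhat n D) ≤ R ∧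
      normL2 Q (αhat n D - α₀ : H.carrier) ≤
        C * modulus Q H α₀ (δ n) (localSpace Q H α₀ M₀ ε))} ≤ ENNReal.ofReal ζ := by
  have hcS := hspaces.cS_pos
  have hζ2 : 0 < ζ / 2 := by positivity
  obtain ⟨K', hK', hopt⟩ := hcrit (ζ / 2) hζ2
  obtain ⟨K, hK, hgood⟩ := exists_measure_not_goodSample_le (αinit := αinit) hA hB hL hmeas hnorm
    hparam (half_pos hcS) hζ2
  obtain ⟨c₀, -, hlow⟩ := hparam.exists_lower_bound
  obtain ⟨cl, Λ, cm, Cm, Ce, CL, hcl, hΛ, hcm, hCm, hCe, hCL, hrates⟩ :=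
    hparam.exists_rates hspaces.ηL_pos
  obtain ⟨R, C₂, hR, hC₂, hest⟩ := exists_estimator_bound hA hB hmeas hnorm hspaces hcl hcm hCm.le
    hK (by positivity : 0 ≤ K' * Ce)
  obtain ⟨C₄, hC₄, hmom⟩ := exists_integral_vecSq_m_le hA hB hL hmeas hnorm hspaces hK hR hC₂
    hΛ.le hCL.le
  have ha₀ : 0 ≤ H.norm α₀ := apply_nonneg _ _
  obtain ⟨E, hE1, hE⟩ := exists_bound_on_ball hA hnorm (add_nonneg hR ha₀)
  -- Curvature is invoked on a local space containing the whole ball of radius `R`, not on the one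
  -- of the conclusion; the passage between them is left to the homogeneity of the modulus.
  obtain ⟨cv, hcv, hcurv'⟩ := hcurv (√E + R ^ 2 + 1) (√E + 1) (by positivity) (by positivity)
  obtain ⟨C₅, hC₅, hmod⟩ := exists_normL2_le_modulus (K := cv * √(cS⁻¹ * C₄)) hA hmeas.H_meas
    hnorm hε hM₀ hM₀' hR
  refine ⟨R, C₅, hR, hC₅, ?_⟩
  filter_upwards [hopt, hrates] with n hn ⟨hn0, hδ1, r₁, r₂, r₃, r₄, r₅, r₆⟩
  obtain ⟨hδ, -, -⟩ := hlow n hn0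
  refine (measure_mono (t := _ ∪ _) fun D hD => ?_).trans
    ((measure_union_le _ _).trans (add_le_add (hgood n hn0) hn)) |>.trans ?_
  · by_contra hcon
    simp only [Set.mem_union, Set.mem_ofPred_eq, not_or, not_not, not_lt] at hcon
    obtain ⟨g₁, g₂⟩ := hcon
    obtain ⟨hball, hpen⟩ := hest n D (δ n) (lam n) (mu n) (αhat n D) hδ r₁ r₃ r₄ g₁ (by
      refine g₂.trans ?_
      have := mul_le_mul_of_nonneg_left r₅ hK'.le
      linarith)
    refine hD ⟨hball, ?_⟩
    set α := αhat n D with hα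
    have hX := hmom n D (δ n) (lam n) α hδ hδ1 (hparam.lam_pos n).le r₂ r₆ g₁ hball hpen
    have hαE : ∀ᵐ z ∂Q, (α : Param q).sqAt (obsX z) (obsG z) ≤ E ∧
        ∀ k, |(α : Param q).W z k| ≤ E :=
      hE.mono fun z hz => hz α (by linarith)
    have hdE : ∀ᵐ z ∂Q, ((α - α₀ : H.carrier) : Param q).sqAt (obsX z) (obsG z) ≤ E :=
      hE.mono fun z hz => (hz _ ((map_sub_le_add _ _ _).trans (by linarith))).1
    have hPhi := Phi_le (α₀ := (α₀ : Param q)) (hmeas.H_meas α) hcS (hαE.mono fun _ h => h.2)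
      (hspaces.nondegenerate α₀ (by
        rw [sub_self]
        have : normL2 Q ((0 : H.carrier) : Param q) = 0 := by simp [normL2, Param.sqAt]
        rw [this]; exact hspaces.ηS_pos.le) (by simpa using hspaces.ηS_pos.le))
    have hsE : 0 ≤ √E := Real.sqrt_nonneg _
    have hps := hcurv' α ⟨(normL2_le_of_sqAt_le hdE).trans (by linarith),
      (normL2_le_of_sqAt_le (hαE.mono fun _ h => h.1)).trans (by nlinarith [sq_nonneg R]),
      by nlinarith [pow_le_pow_left₀ (apply_nonneg H.norm α) hball 2]⟩
    refine hmod (δ n) hδ.le α hball (hps.trans ?_)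
    rw [mul_assoc]
    refine mul_le_mul_of_nonneg_left ?_ hcv.le
    rw [← Real.sqrt_sq hδ.le, ← Real.sqrt_mul (by positivity)]
    refine Real.sqrt_le_sqrt (hPhi.trans ?_)
    rw [mul_assoc]
    exact mul_le_mul_of_nonneg_left hX (by positivity)
  · rw [← ENNReal.ofReal_add hζ2.le hζ2.le, add_halves]

end Convergence

end InvalidIVPricing

end

/-! ### The regret bound. -/

theorem mainTheorem2 {Ω : Type*} [MeasurableSpace Ω] [StandardBorelSpace Ω]
    (μ : Measure Ω) [IsProbabilityMeasure μ] {q r : ℕ}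
    -- revenue and price models with the identification assumptions
    (M : PricingModel Ω q r) (hM : M.IsMeasurableModel) (hmodel : M.SatisfiesModels μ)
    (hident : PricingModel.Identification μ hM)
    -- the law of an observation, function spaces, true parameter, initial guess and estimator
    (Q : Measure (Obs q)) [IsProbabilityMeasure Q] (hQ : Q = μ.map M.Z)
    (H : NormedFunctionSpace (Param q))
    (F : ℕ → Fin 8 → NormedFunctionSpace ((Fin q → ℝ) → ℝ))
    (α₀ αinit : H.carrier) (hα₀ : (α₀ : Param q).IsTrue M μ)
    (αhat : ∀ n, (Fin n → Obs q) → H.carrier)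
    -- technical assumptions
    (A B L ηS cS : ℝ) (hA : 0 < A) (hB : 0 < B) (hL : 0 < L)
    (ηL η lam mu δbar δ : ℕ → ℝ)
    (hmeas : MeasurableSpaces H F α₀ A B L)
    (hnorm : Normalized Q H F A B)
    (hspaces : IdentifiabilityAndSpaces Q H F α₀ αinit A L ηL ηS cS)
    (hcrit : SampleCriterion Q H F αinit lam mu η αhat)
    (hparam : Parameters Q H F α₀ A B L ηL η lam mu δbar δ)
    (hcurv : ∀ M₀ ε : ℝ, 0 < M₀ → 0 < ε → LocalCurvature Q H α₀ M₀ ε)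
    -- strict concavity of the expected revenue in the price
    (c : ℝ) (hc : 0 < c) (hconc : ∀ᵐ x ∂(lawX Q), c ≤ -(α₀ : Param q).β2 x)
    -- the local space, with `α₀` inside its norm bounds
    (M₀ ε : ℝ) (hε : 0 < ε) (hM₀ : H.norm α₀ ^ 2 < M₀) (hM₀' : normL2 Q (α₀ : Param q) < M₀)
    -- an optimal policy
    (πstar : (Fin q → ℝ) → ℝ) (hπ : M.IsOptimal μ πstar) :
    IsBigOp (sampleLaw Q)
      (fun n D => M.value μ πstar - M.value μ ((αhat n D : Param q).policy M.p1 M.p2))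
      (fun n => modulus Q H α₀ (δ n) (localSpace Q H α₀ M₀ ε)) := by
  intro ζ hζ
  obtain ⟨R, C, hR, hC, hest⟩ := exists_measure_estimator_error_le hA hB hL hmeas hnorm hspaces
    hcrit hparam hcurv hε hM₀ hM₀' hζ
  have ha₀ : 0 ≤ H.norm α₀ := apply_nonneg _ _
  obtain ⟨E, hE1, hE⟩ := exists_bound_on_ball hA hnorm (add_nonneg hR ha₀)
  obtain ⟨hp0, hp12, -⟩ := hmodel.price_range
  have hp2 : 0 ≤ M.p2 := hp0.trans hp12
  set K := 2 * ((2 + 4 * E / c) * (M.p2 + M.p2 ^ 2)) with hK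
  have hK0 : 0 ≤ K := by positivity
  -- `K` vanishes when `M.p2 = 0`, so 1 is added to keep the constant positive.
  refine ⟨(K + 1) * C, by positivity, ?_⟩
  filter_upwards [hest] with n hn
  refine (measure_mono fun D hD hgood => ?_).trans hn
  obtain ⟨hball, herr⟩ := hgood
  have hreg := regret_le hM hmodel hQ hα₀ (hmeas.H_meas α₀) (hmeas.H_meas (αhat n D)) hc hE1
    (hE.mono fun z hz => (hz α₀ (by linarith)).1)
    (hE.mono fun z hz => (hz (αhat n D - α₀) ((map_sub_le_add _ _ _).trans (by linarith))).1)
    hconc hπ.1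
  have hopt := hπ.2 _ (isPolicy_policy hmodel (hmeas.H_meas (αhat n D)))
  rw [Set.mem_ofPred_eq, ← not_le] at hD
  refine hD ?_
  -- The plug-in rule is itself a policy, so optimality makes the regret nonnegative.
  rw [abs_of_nonneg (sub_nonneg.2 hopt)]
  have hn0 : 0 ≤ normL2 Q (αhat n D - α₀ : H.carrier) := Real.sqrt_nonneg _
  calc _ ≤ K * normL2 Q (αhat n D - α₀ : H.carrier) := hreg
    _ ≤ (K + 1) * normL2 Q (αhat n D - α₀ : H.carrier) := by linarith
    _ ≤ (K + 1) * (C * modulus Q H α₀ (δ n) (localSpace Q H α₀ M₀ ε)) := by gcongr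
    _ = _ := by ring
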